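/- Let $n$ be even and let $(X_{i,j})_{i\ne j}$, $i,j\in[n]$, be independent uniform random variables on $[0,1]$; person $i$ prefers $a$ to $b$ if $X_{i,a}<X_{i,b}$. For a perfect matching $\Pi$ of $[n]$ (with $\Pi(i)$ the partner of $i$), $\Pi$ is stable if for every unmatched pair $i\neq j$ one has $X_{i,\Pi(i)}<X_{i,j}$ or $X_{j,\Pi(j)}<X_{j,i}$. Write $\mathbb P(\,\cdot\,|\,\Pi)$ for the probability conditioned on the event that $\Pi$ is stable, and write $\Pi_i$ inside a probability for the event that $\Pi_i$ is stable. With $x_i=X_{i,\Pi(i)}$ let $\mathcal G_\Pi$ be the event that $$\Big|\sum_i x_i-\sqrt n\Big|\le 10\log n,\quad \max_i x_i\le \frac{\log^2 n}{\sqrt n},\quad \Big|\sum_{\{i,j\}\in\Pi}x_ix_j-\tfrac12\Big|\le n^{-1/3},\quad \Big|\sum_i x_i^2-2\Big|\le n^{-1/3}.$$ There are absolute constants $C>0$, $p\in\mathbb N$ such that for all sufficiently large even $n$ and every perfect matching $\Pi$ of $[n]$ the following hold. (1) Let $1\le k\le n^{1/6}$ and let $\Pi_1,\dots,\Pi_k$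 be perfect matchings such that each $\Pi_i\triangle\Pi$ is a single cycle of length at most $n^{1/4}$ and these cycles are mutually disjoint. Then $$\Big|\mathbb P(\Pi_1,\dots,\Pi_k,\mathcal G_\Pi\,|\,\Pi)-\prod_{i=1}^k\mathbb P(\Pi_i,\mathcal G_\Pi\,|\,\Pi)\Big|\le C(\log n)^p\,k\,n^{-1/3}\prod_{i=1}^k\mathbb P(\Pi_i,\mathcal G_\Pi\,|\,\Pi).$$ (2) Let $\Pi_1,\Pi_2$ be perfect matchings with $|\Pi_1\triangle\Pi|,|\Pi_2\triangle\Pi|\le n^{1/4}$ such that no $i$ has both $\Pi_1(i)\ne\Pi(i)$ and $\Pi_2(i)\neq\Pi(i)$. Then $$\Big|\mathbb P(\Pi_1,\Pi_2,\mathcal G_\Pi\,|\,\Pi)-\mathbb P(\Pi_1,\mathcal G_\Pi\,|\,\Pi)\,\mathbb P(\Pi_2,\mathcal G_\Pi\,|\,\Pi)\Big|\le C(\log n)^p\,n^{-1/3}\;\mathbb P(\Pi_1,\mathcal G_\Pi\,|\,\Pi)\,\mathbb P(\Pi_2,\mathcal G_\Pi\,|\,\Pi).$$ -/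

import Mathlib

open MeasureTheory ProbabilityTheory Filter

/-- A perfect matching of the `n` people `Fin n`: every person is assigned a partner other than
themselves, and the partner of the partner of `i` is `i`. -/
@[ext]
structure PerfectMatching (n : ℕ) where
  partner : Fin n → Fin n
  partner_partner : ∀ i, partner (partner i) = i
  partner_ne : ∀ i, partner i ≠ i

namespace PerfectMatching

variable {n : ℕ}

/-- The graph on the people whose edges are the matched pairs. -/
def graph (M : PerfectMatching n) : SimpleGraph (Fin n) where
  Adj i j := M.partner i = j
  symm := ⟨fun i j h => by rw [← h]; exact M.partner_partner i⟩
  loopless := ⟨fun i h => M.partner_ne i h⟩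

/-- The symmetric difference of two matchings, as a graph: the pairs that are matched in exactly
one of the two. -/
def diffGraph (M M' : PerfectMatching n) : SimpleGraph (Fin n) :=
  symmDiff M.graph M'.graph

/-- The event that the matching `M` is stable. Person `i` prefers `a` to `b` when
`X i a < X i b`; `M` is stable when in every unmatched pair `i, j` at least one of the two prefers
their partner in `M` to the other member of the pair. -/
def stable (M : PerfectMatching n) : Set (Fin n → Fin n → ℝ) :=
  {X | ∀ i j, i ≠ j → M.partner i ≠ j →
    X i (M.partner i) < X i j ∨ X j (M.partner j) < X j i}

/-- The quasirandomness event of the matching `M`, a condition on the numbers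
`x i = X i (M.partner i)`. The third sum runs over the unordered pairs of `M`, each counted once,
at its smaller element. -/
def quasirandom (M : PerfectMatching n) : Set (Fin n → Fin n → ℝ) :=
  {X | |∑ i, X i (M.partner i) - Real.sqrt n| ≤ 10 * Real.log n ∧
    (∀ i, X i (M.partner i) ≤ Real.log n ^ 2 / Real.sqrt n) ∧
    |∑ i with i < M.partner i, X i (M.partner i) * X (M.partner i) i - 1 / 2|
      ≤ (n : ℝ) ^ (-(1 / 3) : ℝ) ∧
    |∑ i, X i (M.partner i) ^ 2 - 2| ≤ (n : ℝ) ^ (-(1 / 3) : ℝ)}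

end PerfectMatching

/-- `G` consists of a single cycle of length `ℓ` (and isolated vertices): some closed walk of
length `ℓ` in `G` is a cycle and uses every edge of `G`. -/
def IsSingleCycle {V : Type*} (G : SimpleGraph V) (ℓ : ℕ) : Prop :=
  ∃ (v : V) (w : G.Walk v v), w.IsCycle ∧ w.length = ℓ ∧ ∀ e ∈ G.edgeSet, e ∈ w.edges

/-- The law of the array `(X i j)` of independent uniform random variables on `[0, 1]`.
(The diagonal entries are present, but no event below depends on them.) -/
noncomputable def prefMeasure (n : ℕ) : Measure (Fin n → Fin n → ℝ) :=
  Measure.pi fun _ => Measure.pi fun _ => volume.restrict (Set.Icc (0 : ℝ) 1)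

/-- The probability of the event `E` conditioned on the matching `M` being stable. -/
noncomputable def probGivenStable {n : ℕ} (M : PerfectMatching n)
    (E : Set (Fin n → Fin n → ℝ)) : ℝ :=
  (cond (prefMeasure n) M.stable).real E

/-! Fix the values x_i at the partners in Π. An unmatched pair {i, j} violates stability with
probability x_i x_j, independently over the pairs, so Π is stable with conditional probability ∏ (1
- x_i x_j). With S, Q and P the sum, the sum of squares and the sum of matched products, expanding
the logarithm to second order gives about exp(-S²/2 + Q/2 + P - Q²/4). On the quasirandom event Q ≈
2 and P ≈ 1/2, so this is about e^{1/2} e^{-S²/2}.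

Now let N differ from Π on a set of v people, and ask for both to be stable. A changed person has
two relevant values; if t is the larger one, the pairs formed with unchanged people contribute about
e^{-tS}, where S is now the sum over the unchanged people. The smaller value is free in (0, t), so
the person contributes ∫ t e^{-tS} dt = S^{-2}. Which of the two values is smaller must follow one
of the o admissible patterns counted by `orientations`. Pairs of two changed people matter only by a
relative error O(v² log⁴ n / n): they are dropped for the upper bound and made more restrictive for
the lower bound. What remains is e^{1/2} o ∫ e^{-S²/2} S^{-2v} over the n - v unchanged coordinates.
This integral is explicit (`orthantMass`), and its ratio to the integral for v = 0 is n^{-v/2} (1 +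
O(v²/n)) (`orthantMass_ratio`). Hence the conditional probability that N is stable and Π quasirandom
is o n^{-v/2} (1 + O(log⁴ n (n^{-1/3} + v²/n))) (`abs_probGivenStable_sub_le`).

The integration needs atypical vectors to be negligible (`setLIntegral_chiWeight_compl_typicalSet`):
a Chernoff bound in S² controls S, and near S = √n the weight is dominated by the law of independent
exponentials of rate √n, for which Chebyshev's inequality controls P and Q.

For several matchings with disjoint changes, one matching N makes all the changes (`IsCombination`),
and joint stability lies between the same two events that bound stability of Π and N. Both o and
n^{-v/2} are multiplicative over disjoint changes (`switchRate_eq`), so the joint probability and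
the product of the individual ones have the same main term. Since v ≤ 2k n^{1/4} and k ≤ n^{1/6},
one has v²/n ≤ 4k n^{-1/3}, which gives the stated error (`abs_sub_prod_le`). -/

open scoped ENNReal

/-! ### Fubini for products of one-variable functions. -/

section ProductIntegrals

theorem lintegral_fin_prod {n : ℕ} {E : Type*} [MeasurableSpace E] (μ : Fin n → Measure E)
    [∀ i, SigmaFinite (μ i)] (f : Fin n → E → ℝ≥0∞) (hf : ∀ i, Measurable (f i)) :
    ∫⁻ x, ∏ i, f i (x i) ∂(Measure.pi μ) = ∏ i, ∫⁻ t, f i t ∂(μ i) := by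
  induction n with
  | zero => simp
  | succ n ih =>
    have h := (measurePreserving_piFinSuccAbove μ 0).symm
    rw [← h.lintegral_comp (by fun_prop)]
    simp only [Fin.prod_univ_succ]
    have : ∀ z : E × (Fin n → E),
        f 0 ((MeasurableEquiv.piFinSuccAbove (fun _ => E) 0).symm z 0) *
          ∏ i : Fin n, f i.succ ((MeasurableEquiv.piFinSuccAbove (fun _ => E) 0).symm z i.succ)
        = f 0 z.1 * ∏ i : Fin n, f i.succ (z.2 i) := by
      intro z
      simp [MeasurableEquiv.piFinSuccAbove_symm_apply]
    simp only [this]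
    rw [lintegral_prod_mul (f := f 0) (g := fun y : Fin n → E => ∏ i : Fin n, f i.succ (y i))
      (hf 0).aemeasurable (Finset.measurable_fun_prod _ fun i _ =>
        (hf i.succ).comp (measurable_pi_apply i)).aemeasurable]
    congr 1
    exact ih (fun i => μ i.succ) (fun i => f i.succ) fun i => hf _

theorem lintegral_fintype_prod {ι : Type*} [Fintype ι] {E : Type*} [MeasurableSpace E]
    (μ : ι → Measure E) [∀ i, SigmaFinite (μ i)] (f : ι → E → ℝ≥0∞) (hf : ∀ i, Measurable (f i)) :
    ∫⁻ x, ∏ i, f i (x i) ∂(Measure.pi μ) = ∏ i, ∫⁻ t, f i t ∂(μ i) := by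
  let e := (Fintype.equivFin ι).symm
  have h := measurePreserving_piCongrLeft μ e
  rw [← h.lintegral_comp (by fun_prop), ← e.prod_comp, ← lintegral_fin_prod _ _ fun i => hf (e i)]
  congr 1 with x
  rw [← e.prod_comp]
  congr 1 with i
  congr 1
  exact Equiv.piCongrLeft_apply_apply ..

end ProductIntegrals

/-! ### Integrals over the orthant of functions of the coordinate sum. -/

section PositiveOrthant

/-- The open positive orthant. -/
def positiveOrthant (ι : Type*) : Set (ι → ℝ) := Set.univ.pi fun _ => Set.Ioi 0

variable {ι : Type*}

theorem mem_positiveOrthant {x : ι → ℝ} : x ∈ positiveOrthant ι ↔ ∀ i, 0 < x i := by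
  simp [positiveOrthant]

variable [Fintype ι]

theorem measurableSet_positiveOrthant : MeasurableSet (positiveOrthant ι) :=
  MeasurableSet.univ_pi fun _ => measurableSet_Ioi

theorem volume_restrict_positiveOrthant :
    (volume : Measure (ι → ℝ)).restrict (positiveOrthant ι)
      = Measure.pi fun _ => volume.restrict (Set.Ioi (0 : ℝ)) := by
  rw [volume_pi, positiveOrthant, Measure.restrict_pi_pi]

theorem setLIntegral_Ioi_zero_mul_left {a : ℝ} (ha : 0 < a) {f : ℝ → ℝ≥0∞} (hf : Measurable f) :
    ∫⁻ t in Set.Ioi 0, f t = ENNReal.ofReal a * ∫⁻ t in Set.Ioi 0, f (a * t) := by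
  have h := Real.smul_map_volume_mul_left ha.ne'
  have e : (fun t : ℝ => a * t) ⁻¹' Set.Ioi 0 = Set.Ioi 0 := by
    ext t; simp [ha]
  conv_lhs => rw [← h]
  rw [Measure.restrict_smul, lintegral_smul_measure, abs_of_pos ha,
    setLIntegral_map measurableSet_Ioi hf (by fun_prop), e, smul_eq_mul]

theorem setLIntegral_positiveOrthant_smul {a : ℝ} (ha : 0 < a) {f : (ι → ℝ) → ℝ≥0∞}
    (hf : Measurable f) :
    ∫⁻ x in positiveOrthant ι, f x
      = ENNReal.ofReal (a ^ Fintype.card ι) * ∫⁻ x in positiveOrthant ι, f (a • x) := by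
  have h := Measure.map_addHaar_smul (volume : Measure (ι → ℝ)) ha.ne'
  have e : (fun x : ι → ℝ => a • x) ⁻¹' positiveOrthant ι = positiveOrthant ι := by
    ext x; simp [mem_positiveOrthant, ha]
  have h2 : (volume : Measure (ι → ℝ))
      = ENNReal.ofReal (a ^ Fintype.card ι) • Measure.map (a • ·) volume := by
    rw [h, smul_smul, ← ENNReal.ofReal_mul (by positivity), Module.finrank_fintype_fun_eq_card,
      abs_of_pos (by positivity), mul_inv_cancel₀ (by positivity)]
    simp
  conv_lhs => rw [h2]
  rw [Measure.restrict_smul, lintegral_smul_measure,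
    setLIntegral_map measurableSet_positiveOrthant hf (by fun_prop), e, smul_eq_mul]

theorem sum_pos_of_mem_positiveOrthant [Nonempty ι] {x : ι → ℝ} (hx : x ∈ positiveOrthant ι) :
    0 < ∑ i, x i :=
  Finset.sum_pos (fun i _ => mem_positiveOrthant.1 hx i) Finset.univ_nonempty

theorem lintegral_exp_neg_sum (ι : Type*) [Fintype ι] :
    ∫⁻ x in positiveOrthant ι, ENNReal.ofReal (Real.exp (-∑ i, x i)) = 1 := by
  have : ∀ x : ι → ℝ, ENNReal.ofReal (Real.exp (-∑ i, x i))
      = ∏ i, ENNReal.ofReal (Real.exp (-x i)) := by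
    intro x
    rw [← Finset.sum_neg_distrib, Real.exp_sum, ENNReal.ofReal_prod_of_nonneg]
    intros; positivity
  simp only [this]
  rw [volume_restrict_positiveOrthant,
    lintegral_fintype_prod _ (fun _ t => ENNReal.ofReal (Real.exp (-t))) (by fun_prop)]
  have h1 : ∫⁻ t in Set.Ioi (0 : ℝ), ENNReal.ofReal (Real.exp (-t)) = 1 := by
    rw [← ofReal_integral_eq_lintegral_ofReal]
    · rw [integral_exp_neg_Ioi_zero]; simp
    · exact integrableOn_exp_neg_Ioi 0
    · exact Eventually.of_forall fun t => by positivity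
  simp [h1]

theorem lintegral_pow_mul_exp_neg (N : ℕ) (hN : 0 < N) :
    ∫⁻ t in Set.Ioi (0 : ℝ), ENNReal.ofReal (t ^ (N - 1) * Real.exp (-t))
      = ENNReal.ofReal (N - 1).factorial := by
  rw [← Real.Gamma_nat_eq_factorial, Real.Gamma_eq_integral (by positivity),
    ofReal_integral_eq_lintegral_ofReal]
  · refine setLIntegral_congr_fun measurableSet_Ioi fun t ht => ?_
    simp only [add_sub_cancel_right, Real.rpow_natCast, mul_comm]
  · exact Real.GammaIntegral_convergent (by positivity)
  · filter_upwards [ae_restrict_mem measurableSet_Ioi] with t ht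
    have : (0 : ℝ) < t := ht
    positivity

/-- Integration over the positive orthant of a function of the sum of the coordinates. -/
theorem lintegral_positiveOrthant_comp_sum [Nonempty ι] {φ : ℝ → ℝ≥0∞} (hφ : Measurable φ) :
    ENNReal.ofReal (Fintype.card ι - 1).factorial * ∫⁻ x in positiveOrthant ι, φ (∑ i, x i)
      = ∫⁻ s in Set.Ioi (0 : ℝ), ENNReal.ofReal (s ^ (Fintype.card ι - 1)) * φ s := by
  set N := Fintype.card ι with hN
  have hN0 : 0 < N := Fintype.card_pos
  have hN1 : N - 1 + 1 = N := by omega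
  set G : ℝ → ℝ≥0∞ := fun s => ENNReal.ofReal (s ^ N) * φ s with hG
  have hGm : Measurable G := by fun_prop
  -- The factorial is written as a Gamma integral in the variable u S, with S the coordinate sum.
  -- After Fubini and the scaling of x by 1/u, a second Fubini and the scaling of u by 1/S make φ
  -- depend on u alone. The x-integral is then that of e^{-S}, which is 1, and u ↦ 1/u gives the
  -- claim.
  calc _ = ∫⁻ x in positiveOrthant ι, ∫⁻ u in Set.Ioi (0 : ℝ),
        ENNReal.ofReal (u ^ (N - 1) * Real.exp (-(u * ∑ i, x i))) * G (∑ i, x i) := by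
        rw [← lintegral_const_mul _ (by fun_prop)]
        refine setLIntegral_congr_fun measurableSet_positiveOrthant fun x hx => ?_
        have hS := sum_pos_of_mem_positiveOrthant hx
        rw [← lintegral_pow_mul_exp_neg N hN0, setLIntegral_Ioi_zero_mul_left hS (by fun_prop),
          ← lintegral_const_mul _ (by fun_prop), ← lintegral_mul_const _ (by fun_prop)]
        refine setLIntegral_congr_fun measurableSet_Ioi fun u hu => ?_
        have hu : (0 : ℝ) < u := hu
        simp only [hG]
        rw [← mul_assoc, ← ENNReal.ofReal_mul (by positivity),
          ← ENNReal.ofReal_mul (by positivity)]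
        congr 2
        rw [mul_pow, ← hN1, pow_succ, mul_comm u]
        simp only [Nat.add_sub_cancel]
        ring
    _ = ∫⁻ u in Set.Ioi (0 : ℝ), ∫⁻ x in positiveOrthant ι,
        ENNReal.ofReal (u ^ (N - 1) * Real.exp (-(u * ∑ i, x i))) * G (∑ i, x i) := by
        rw [lintegral_lintegral_swap]
        fun_prop
    _ = ∫⁻ u in Set.Ioi (0 : ℝ), ∫⁻ x in positiveOrthant ι,
        ENNReal.ofReal (u⁻¹ * Real.exp (-∑ i, x i)) * G (u⁻¹ * ∑ i, x i) := by
        refine setLIntegral_congr_fun measurableSet_Ioi fun u hu => ?_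
        have hu : (0 : ℝ) < u := hu
        rw [setLIntegral_positiveOrthant_smul (inv_pos.2 hu) (by fun_prop),
          ← lintegral_const_mul _ (by fun_prop)]
        refine setLIntegral_congr_fun measurableSet_positiveOrthant fun x hx => ?_
        simp only [Pi.smul_apply, smul_eq_mul, ← Finset.mul_sum]
        rw [← mul_assoc, ← ENNReal.ofReal_mul (by positivity), ← hN]
        congr 2
        rw [mul_inv_cancel_left₀ hu.ne', ← mul_assoc]
        congr 1
        rw [← hN1, pow_succ]
        simp only [Nat.add_sub_cancel]
        rw [mul_right_comm, ← mul_pow, inv_mul_cancel₀ hu.ne', one_pow, one_mul]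
    _ = ∫⁻ x in positiveOrthant ι, ∫⁻ u in Set.Ioi (0 : ℝ),
        ENNReal.ofReal (u⁻¹ * Real.exp (-∑ i, x i)) * G (u⁻¹ * ∑ i, x i) := by
        rw [lintegral_lintegral_swap]
        fun_prop
    _ = ∫⁻ x in positiveOrthant ι, ENNReal.ofReal (Real.exp (-∑ i, x i)) *
          ∫⁻ u in Set.Ioi (0 : ℝ), ENNReal.ofReal u⁻¹ * G u⁻¹ := by
        refine setLIntegral_congr_fun measurableSet_positiveOrthant fun x hx => ?_
        have hS := sum_pos_of_mem_positiveOrthant hx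
        rw [setLIntegral_Ioi_zero_mul_left hS (by fun_prop),
          ← lintegral_const_mul _ (by fun_prop), ← lintegral_const_mul _ (by fun_prop)]
        refine setLIntegral_congr_fun measurableSet_Ioi fun u hu => ?_
        have hu : (0 : ℝ) < u := hu
        have e : ((∑ i, x i) * u)⁻¹ * ∑ i, x i = u⁻¹ := by field_simp
        rw [e, ← mul_assoc, ← mul_assoc (ENNReal.ofReal _) (ENNReal.ofReal u⁻¹),
          ← ENNReal.ofReal_mul (by positivity), ← ENNReal.ofReal_mul (by positivity)]
        congr 2
        field_simp
    _ = ∫⁻ u in Set.Ioi (0 : ℝ), ENNReal.ofReal u⁻¹ * G u⁻¹ := by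
        rw [lintegral_mul_const _ (by fun_prop), lintegral_exp_neg_sum, one_mul]
    _ = ∫⁻ u in Set.Ioi (0 : ℝ),
          ENNReal.ofReal |-(u ^ 2)⁻¹| * (ENNReal.ofReal (u⁻¹ ^ (N - 1)) * φ u⁻¹) := by
        refine setLIntegral_congr_fun measurableSet_Ioi fun u hu => ?_
        have hu : (0 : ℝ) < u := hu
        simp only [hG]
        rw [← mul_assoc, ← mul_assoc, ← ENNReal.ofReal_mul (by positivity),
          ← ENNReal.ofReal_mul (by positivity), abs_neg, abs_of_pos (by positivity)]
        congr 2
        rw [← hN1, pow_succ]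
        simp only [Nat.add_sub_cancel]
        ring
    _ = _ := by
        have h := lintegral_image_eq_lintegral_abs_deriv_mul (s := Set.Ioi (0 : ℝ))
          (f := fun u => u⁻¹) (f' := fun u => -(u ^ 2)⁻¹) measurableSet_Ioi
          (fun u hu => (hasDerivAt_inv (ne_of_gt hu)).hasDerivWithinAt)
          (inv_injective.injOn) (fun s => ENNReal.ofReal (s ^ (N - 1)) * φ s)
        rw [← h]
        congr 2
        ext s
        simp

theorem lintegral_pow_mul_exp_neg_mul_sq {N a : ℕ} (ha : a < N) {b : ℝ} (hb : 0 < b) :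
    ∫⁻ s in Set.Ioi (0 : ℝ), ENNReal.ofReal (s ^ (N - 1)) *
        ENNReal.ofReal (Real.exp (-(b * s ^ 2 / 2)) * (s ^ a)⁻¹)
      = ENNReal.ofReal ((b / 2) ^ (-(((N : ℝ) - a) / 2)) / 2 * Real.Gamma (((N : ℝ) - a) / 2)) := by
  have hN : (a : ℝ) + 1 ≤ N := by exact_mod_cast ha
  have h := integral_rpow_mul_exp_neg_mul_rpow (p := 2) (q := (N : ℝ) - a - 1) (b := b / 2)
    (by norm_num) (by linarith) (by positivity)
  have h1 : ((N : ℝ) - a - 1 + 1) / 2 = ((N : ℝ) - a) / 2 := by ring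
  rw [h1, neg_div, h1, mul_one_div] at h
  rw [← h, ofReal_integral_eq_lintegral_ofReal]
  · refine setLIntegral_congr_fun measurableSet_Ioi fun s hs => ?_
    have hs : (0 : ℝ) < s := hs
    rw [← ENNReal.ofReal_mul (by positivity)]
    congr 1
    have : ((N : ℝ) - a - 1) = ((N - 1 : ℕ) : ℝ) - (a : ℕ) := by
      rw [Nat.cast_sub (by omega)]; push_cast; ring
    rw [this, Real.rpow_sub hs, Real.rpow_natCast, Real.rpow_natCast, Real.rpow_two]
    have : -(b * s ^ 2 / 2) = -(b / 2) * s ^ 2 := by ring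
    rw [this]
    ring
  · exact integrableOn_rpow_mul_exp_neg_mul_rpow (by linarith) (by norm_num) (by positivity)
  · filter_upwards [ae_restrict_mem measurableSet_Ioi] with t ht
    have : (0 : ℝ) < t := ht
    positivity

/-- The integral of `exp (-b S ^ 2 / 2) / S ^ a` over the positive orthant, where `S` is the sum of
the coordinates. -/
theorem lintegral_exp_neg_mul_sq_sum [Nonempty ι] {a : ℕ} (ha : a < Fintype.card ι) {b : ℝ}
    (hb : 0 < b) :
    ∫⁻ x in positiveOrthant ι,
        ENNReal.ofReal (Real.exp (-(b * (∑ i, x i) ^ 2 / 2)) * ((∑ i, x i) ^ a)⁻¹)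
      = ENNReal.ofReal ((b / 2) ^ (-(((Fintype.card ι : ℝ) - a) / 2)) / 2
          * Real.Gamma (((Fintype.card ι : ℝ) - a) / 2) / (Fintype.card ι - 1).factorial) := by
  have h := lintegral_positiveOrthant_comp_sum (ι := ι)
    (φ := fun s => ENNReal.ofReal (Real.exp (-(b * s ^ 2 / 2)) * (s ^ a)⁻¹)) (by fun_prop)
  rw [lintegral_pow_mul_exp_neg_mul_sq ha hb] at h
  have h0 : ENNReal.ofReal (Fintype.card ι - 1).factorial ≠ 0 := by simp [Nat.factorial_ne_zero]
  rw [ENNReal.ofReal_div_of_pos (by positivity), ← h, mul_comm,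
    ENNReal.mul_div_cancel_right h0 ENNReal.ofReal_ne_top]

end PositiveOrthant

/-! ### Closed form of the mass and its dependence on the number of changes. -/

section Mass

/-- The integral of `exp (-S ^ 2 / 2) / S ^ a` over the positive orthant of dimension `N`, where `S`
is the sum of the coordinates. -/
noncomputable def orthantMass (N a : ℕ) : ℝ :=
  (1 / 2 : ℝ) ^ (-(((N : ℝ) - a) / 2)) / 2 * Real.Gamma (((N : ℝ) - a) / 2) / (N - 1).factorial

theorem orthantMass_pos {N a : ℕ} (h : a < N) : 0 < orthantMass N a := by
  have : (0 : ℝ) < ((N : ℝ) - a) / 2 := by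
    have : (a : ℝ) < N := by exact_mod_cast h
    linarith
  have := Real.Gamma_pos_of_pos this
  unfold orthantMass
  positivity

/-- For even N - a the Gamma value is a factorial. In the application N - a = n - 3v, which is even
because n and v are. -/
theorem orthantMass_eq {N a k : ℕ} (hk : N = a + 2 * (k + 1)) :
    orthantMass N a = 2 ^ k * k.factorial / (N - 1).factorial := by
  have h : ((N : ℝ) - a) / 2 = k + 1 := by rw [hk]; push_cast; ring
  have h2 : (1 / 2 : ℝ) ^ (-((k : ℝ) + 1)) = 2 ^ (k + 1) := by
    rw [one_div, Real.inv_rpow (by norm_num), Real.rpow_neg (by norm_num), inv_inv]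
    exact_mod_cast Real.rpow_natCast 2 (k + 1)
  rw [orthantMass, h, Real.Gamma_nat_eq_factorial, h2]
  congr 1
  ring

theorem one_sub_le_pow_div {n k m : ℝ} {j : ℕ} (hn : 0 < n) (hk : k ≤ n) (hm : j * k ≤ m) :
    n ^ j * (1 - m / n) ≤ (n - k) ^ j := by
  have h1 := one_add_mul_le_pow (a := -(k / n)) (by
    have : k / n ≤ 1 := (div_le_one hn).2 hk
    linarith) j
  have h2 : (n - k) ^ j = n ^ j * (1 + -(k / n)) ^ j := by
    rw [← mul_pow]; congr 1; field_simp; ring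
  rw [h2]
  refine mul_le_mul_of_nonneg_left (le_trans ?_ h1) (by positivity)
  have : (j * k) / n ≤ m / n := by gcongr
  have e : (j : ℝ) * -(k / n) = - ((j * k) / n) := by ring
  linarith

/-- Put n = 2h and v = 2m. The quotient of the two masses is the falling factorial of n - 1 of
length 2m divided by 2^{3m} times that of h - 1 of length 3m, hence about n^{2m} / n^{3m} = n^{-m}.
Replacing falling factorials by powers costs a relative O(m²/n) by Bernoulli's inequality. -/
theorem orthantMass_ratio {h m : ℕ} (hm : 36 * m ^ 2 ≤ 2 * h) (hh : 0 < h) :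
    (1 - 4 * (m : ℝ) ^ 2 / (2 * h : ℕ)) * orthantMass (2 * h) 0
        ≤ ((2 * h : ℕ) : ℝ) ^ m * orthantMass (2 * h - 2 * m) (2 * (2 * m)) ∧
      ((2 * h : ℕ) : ℝ) ^ m * orthantMass (2 * h - 2 * m) (2 * (2 * m))
        ≤ (1 + 36 * (m : ℝ) ^ 2 / (2 * h : ℕ)) * orthantMass (2 * h) 0 := by
  have hmh : 3 * m < h := by nlinarith
  rw [orthantMass_eq (k := h - 1) (by omega : 2 * h = _),
    orthantMass_eq (k := h - 1 - 3 * m) (by omega : 2 * h - 2 * m = _)]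
  have f1 := Nat.factorial_mul_descFactorial (n := 2 * h - 1) (k := 2 * m) (by omega)
  have f2 := Nat.factorial_mul_descFactorial (n := h - 1) (k := 3 * m) (by omega)
  have d1 := Nat.pow_sub_le_descFactorial (2 * h - 1) (2 * m)
  have d1' := Nat.descFactorial_le_pow (2 * h - 1) (2 * m)
  have d2 := Nat.pow_sub_le_descFactorial (h - 1) (3 * m)
  have d2' := Nat.descFactorial_le_pow (h - 1) (3 * m)
  rw [show 2 * h - 1 - 2 * m = 2 * h - 2 * m - 1 by omega] at f1
  rw [← f1, ← f2]
  set D1 := (2 * h - 1).descFactorial (2 * m)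
  set D2 := (h - 1).descFactorial (3 * m)
  have e1 : ((2 * h : ℕ) : ℝ) ^ (2 * m) * (1 - 4 * (m : ℝ) ^ 2 / (2 * h : ℕ)) ≤ D1 := by
    refine (one_sub_le_pow_div (k := (2 * m : ℕ)) (by positivity) (by norm_cast; omega) ?_).trans ?_
    · push_cast; nlinarith
    · rw [← Nat.cast_sub (by omega)]
      exact_mod_cast (by convert d1 using 2; omega)
  have e1' : (D1 : ℝ) ≤ ((2 * h : ℕ) : ℝ) ^ (2 * m) := by
    exact_mod_cast d1'.trans (Nat.pow_le_pow_left (by omega) _)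
  have e2 : ((2 * h : ℕ) : ℝ) ^ (3 * m) * (1 - 18 * (m : ℝ) ^ 2 / (2 * h : ℕ))
      ≤ 2 ^ (3 * m) * D2 := by
    refine (one_sub_le_pow_div (k := (6 * m : ℕ)) (by positivity) (by norm_cast; omega) ?_).trans ?_
    · push_cast; nlinarith
    · rw [← Nat.cast_sub (by omega), show 2 * h - 6 * m = 2 * (h - 1 + 1 - 3 * m) by omega]
      push_cast [mul_pow]
      gcongr
      exact_mod_cast d2
  have e2' : (2 : ℝ) ^ (3 * m) * D2 ≤ ((2 * h : ℕ) : ℝ) ^ (3 * m) := by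
    have : (D2 : ℝ) ≤ (h : ℝ) ^ (3 * m) := by
      exact_mod_cast d2'.trans (Nat.pow_le_pow_left (by omega) _)
    push_cast [mul_pow]
    gcongr
  set n : ℝ := ((2 * h : ℕ) : ℝ) with hn
  have hn0 : 0 < n := by positivity
  have hmn : 36 * (m : ℝ) ^ 2 / n ≤ 1 := by
    rw [div_le_one hn0, hn]; exact_mod_cast hm
  set t : ℝ := (m : ℝ) ^ 2 / n with ht
  have ht0 : 0 ≤ t := by positivity
  simp only [mul_div_assoc, ← ht] at *
  have hD1 : (0 : ℝ) < D1 := by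
    refine lt_of_lt_of_le ?_ e1
    have : 0 < 1 - 4 * t := by linarith
    positivity
  have hp : (2 : ℝ) ^ (h - 1) = 2 ^ (h - 1 - 3 * m) * 2 ^ (3 * m) := by
    rw [← pow_add]; congr 1; omega
  have hq : n ^ (3 * m) = n ^ m * n ^ (2 * m) := by rw [← pow_add]; congr 1; omega
  have key : ∀ c : ℝ, c * (2 ^ (h - 1) * ((((h - 1 - 3 * m).factorial * D2 : ℕ) : ℝ)
      / (((2 * h - 2 * m - 1).factorial * D1 : ℕ) : ℝ)))
      = (2 ^ (h - 1 - 3 * m) * ((h - 1 - 3 * m).factorial / ((2 * h - 2 * m - 1).factorial * D1)))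
        * (c * (2 ^ (3 * m) * D2)) := by
    intro c; rw [hp]; push_cast; ring
  have key2 : n ^ m * (2 ^ (h - 1 - 3 * m) * (((h - 1 - 3 * m).factorial : ℝ)
      / ((2 * h - 2 * m - 1).factorial : ℝ)))
      = (2 ^ (h - 1 - 3 * m) * ((h - 1 - 3 * m).factorial / ((2 * h - 2 * m - 1).factorial * D1)))
        * (n ^ m * D1) := by
    field_simp
  rw [key, key, key2]
  have hc : 0 ≤ (2 : ℝ) ^ (h - 1 - 3 * m)
      * ((h - 1 - 3 * m).factorial / ((2 * h - 2 * m - 1).factorial * D1)) := by positivity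
  have hnm : 0 ≤ n ^ m := by positivity
  have hn3 : 0 ≤ n ^ (3 * m) := by positivity
  constructor
  · refine mul_le_mul_of_nonneg_left ?_ hc
    calc (1 - 4 * t) * (2 ^ (3 * m) * D2) ≤ (1 - 4 * t) * n ^ (3 * m) :=
          mul_le_mul_of_nonneg_left e2' (by linarith)
      _ = n ^ m * (n ^ (2 * m) * (1 - 4 * t)) := by rw [hq]; ring
      _ ≤ n ^ m * D1 := mul_le_mul_of_nonneg_left e1 hnm
  · refine mul_le_mul_of_nonneg_left ?_ hc
    calc n ^ m * D1 ≤ n ^ m * n ^ (2 * m) := mul_le_mul_of_nonneg_left e1' hnm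
      _ = n ^ (3 * m) * 1 := by rw [hq]; ring
      -- The product of the two brackets is at least 1 precisely because t ≤ 1/36, which is the
      -- hypothesis on m.
      _ ≤ n ^ (3 * m) * ((1 + 36 * t) * (1 - 18 * t)) :=
          mul_le_mul_of_nonneg_left (by nlinarith) hn3
      _ = (1 + 36 * t) * (n ^ (3 * m) * (1 - 18 * t)) := by ring
      _ ≤ _ := mul_le_mul_of_nonneg_left e2 (by linarith)

end Mass

/-! ### Independent exponential variables: moments and deviations. -/

section ExponentialLaw

/-- The exponential law with rate `r`. -/
noncomputable def expLaw (r : ℝ) : Measure ℝ :=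
  (volume.restrict (Set.Ioi 0)).withDensity fun t => ENNReal.ofReal (r * Real.exp (-(r * t)))

theorem lintegral_expLaw (r : ℝ) {f : ℝ → ℝ≥0∞} (hf : Measurable f) :
    ∫⁻ t, f t ∂(expLaw r)
      = ∫⁻ t in Set.Ioi 0, ENNReal.ofReal (r * Real.exp (-(r * t))) * f t := by
  rw [expLaw, lintegral_withDensity_eq_lintegral_mul _ (by fun_prop) hf]
  rfl

theorem lintegral_pow_expLaw {r : ℝ} (hr : 0 < r) (k : ℕ) :
    ∫⁻ t, ENNReal.ofReal (t ^ k) ∂(expLaw r) = ENNReal.ofReal (k.factorial / r ^ k) := by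
  rw [lintegral_expLaw _ (by fun_prop), setLIntegral_Ioi_zero_mul_left (inv_pos.2 hr) (by fun_prop),
    ← lintegral_const_mul _ (by fun_prop), ENNReal.ofReal_div_of_pos (by positivity),
    div_eq_mul_inv, ← ENNReal.ofReal_inv_of_pos (by positivity)]
  have h := lintegral_pow_mul_exp_neg (k + 1) (by omega)
  simp only [Nat.add_sub_cancel] at h
  rw [← h, mul_comm, ← lintegral_const_mul _ (by fun_prop)]
  refine setLIntegral_congr_fun measurableSet_Ioi fun t ht => ?_
  have ht : (0 : ℝ) < t := ht
  rw [← ENNReal.ofReal_mul (by positivity), ← ENNReal.ofReal_mul (by positivity),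
    ← ENNReal.ofReal_mul (by positivity), mul_inv_cancel_left₀ hr.ne']
  congr 1
  rw [mul_pow, inv_pow]
  field_simp

theorem isProbabilityMeasure_expLaw {r : ℝ} (hr : 0 < r) : IsProbabilityMeasure (expLaw r) := by
  constructor
  simpa using lintegral_pow_expLaw hr 0

theorem ae_pos_expLaw (r : ℝ) : ∀ᵐ t ∂(expLaw r), 0 < t :=
  (withDensity_absolutelyContinuous _ _).ae_le (ae_restrict_mem measurableSet_Ioi)

theorem integrable_pow_expLaw {r : ℝ} (hr : 0 < r) (k : ℕ) :
    Integrable (fun t => t ^ k) (expLaw r) := by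
  refine ⟨by fun_prop, ?_⟩
  rw [hasFiniteIntegral_iff_ofReal, lintegral_pow_expLaw hr]
  · exact ENNReal.ofReal_lt_top
  · filter_upwards [ae_pos_expLaw r] with t ht
    positivity

theorem integral_pow_expLaw {r : ℝ} (hr : 0 < r) (k : ℕ) :
    ∫ t, t ^ k ∂(expLaw r) = k.factorial / r ^ k := by
  rw [integral_eq_lintegral_of_nonneg_ae _ (by fun_prop), lintegral_pow_expLaw hr,
    ENNReal.toReal_ofReal (by positivity)]
  filter_upwards [ae_pos_expLaw r] with t ht
  positivity

theorem memLp_pow_expLaw {r : ℝ} (hr : 0 < r) (k : ℕ) :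
    MemLp (fun t => t ^ k) 2 (expLaw r) := by
  refine (memLp_two_iff_integrable_sq (by fun_prop)).2 ?_
  simpa only [← pow_mul] using integrable_pow_expLaw hr (k * 2)

theorem expLaw_Ioi {r c : ℝ} (hr : 0 < r) (hc : 0 ≤ c) :
    expLaw r (Set.Ioi c) = ENNReal.ofReal (Real.exp (-(r * c))) := by
  rw [expLaw, withDensity_apply _ measurableSet_Ioi, Measure.restrict_restrict measurableSet_Ioi,
    Set.inter_eq_left.2 (Set.Ioi_subset_Ioi hc), ← ofReal_integral_eq_lintegral_ofReal]
  · congr 1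
    rw [integral_const_mul]
    have := integral_exp_mul_Ioi (neg_lt_zero.2 hr) c
    simp only [neg_mul] at this
    rw [this]
    field_simp
  · have := integrableOn_exp_mul_Ioi (neg_lt_zero.2 hr) c
    simp only [neg_mul] at this
    exact this.const_mul r
  · exact Eventually.of_forall fun t => by positivity

variable {ι : Type*} [Fintype ι]

theorem pi_expLaw {r : ℝ} (hr : 0 < r) :
    Measure.pi (fun _ : ι => expLaw r)
      = ((volume : Measure (ι → ℝ)).restrict (positiveOrthant ι)).withDensity
          fun x => ENNReal.ofReal (r ^ Fintype.card ι) * ENNReal.ofReal (Real.exp (-(r * ∑ i, x i))) := by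
  have := isProbabilityMeasure_expLaw hr
  refine Measure.pi_eq fun s hs => ?_
  rw [withDensity_apply _ (MeasurableSet.univ_pi hs), volume_restrict_positiveOrthant,
    Measure.restrict_pi_pi]
  have h : ∀ x : ι → ℝ, ENNReal.ofReal (r ^ Fintype.card ι)
      * ENNReal.ofReal (Real.exp (-(r * ∑ i, x i)))
      = ∏ i, ENNReal.ofReal (r * Real.exp (-(r * x i))) := by
    intro x
    rw [← ENNReal.ofReal_prod_of_nonneg (fun _ _ => by positivity),
      ← ENNReal.ofReal_mul (by positivity), Finset.prod_mul_distrib, ← Real.exp_sum,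
      Finset.sum_neg_distrib, ← Finset.mul_sum]
    simp
  simp only [h]
  rw [lintegral_fintype_prod _ (fun _ t => ENNReal.ofReal (r * Real.exp (-(r * t))))
    (by fun_prop)]
  refine Finset.prod_congr rfl fun i _ => ?_
  rw [expLaw, withDensity_apply _ (hs i)]

/-- This lets probabilistic bounds for independent exponentials be used for integrals over the
orthant. -/
theorem setLIntegral_exp_neg_mul_sum {r : ℝ} (hr : 0 < r) {B : Set (ι → ℝ)}
    (hB : MeasurableSet B) :
    ∫⁻ x in positiveOrthant ι ∩ B, ENNReal.ofReal (Real.exp (-(r * ∑ i, x i)))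
      = ENNReal.ofReal (r ^ Fintype.card ι)⁻¹ * Measure.pi (fun _ : ι => expLaw r) B := by
  rw [pi_expLaw hr, withDensity_apply _ hB, lintegral_const_mul _ (by fun_prop), ← mul_assoc,
    ← ENNReal.ofReal_mul (by positivity), inv_mul_cancel₀ (by positivity), ENNReal.ofReal_one,
    one_mul, Measure.restrict_restrict hB, Set.inter_comm]

theorem integral_eval_pow_expLaw {r : ℝ} (hr : 0 < r) (i : ι) (k : ℕ) :
    ∫ x, x i ^ k ∂(Measure.pi fun _ : ι => expLaw r) = k.factorial / r ^ k := by
  have := isProbabilityMeasure_expLaw hr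
  have h := (measurePreserving_eval (fun _ : ι => expLaw r) i)
  have h2 := integral_map (μ := Measure.pi fun _ : ι => expLaw r) (φ := Function.eval i)
    (measurable_pi_apply i).aemeasurable (f := fun t => t ^ k) (by fun_prop)
  rw [h.map_eq, integral_pow_expLaw hr] at h2
  exact h2.symm

/-- Chebyshev's inequality, with the variance of each term bounded by its second moment. -/
theorem expLaw_sum_pow_deviation {r : ℝ} (hr : 0 < r) (k : ℕ) {c : ℝ} (hc : 0 < c) :
    Measure.pi (fun _ : ι => expLaw r)
        {x | c ≤ |∑ i, x i ^ k - Fintype.card ι * (k.factorial / r ^ k)|}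
      ≤ ENNReal.ofReal (Fintype.card ι * ((2 * k).factorial / r ^ (2 * k)) / c ^ 2) := by
  have := isProbabilityMeasure_expLaw hr
  have hL := fun i : ι => memLp_pow_expLaw hr k
  have hm : ∀ i : ι, MemLp (fun x : ι → ℝ => x i ^ k) 2 (Measure.pi fun _ : ι => expLaw r) :=
    fun i => (hL i).comp_measurePreserving (measurePreserving_eval _ i)
  have hv := variance_sum_pi (μ := fun _ : ι => expLaw r) (X := fun _ t => t ^ k) hL
  have hM : MemLp (∑ i : ι, fun x : ι → ℝ => x i ^ k) 2 (Measure.pi fun _ : ι => expLaw r) :=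
    memLp_finsetSum' _ fun i _ => hm i
  have hE : ∫ x, (∑ i : ι, fun x : ι → ℝ => x i ^ k) x ∂(Measure.pi fun _ : ι => expLaw r)
      = Fintype.card ι * (k.factorial / r ^ k) := by
    simp only [Finset.sum_apply]
    rw [integral_finsetSum _ fun i _ => (hm i).integrable (by norm_num)]
    simp [integral_eval_pow_expLaw hr]
  have h := meas_ge_le_variance_div_sq hM hc
  rw [hE] at h
  simp only [Finset.sum_apply] at h
  refine h.trans (ENNReal.ofReal_le_ofReal ?_)
  gcongr
  rw [hv]
  have : Var[fun t => t ^ k; expLaw r] ≤ (2 * k).factorial / r ^ (2 * k) := by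
    refine (variance_le_expectation_sq (by fun_prop)).trans (le_of_eq ?_)
    rw [← integral_pow_expLaw hr]
    congr 1 with t
    simp only [Pi.pow_apply]
    ring
  calc _ ≤ ∑ i : ι, ((2 * k).factorial : ℝ) / r ^ (2 * k) := Finset.sum_le_sum fun i _ => this
    _ = _ := by simp

theorem card_filter_lt_involution [LinearOrder ι] {σ : ι → ι} (h1 : ∀ i, σ (σ i) = i)
    (h2 : ∀ i, σ i ≠ i) :
    2 * (Finset.univ.filter fun i => i < σ i).card = Fintype.card ι := by
  have hcard : (Finset.univ.filter fun i => i < σ i).card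
      = (Finset.univ.filter fun i => ¬ i < σ i).card := by
    refine Finset.card_nbij' σ σ ?_ ?_ ?_ ?_ <;> intro i hi <;> simp only [Finset.coe_filter,
      Finset.mem_univ, true_and, Set.mem_ofPred_eq, h1, not_lt] at hi ⊢
    · exact hi.le
    · exact lt_of_le_of_ne hi (h2 i)
  have := Finset.card_filter_add_card_filter_not (s := (Finset.univ : Finset ι)) fun i => i < σ i
  rw [← Finset.card_univ, ← this, ← hcard]
  ring

/-- Products over different pairs of the involution share no coordinate, so they are pairwise
independent and their variances add; then Chebyshev's inequality applies. -/
theorem expLaw_pair_sum_deviation [LinearOrder ι] {σ : ι → ι} (h1 : ∀ i, σ (σ i) = i)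
    (h2 : ∀ i, σ i ≠ i) {r : ℝ} (hr : 0 < r) {c : ℝ} (hc : 0 < c) :
    Measure.pi (fun _ : ι => expLaw r)
        {x | c ≤ |∑ i with i < σ i, x i * x (σ i) - Fintype.card ι / (2 * r ^ 2)|}
      ≤ ENNReal.ofReal (2 * Fintype.card ι / r ^ 4 / c ^ 2) := by
  have := isProbabilityMeasure_expLaw hr
  set μ := Measure.pi fun _ : ι => expLaw r with hμ
  have hind : iIndepFun (fun (i : ι) (x : ι → ℝ) => x i) μ :=
    iIndepFun_pi (X := fun _ t => t) fun i => by fun_prop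
  have hmom : ∀ (i : ι) (k : ℕ), ∫ x, x i ^ k ∂μ = k.factorial / r ^ k :=
    integral_eval_pow_expLaw hr
  have hint : ∀ (i : ι) (k : ℕ), Integrable (fun x : ι → ℝ => x i ^ k) μ := fun i k =>
    (measurePreserving_eval (fun _ : ι => expLaw r) i).integrable_comp_of_integrable
      (integrable_pow_expLaw hr k)
  have hpair : ∀ (i : ι) (k : ℕ), IndepFun (fun x : ι → ℝ => x i ^ k) (fun x => x (σ i) ^ k) μ := by
    intro i k
    exact (hind.indepFun (h2 i).symm).comp (φ := fun t => t ^ k) (ψ := fun t => t ^ k)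
      (by fun_prop) (by fun_prop)
  have hprod : ∀ (i : ι) (k : ℕ), ∫ x, (x i * x (σ i)) ^ k ∂μ = (k.factorial / r ^ k) ^ 2 := by
    intro i k
    simp only [mul_pow]
    rw [(hpair i k).integral_fun_mul_eq_mul_integral
      (hint i k).aestronglyMeasurable (hint (σ i) k).aestronglyMeasurable, hmom, hmom, sq]
  have hprodint : ∀ (i : ι) (k : ℕ), Integrable (fun x : ι → ℝ => (x i * x (σ i)) ^ k) μ := by
    intro i k
    simp only [mul_pow]
    exact (hpair i k).integrable_mul (hint i k) (hint (σ i) k)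
  have hm : ∀ i : ι, MemLp (fun x : ι → ℝ => x i * x (σ i)) 2 μ := fun i =>
    (memLp_two_iff_integrable_sq (by fun_prop)).2 (hprodint i 2)
  set s := Finset.univ.filter fun i => i < σ i with hs
  have hcard : (s.card : ℝ) = Fintype.card ι / 2 := by
    rw [← card_filter_lt_involution h1 h2]; push_cast; ring
  have hv := IndepFun.variance_sum (μ := μ) (s := s) (X := fun i x => x i * x (σ i))
    (fun i _ => hm i) (by
      intro i hi j hj hij
      simp only [hs, Finset.coe_filter, Finset.mem_univ, true_and, Set.mem_ofPred_eq] at hi hj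
      refine hind.indepFun_mul_mul (fun i => by fun_prop) i (σ i) j (σ j) hij ?_ ?_ ?_
      · rintro rfl
        rw [h1] at hi
        exact lt_asymm hi hj
      · rintro rfl
        rw [h1] at hj
        exact lt_asymm hi hj
      · intro h
        exact hij (by rw [← h1 i, h, h1]))
  have hM : MemLp (∑ i ∈ s, fun x : ι → ℝ => x i * x (σ i)) 2 μ :=
    memLp_finsetSum' _ fun i _ => hm i
  have hE : ∫ x, (∑ i ∈ s, fun x : ι → ℝ => x i * x (σ i)) x ∂μ
      = Fintype.card ι / (2 * r ^ 2) := by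
    simp only [Finset.sum_apply]
    rw [integral_finsetSum _ fun i _ => (hm i).integrable (by norm_num)]
    have : ∀ i ∈ s, ∫ x, x i * x (σ i) ∂μ = 1 / r ^ 2 := by
      intro i _
      simpa using hprod i 1
    rw [Finset.sum_congr rfl this, Finset.sum_const, nsmul_eq_mul, hcard]
    ring
  have h := meas_ge_le_variance_div_sq hM hc
  rw [hE] at h
  simp only [Finset.sum_apply] at h
  refine h.trans (ENNReal.ofReal_le_ofReal ?_)
  gcongr
  rw [hv]
  have : ∀ i ∈ s, Var[fun x : ι → ℝ => x i * x (σ i); μ] ≤ 4 / r ^ 4 := by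
    intro i _
    refine (variance_le_expectation_sq (by fun_prop)).trans (le_of_eq ?_)
    have := hprod i 2
    simp only [Pi.pow_apply, this]
    norm_num
    ring
  calc _ ≤ ∑ i ∈ s, 4 / r ^ 4 := Finset.sum_le_sum this
    _ = _ := by rw [Finset.sum_const, nsmul_eq_mul, hcard]; ring

theorem expLaw_exists_gt {r : ℝ} (hr : 0 < r) {c : ℝ} (hc : 0 ≤ c) :
    Measure.pi (fun _ : ι => expLaw r) {x | ∃ i, c < x i}
      ≤ ENNReal.ofReal (Fintype.card ι * Real.exp (-(r * c))) := by
  have := isProbabilityMeasure_expLaw hr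
  have e : {x : ι → ℝ | ∃ i, c < x i} = ⋃ i, Function.eval i ⁻¹' Set.Ioi c := by
    ext x; simp
  rw [e]
  refine (measure_iUnion_fintype_le _ _).trans ?_
  have : ∀ i : ι, Measure.pi (fun _ : ι => expLaw r) (Function.eval i ⁻¹' Set.Ioi c)
      = ENNReal.ofReal (Real.exp (-(r * c))) := by
    intro i
    rw [(measurePreserving_eval (fun _ : ι => expLaw r) i).measure_preimage
      measurableSet_Ioi.nullMeasurableSet, expLaw_Ioi hr hc]
  simp only [this, Finset.sum_const, Finset.card_univ, nsmul_eq_mul]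
  rw [ENNReal.ofReal_mul (by positivity), ENNReal.ofReal_natCast]

end ExponentialLaw

/-! ### Chernoff bound for the coordinate sum. -/

section Concentration

/-- The weight `exp (-s ^ 2 / 2) / s ^ a`. -/
noncomputable def chiWeight (a : ℕ) (s : ℝ) : ℝ := Real.exp (-(s ^ 2 / 2)) * (s ^ a)⁻¹

@[fun_prop]
theorem measurable_chiWeight (a : ℕ) : Measurable (chiWeight a) := by
  unfold chiWeight; fun_prop

variable {ι : Type*} [Fintype ι]

theorem lintegral_exp_neg_mul_sq_sum_eq_mul [Nonempty ι] {a : ℕ} (ha : a < Fintype.card ι) {b : ℝ}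
    (hb : 0 < b) :
    ∫⁻ x in positiveOrthant ι,
        ENNReal.ofReal (Real.exp (-(b * (∑ i, x i) ^ 2 / 2)) * ((∑ i, x i) ^ a)⁻¹)
      = ENNReal.ofReal (b ^ (-(((Fintype.card ι : ℝ) - a) / 2)))
        * ENNReal.ofReal (orthantMass (Fintype.card ι) a) := by
  rw [lintegral_exp_neg_mul_sq_sum ha hb, ← ENNReal.ofReal_mul (by positivity), orthantMass,
    div_eq_mul_one_div b, Real.mul_rpow hb.le (by norm_num)]
  congr 1
  ring

theorem lintegral_chiWeight [Nonempty ι] {a : ℕ} (ha : a < Fintype.card ι) :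
    ∫⁻ x in positiveOrthant ι, ENNReal.ofReal (chiWeight a (∑ i, x i))
      = ENNReal.ofReal (orthantMass (Fintype.card ι) a) := by
  simpa [chiWeight] using lintegral_exp_neg_mul_sq_sum_eq_mul (ι := ι) ha one_pos

/-- Lowering the coefficient of S² from 1 to 1 - 1/√n multiplies the mass by (1 - 1/√n)^{-K/2}. To
first order this is at most e^{√n/2}, which the other factor cancels; the second-order term
contributes the remaining constant. -/
theorem upper_tail_factor {n K : ℝ} (hn : 4 ≤ n) (hK0 : 0 ≤ K) (hK : K ≤ n) :
    Real.exp (-(n / √n / 2)) * (1 - 1 / √n) ^ (-(K / 2)) ≤ Real.exp 1 := by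
  have hr : 2 ≤ √n := Real.le_sqrt_of_sq_le (by linarith)
  set r := √n
  have hrn : n = r ^ 2 := (Real.sq_sqrt (by linarith)).symm
  have hl : 1 / r ≤ 1 / 2 := one_div_le_one_div_of_le (by norm_num) hr
  have hl0 : 0 < 1 / r := by positivity
  have hp : 0 < 1 - 1 / r := by linarith
  rw [Real.rpow_def_of_pos hp, ← Real.exp_add]
  apply Real.exp_le_exp.2
  have h1 := Real.one_sub_inv_le_log_of_pos hp
  have h2 : -(1 / r) - 2 * (1 / r) ^ 2 ≤ 1 - (1 - 1 / r)⁻¹ := by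
    rw [le_sub_iff_add_le, add_comm, ← le_sub_iff_add_le, inv_le_iff_one_le_mul₀ hp]
    nlinarith [mul_nonneg (sq_nonneg (1 / r)) (by linarith : 0 ≤ 1 - 2 * (1 / r))]
  have h3 : -Real.log (1 - 1 / r) ≤ 1 / r + 2 * (1 / r) ^ 2 := by linarith
  have h4 : Real.log (1 - 1 / r) * -(K / 2) ≤ (1 / r + 2 * (1 / r) ^ 2) * (n / 2) := by
    calc _ = (-Real.log (1 - 1 / r)) * (K / 2) := by ring
      _ ≤ (1 / r + 2 * (1 / r) ^ 2) * (K / 2) := mul_le_mul_of_nonneg_right h3 (by linarith)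
      _ ≤ _ := by gcongr
  have h5 : (1 / r + 2 * (1 / r) ^ 2) * (n / 2) = n / r / 2 + 1 := by
    rw [hrn]; field_simp
  linarith

/-- The mirror image of `upper_tail_factor`. Here the power of 1 + 1/√n has to beat e^{√n/2}, so K
must not fall below n by more than √n. -/
theorem lower_tail_factor {n K : ℝ} (hn : 4 ≤ n) (hK0 : n - √n ≤ K) (hK : K ≤ n) :
    Real.exp (n / √n / 2) * (1 + 1 / √n) ^ (-(K / 2)) ≤ Real.exp 1 := by
  have hr : 2 ≤ √n := Real.le_sqrt_of_sq_le (by linarith)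
  set r := √n
  have hrn : n = r ^ 2 := (Real.sq_sqrt (by linarith)).symm
  have hl0 : 0 < 1 / r := by positivity
  have hp : 0 < 1 + 1 / r := by linarith
  rw [Real.rpow_def_of_pos hp, ← Real.exp_add]
  apply Real.exp_le_exp.2
  have h1 := Real.one_sub_inv_le_log_of_pos hp
  have h2 : (1 / r) - (1 / r) ^ 2 ≤ 1 - (1 + 1 / r)⁻¹ := by
    rw [le_sub_iff_add_le, add_comm, ← le_sub_iff_add_le, inv_le_iff_one_le_mul₀ hp]
    nlinarith [mul_pos hl0 (mul_pos hl0 hl0)]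
  have hK1 : 0 ≤ K := by nlinarith
  have h4 : ((1 / r) - (1 / r) ^ 2) * (K / 2) ≤ Real.log (1 + 1 / r) * (K / 2) :=
    mul_le_mul_of_nonneg_right (h2.trans h1) (by linarith)
  have hl : 1 / r ≤ 1 / 2 := one_div_le_one_div_of_le (by norm_num) hr
  have h6 : ((1 / r) - (1 / r) ^ 2) * ((n - r) / 2) ≤ ((1 / r) - (1 / r) ^ 2) * (K / 2) := by
    refine mul_le_mul_of_nonneg_left (by linarith) ?_
    nlinarith
  have h5 : ((1 / r) - (1 / r) ^ 2) * ((n - r) / 2) = n / r / 2 - 1 + 1 / r / 2 := by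
    rw [hrn]; field_simp; ring
  linarith

/-- On either tail |S² - n| / √n ≥ 8ℓ, so the weight may be multiplied by exp(±(S² - n)/(2√n) - 4ℓ)
≥ 1. This only alters the coefficient of S², and the altered integral is known exactly. -/
theorem setLIntegral_chiWeight_tail [Nonempty ι] {n v : ℕ} (hn : 4 ≤ n)
    (hN : Fintype.card ι + v = n) (hv : 3 * (v : ℝ) ≤ √n) {ℓ : ℝ} (hl : 0 ≤ ℓ) :
    ∫⁻ x in positiveOrthant ι ∩ {x | 9 * ℓ < |∑ i, x i - √n|},
        ENNReal.ofReal (chiWeight (2 * v) (∑ i, x i))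
      ≤ ENNReal.ofReal (2 * Real.exp 1 * Real.exp (-(4 * ℓ)))
        * ENNReal.ofReal (orthantMass (Fintype.card ι) (2 * v)) := by
  have hn' : (4 : ℝ) ≤ n := by exact_mod_cast hn
  have hr : 2 ≤ √(n : ℝ) := Real.le_sqrt_of_sq_le (by linarith)
  have hrn : (n : ℝ) = √(n : ℝ) ^ 2 := (Real.sq_sqrt (by linarith)).symm
  have hN' : (Fintype.card ι : ℝ) = n - v := by rw [← hN]; push_cast; ring
  have hlt : 2 * v < Fintype.card ι := by
    have : (3 : ℝ) * v < n := by nlinarith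
    have : 3 * v < n := by exact_mod_cast this
    omega
  have up := upper_tail_factor (n := n) (K := n - 3 * v) hn' (by nlinarith)
    (by linarith [(Nat.cast_nonneg v : (0 : ℝ) ≤ v)])
  have lo := lower_tail_factor (n := n) (K := n - 3 * v) hn' (by linarith)
    (by linarith [(Nat.cast_nonneg v : (0 : ℝ) ≤ v)])
  have hexp : (Fintype.card ι : ℝ) - ((2 * v : ℕ) : ℝ) = n - 3 * v := by
    rw [hN']; push_cast; ring
  set r := √(n : ℝ)
  have hb1 : 0 < 1 - 1 / r := by
    have : 1 / r ≤ 1 / 2 := one_div_le_one_div_of_le (by norm_num) hr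
    linarith
  have hb2 : 0 < 1 + 1 / r := by positivity
  have I1 := lintegral_exp_neg_mul_sq_sum_eq_mul (ι := ι) hlt hb1
  have I2 := lintegral_exp_neg_mul_sq_sum_eq_mul (ι := ι) hlt hb2
  rw [hexp] at I1 I2
  have hw : ∀ x ∈ positiveOrthant ι ∩ {x | 9 * ℓ < |∑ i, x i - r|},
      ENNReal.ofReal (chiWeight (2 * v) (∑ i, x i)) ≤
        ENNReal.ofReal (Real.exp (-(4 * ℓ)) * Real.exp (-(n / r / 2))) *
          ENNReal.ofReal (Real.exp (-((1 - 1 / r) * (∑ i, x i) ^ 2 / 2)) * ((∑ i, x i) ^ (2 * v))⁻¹)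
        + ENNReal.ofReal (Real.exp (-(4 * ℓ)) * Real.exp (n / r / 2)) *
          ENNReal.ofReal
            (Real.exp (-((1 + 1 / r) * (∑ i, x i) ^ 2 / 2)) * ((∑ i, x i) ^ (2 * v))⁻¹) := by
    rintro x ⟨hx, hd⟩
    have hS := sum_pos_of_mem_positiveOrthant hx
    set S := ∑ i, x i
    have hd : 9 * ℓ < |S - r| := hd
    rw [chiWeight]
    rcases lt_abs.1 hd with h | h
    · refine le_trans ?_ le_self_add
      rw [← ENNReal.ofReal_mul (by positivity), ← mul_assoc, ← Real.exp_add, ← Real.exp_add]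
      refine ENNReal.ofReal_le_ofReal (mul_le_mul_of_nonneg_right ?_ (by positivity))
      apply Real.exp_le_exp.2
      have h1 : 8 * ℓ * r ≤ S ^ 2 - n := by rw [hrn]; nlinarith
      have h2 : 8 * ℓ ≤ (S ^ 2 - n) / r := (le_div_iff₀ (by linarith)).2 h1
      have e : -(4 * ℓ) + -(n / r / 2) + -((1 - 1 / r) * S ^ 2 / 2)
        = -(S ^ 2 / 2) + (S ^ 2 - n) / r / 2 - 4 * ℓ := by ring
      linarith
    · refine le_trans ?_ le_add_self
      rw [← ENNReal.ofReal_mul (by positivity), ← mul_assoc, ← Real.exp_add, ← Real.exp_add]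
      refine ENNReal.ofReal_le_ofReal (mul_le_mul_of_nonneg_right ?_ (by positivity))
      apply Real.exp_le_exp.2
      have h1 : 8 * ℓ * r ≤ n - S ^ 2 := by rw [hrn]; nlinarith
      have h2 : 8 * ℓ ≤ (n - S ^ 2) / r := (le_div_iff₀ (by linarith)).2 h1
      have e : -(4 * ℓ) + (n / r / 2) + -((1 + 1 / r) * S ^ 2 / 2)
        = -(S ^ 2 / 2) + (n - S ^ 2) / r / 2 - 4 * ℓ := by ring
      linarith
  refine (setLIntegral_mono (by fun_prop) hw).trans
    ((lintegral_mono_set Set.inter_subset_left).trans ?_)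
  rw [lintegral_add_left (by fun_prop), lintegral_const_mul _ (by fun_prop),
    lintegral_const_mul _ (by fun_prop), I1, I2, ← mul_assoc, ← mul_assoc, ← add_mul]
  refine mul_le_mul_left ?_ _
  rw [← ENNReal.ofReal_mul (by positivity), ← ENNReal.ofReal_mul (by positivity),
    ← ENNReal.ofReal_add (by positivity) (by positivity)]
  apply ENNReal.ofReal_le_ofReal
  rw [mul_assoc, mul_assoc (Real.exp _) (Real.exp _), ← mul_add, mul_comm]
  exact mul_le_mul_of_nonneg_right (by linarith) (by positivity)

end Concentration

/-! ### Atypical vectors carry a negligible share of the mass. -/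

section Typical

variable {ι : Type*} [Fintype ι]

theorem one_add_pow_le_two {a : ℕ} {t : ℝ} (ht : 0 ≤ t) (h : a * t ≤ 1 / 2) :
    (1 + t) ^ a ≤ 2 := by
  calc (1 + t) ^ a ≤ Real.exp t ^ a := by
        gcongr
        linarith [Real.add_one_le_exp t]
    _ = Real.exp (a * t) := by rw [← Real.exp_nat_mul]
    _ ≤ Real.exp (1 / 2) := Real.exp_le_exp.2 h
    _ ≤ 2 := by
      have h2 : Real.exp (1 / 2) ^ 2 = Real.exp 1 := by rw [← Real.exp_nat_mul]; norm_num
      have := Real.exp_one_lt_d9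
      nlinarith [Real.exp_pos (1 / 2)]

/-- With r = √n, e^{-S²/2} = e^{n/2} e^{-rS} e^{-(S - r)²/2}. On the window |S - r| < 2 the last
factor is at least e^{-2} and S^{-2v} is at least r^{-2v}/2, so the weight dominates a multiple of
the exponential density. The window has probability at least 1/9, whence 18 e² = 9 · 2e². -/
theorem orthantMass_lower_bound [Nonempty ι] {n v : ℕ} (hn : 4 ≤ n)
    (hN : Fintype.card ι + v = n) (hv : 8 * (v : ℝ) ≤ √n) :
    Real.exp (n / 2) * (√n ^ (2 * v))⁻¹ * (√n ^ Fintype.card ι)⁻¹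
      ≤ 18 * Real.exp 2 * orthantMass (Fintype.card ι) (2 * v) := by
  have hn' : (4 : ℝ) ≤ n := by exact_mod_cast hn
  have hr : 2 ≤ √(n : ℝ) := Real.le_sqrt_of_sq_le (by linarith)
  have hrn : (n : ℝ) = √(n : ℝ) ^ 2 := (Real.sq_sqrt (by linarith)).symm
  have hN' : (Fintype.card ι : ℝ) = n - v := by rw [← hN]; push_cast; ring
  have hlt : 2 * v < Fintype.card ι := by
    have : (3 : ℝ) * v < n := by nlinarith
    have : 3 * v < n := by exact_mod_cast this
    omega
  set r := √(n : ℝ)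
  have hr0 : 0 < r := by linarith
  have := isProbabilityMeasure_expLaw hr0
  set μ := Measure.pi fun _ : ι => expLaw r
  set B : Set (ι → ℝ) := {x | |∑ i, x i - r| < 2} with hB
  have hBm : MeasurableSet B := measurableSet_lt (by fun_prop) (by fun_prop)
  have hP : ENNReal.ofReal (1 / 9) ≤ μ B := by
    -- The sum has mean (n - v)/r = r - v/r with v/r ≤ 1/2, so a deviation of 2 from r is one of at
    -- least 3/2 from the mean. The second moments add up to at most 2, and 2/(3/2)² = 8/9.
    have h := expLaw_sum_pow_deviation (ι := ι) hr0 1 (c := 3 / 2) (by norm_num)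
    have hsub : Bᶜ ⊆ {x | 3 / 2 ≤ |∑ i, x i ^ 1 - Fintype.card ι * ((1 : ℕ).factorial / r ^ 1)|} := by
      intro x hx
      simp only [hB, Set.mem_compl_iff, Set.mem_ofPred_eq, not_lt] at hx
      simp only [pow_one, Nat.factorial_one, Nat.cast_one, Set.mem_ofPred_eq]
      have e : (Fintype.card ι : ℝ) * (1 / r) = r - v / r := by
        rw [hN', hrn]; field_simp
      rw [e]
      have hvr : (v : ℝ) / r ≤ 1 / 2 := by rw [div_le_iff₀ hr0]; linarith
      have hvr0 : 0 ≤ (v : ℝ) / r := by positivity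
      rcases le_abs.1 hx with h | h
      · exact le_abs.2 (Or.inl (by linarith))
      · exact le_abs.2 (Or.inr (by linarith))
    have h2 : μ Bᶜ ≤ ENNReal.ofReal (8 / 9) := by
      refine (measure_mono hsub).trans (h.trans (ENNReal.ofReal_le_ofReal ?_))
      have h1 : (Fintype.card ι : ℝ) / r ^ 2 ≤ 1 := by
        rw [div_le_one (by positivity), ← hrn, hN']
        linarith [(Nat.cast_nonneg v : (0 : ℝ) ≤ v)]
      norm_num
      have e : (Fintype.card ι : ℝ) * (2 / r ^ 2) / (9 / 4) = (Fintype.card ι : ℝ) / r ^ 2 * (8 / 9) := by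
        ring
      rw [e]; linarith
    have h3 := prob_compl_eq_one_sub hBm (μ := μ)
    have h4 : (1 : ℝ≥0∞) = ENNReal.ofReal (1 / 9) + ENNReal.ofReal (8 / 9) := by
      rw [← ENNReal.ofReal_add (by norm_num) (by norm_num)]; norm_num
    have h5 : μ B + μ Bᶜ = 1 := by rw [measure_add_measure_compl hBm]; simp [μ]
    rw [h4] at h5
    by_contra hlt
    push Not at hlt
    have := ENNReal.add_lt_add_of_lt_of_le (by simp) hlt h2
    rw [h5] at this
    exact lt_irrefl _ this
  have hw : ∀ x ∈ positiveOrthant ι ∩ B,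
      ENNReal.ofReal (Real.exp (n / 2) * (r ^ (2 * v))⁻¹ / (2 * Real.exp 2))
        * ENNReal.ofReal (Real.exp (-(r * ∑ i, x i)))
        ≤ ENNReal.ofReal (chiWeight (2 * v) (∑ i, x i)) := by
    rintro x ⟨hx, hxB⟩
    have hS := sum_pos_of_mem_positiveOrthant hx
    have hxB : |∑ i, x i - r| < 2 := hxB
    set S := ∑ i, x i
    rw [← ENNReal.ofReal_mul (by positivity)]
    apply ENNReal.ofReal_le_ofReal
    rw [chiWeight]
    have h1 : S ^ (2 * v) ≤ 2 * r ^ (2 * v) := by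
      calc S ^ (2 * v) ≤ (r * (1 + 2 / r)) ^ (2 * v) := by
            gcongr
            rw [mul_add, mul_div_cancel₀ _ hr0.ne']
            linarith [(abs_lt.1 hxB).2]
        _ = r ^ (2 * v) * (1 + 2 / r) ^ (2 * v) := mul_pow ..
        _ ≤ r ^ (2 * v) * 2 := by
            gcongr
            refine one_add_pow_le_two (by positivity) ?_
            push_cast
            rw [← mul_div_assoc, div_le_iff₀ hr0]
            linarith
        _ = _ := mul_comm ..
    have h2 : (r ^ (2 * v))⁻¹ / 2 ≤ (S ^ (2 * v))⁻¹ := by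
      rw [← one_div, ← one_div, div_div, mul_comm]
      exact one_div_le_one_div_of_le (by positivity) h1
    have h3 : Real.exp (n / 2) / Real.exp 2 * Real.exp (-(r * S)) ≤ Real.exp (-(S ^ 2 / 2)) := by
      rw [← Real.exp_sub, ← Real.exp_add]
      apply Real.exp_le_exp.2
      have : (S - r) ^ 2 ≤ 2 ^ 2 := sq_le_sq' (by linarith [(abs_lt.1 hxB).1]) (abs_lt.1 hxB).2.le
      nlinarith
    calc _ = (Real.exp (n / 2) / Real.exp 2 * Real.exp (-(r * S))) * ((r ^ (2 * v))⁻¹ / 2) := by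
          ring
      _ ≤ _ := by gcongr
  have h1 : ∫⁻ x in positiveOrthant ι ∩ B,
      ENNReal.ofReal (Real.exp (n / 2) * (r ^ (2 * v))⁻¹ / (2 * Real.exp 2))
        * ENNReal.ofReal (Real.exp (-(r * ∑ i, x i)))
      ≤ ENNReal.ofReal (orthantMass (Fintype.card ι) (2 * v)) := by
    rw [← lintegral_chiWeight hlt]
    exact (setLIntegral_mono (by fun_prop) hw).trans (lintegral_mono_set Set.inter_subset_left)
  rw [lintegral_const_mul _ (by fun_prop), setLIntegral_exp_neg_mul_sum hr0 hBm] at h1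
  have h2 : ENNReal.ofReal (Real.exp (n / 2) * (r ^ (2 * v))⁻¹ / (2 * Real.exp 2)) *
      (ENNReal.ofReal (r ^ Fintype.card ι)⁻¹ * ENNReal.ofReal (1 / 9))
      ≤ ENNReal.ofReal (orthantMass (Fintype.card ι) (2 * v)) := by
    refine le_trans ?_ h1
    gcongr
  rw [← ENNReal.ofReal_mul (by positivity), ← ENNReal.ofReal_mul (by positivity),
    ENNReal.ofReal_le_ofReal_iff (orthantMass_pos hlt).le] at h2
  have e2 := Real.exp_pos 2
  calc _ = 18 * Real.exp 2 * (Real.exp (n / 2) * (r ^ (2 * v))⁻¹ / (2 * Real.exp 2)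
        * ((r ^ Fintype.card ι)⁻¹ * (1 / 9))) := by field_simp; ring
    _ ≤ _ := by gcongr

/-- Near S = √n the weight is at most 2 e^{n/2} n^{-v} e^{-√n S}, and `orthantMass_lower_bound`
shows that the prefactor is of the order of the total mass after normalisation. The share of an
event is thus at most a constant times its probability under exponentials, with no loss of powers of
n. -/
theorem setLIntegral_chiWeight_le_expLaw [Nonempty ι] {n v : ℕ} (hn : 4 ≤ n)
    (hN : Fintype.card ι + v = n) {ℓ : ℝ} (hl : 1 ≤ ℓ) (hv : 36 * v * ℓ ≤ √n)
    (hlr : 18 * ℓ ≤ √n) {B : Set (ι → ℝ)} (hB : MeasurableSet B) :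
    ∫⁻ x in positiveOrthant ι ∩ ({x | |∑ i, x i - √n| ≤ 9 * ℓ} ∩ B),
        ENNReal.ofReal (chiWeight (2 * v) (∑ i, x i))
      ≤ ENNReal.ofReal (36 * Real.exp 2) * Measure.pi (fun _ : ι => expLaw √n) B
        * ENNReal.ofReal (orthantMass (Fintype.card ι) (2 * v)) := by
  have hn' : (4 : ℝ) ≤ n := by exact_mod_cast hn
  have hv8 : 8 * (v : ℝ) ≤ √(n : ℝ) := by nlinarith [(Nat.cast_nonneg v : (0 : ℝ) ≤ v)]
  have hlow := orthantMass_lower_bound hn hN hv8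
  have hr : 2 ≤ √(n : ℝ) := Real.le_sqrt_of_sq_le (by linarith)
  have hrn : (n : ℝ) = √(n : ℝ) ^ 2 := (Real.sq_sqrt (by linarith)).symm
  set r := √(n : ℝ)
  have hr0 : 0 < r := by linarith
  have := isProbabilityMeasure_expLaw hr0
  have hw : ∀ x ∈ positiveOrthant ι ∩ ({x | |∑ i, x i - r| ≤ 9 * ℓ} ∩ B),
      ENNReal.ofReal (chiWeight (2 * v) (∑ i, x i)) ≤
        ENNReal.ofReal (2 * (Real.exp (n / 2) * (r ^ (2 * v))⁻¹))
        * ENNReal.ofReal (Real.exp (-(r * ∑ i, x i))) := by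
    rintro x ⟨hx, hd, -⟩
    have hS := sum_pos_of_mem_positiveOrthant hx
    have hd : |∑ i, x i - r| ≤ 9 * ℓ := hd
    set S := ∑ i, x i
    rw [← ENNReal.ofReal_mul (by positivity)]
    apply ENNReal.ofReal_le_ofReal
    rw [chiWeight]
    have h1 : r ^ (2 * v) ≤ 2 * S ^ (2 * v) := by
      have h := one_sub_le_pow_div (n := r) (k := 9 * ℓ) (m := r / 2) (j := 2 * v) hr0 (by linarith)
        (by push_cast; linarith)
      have e : 1 - r / 2 / r = 1 / 2 := by field_simp; norm_num
      rw [e] at h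
      have : (r - 9 * ℓ) ^ (2 * v) ≤ S ^ (2 * v) :=
        pow_le_pow_left₀ (by linarith) (by linarith [(abs_le.1 hd).1]) _
      linarith
    have h2 : (S ^ (2 * v))⁻¹ ≤ 2 * (r ^ (2 * v))⁻¹ := by
      rw [inv_le_iff_one_le_mul₀ (by positivity), mul_right_comm, ← div_eq_mul_inv,
        one_le_div (by positivity)]
      exact h1
    have h3 : Real.exp (-(S ^ 2 / 2)) ≤ Real.exp (n / 2) * Real.exp (-(r * S)) := by
      rw [← Real.exp_add]
      apply Real.exp_le_exp.2
      nlinarith [sq_nonneg (S - r)]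
    calc _ ≤ (Real.exp (n / 2) * Real.exp (-(r * S))) * (2 * (r ^ (2 * v))⁻¹) := by gcongr
      _ = _ := by ring
  have hsub : positiveOrthant ι ∩ ({x | |∑ i, x i - r| ≤ 9 * ℓ} ∩ B) ⊆ positiveOrthant ι ∩ B :=
    Set.inter_subset_inter_right _ Set.inter_subset_right
  refine (setLIntegral_mono (by fun_prop) hw).trans ((lintegral_mono_set hsub).trans ?_)
  rw [lintegral_const_mul _ (by fun_prop), setLIntegral_exp_neg_mul_sum hr0 hB, ← mul_assoc,
    mul_right_comm (ENNReal.ofReal (36 * _))]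
  refine mul_le_mul_left ?_ _
  rw [← ENNReal.ofReal_mul (by positivity), ← ENNReal.ofReal_mul (by positivity)]
  apply ENNReal.ofReal_le_ofReal
  linarith

/-- The vectors with typical sum, maximum, sum over the pairs of the involution `σ` of the products,
and sum of squares. -/
def typicalSet [LinearOrder ι] (n : ℕ) (σ : ι → ι) : Set (ι → ℝ) :=
  {x | |∑ i, x i - √n| ≤ 9 * Real.log n ∧ (∀ i, x i ≤ Real.log n ^ 2 / √n) ∧
    |∑ i with i < σ i, x i * x (σ i) - 1 / 2| ≤ (n : ℝ) ^ (-(1 / 3) : ℝ) / 2 ∧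
    |∑ i, x i ^ 2 - 2| ≤ (n : ℝ) ^ (-(1 / 3) : ℝ) / 2}

theorem measurableSet_typicalSet [LinearOrder ι] (n : ℕ) (σ : ι → ι) :
    MeasurableSet (typicalSet n σ) := by
  have : typicalSet (ι := ι) n σ = {x | |∑ i, x i - √n| ≤ 9 * Real.log n} ∩
      ((⋂ i, {x | x i ≤ Real.log n ^ 2 / √n}) ∩
        ({x | |∑ i with i < σ i, x i * x (σ i) - 1 / 2| ≤ (n : ℝ) ^ (-(1 / 3) : ℝ) / 2} ∩
        {x | |∑ i, x i ^ 2 - 2| ≤ (n : ℝ) ^ (-(1 / 3) : ℝ) / 2})) := by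
    ext x; simp [typicalSet]
  rw [this]
  exact (measurableSet_le (by fun_prop) (by fun_prop)).inter
    ((MeasurableSet.iInter fun i => measurableSet_le (by fun_prop) (by fun_prop)).inter
      ((measurableSet_le (by fun_prop) (by fun_prop)).inter
        (measurableSet_le (by fun_prop) (by fun_prop))))

/-- With δ = n^{-1/3}, Chebyshev's inequality at tolerance δ/4 gives multiples of 1/(nδ²) = δ; this
balance explains the exponent 1/3. The constant is 417 = 1 + 384 + 32, with 384 = 4! · 16 and 32 = 2
· 16; the maximum contributes n e^{-log² n} ≤ 1/n ≤ δ. -/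
theorem expLaw_typicalSet_compl [LinearOrder ι] {σ : ι → ι} (h1 : ∀ i, σ (σ i) = i)
    (h2 : ∀ i, σ i ≠ i) {n v : ℕ} (hn : 0 < n) (hN : Fintype.card ι + v = n)
    (hl : 2 ≤ Real.log n) :
    Measure.pi (fun _ : ι => expLaw √n)
        ({x | ∃ i, Real.log n ^ 2 / √n < x i} ∪
          ({x | (n : ℝ) ^ (-(1 / 3) : ℝ) / 4 ≤ |∑ i, x i ^ 2
            - Fintype.card ι * ((2 : ℕ).factorial / √n ^ 2)|} ∪
          {x | (n : ℝ) ^ (-(1 / 3) : ℝ) / 4 ≤ |∑ i with i < σ i, x i * x (σ i)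
            - Fintype.card ι / (2 * √n ^ 2)|}))
      ≤ ENNReal.ofReal (417 * (n : ℝ) ^ (-(1 / 3) : ℝ)) := by
  have hn' : (0 : ℝ) < n := by exact_mod_cast hn
  have hr0 : 0 < √(n : ℝ) := Real.sqrt_pos.2 hn'
  have hrn : √(n : ℝ) ^ 2 = n := Real.sq_sqrt (by linarith)
  have hr4 : √(n : ℝ) ^ 4 = (n : ℝ) ^ 2 := by
    rw [show √(n : ℝ) ^ 4 = (√(n : ℝ) ^ 2) ^ 2 by ring, hrn]
  have hNn : (Fintype.card ι : ℝ) ≤ n := by exact_mod_cast (by omega : Fintype.card ι ≤ n)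
  set δ := (n : ℝ) ^ (-(1 / 3) : ℝ) with hδ
  have hδ0 : 0 < δ := by positivity
  have hδ3 : δ ^ 3 = 1 / n := by
    rw [hδ, ← Real.rpow_natCast, ← Real.rpow_mul hn'.le]
    norm_num
    exact Real.rpow_neg_one _
  have hδn : 1 / n ≤ δ := by
    rw [← hδ3]
    have : δ ≤ 1 := Real.rpow_le_one_of_one_le_of_nonpos (by exact_mod_cast hn) (by norm_num)
    calc δ ^ 3 ≤ δ ^ 1 := pow_le_pow_of_le_one hδ0.le this (by norm_num)
      _ = δ := pow_one _
  have hδinv : 1 / n / δ ^ 2 = δ := by rw [← hδ3]; field_simp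
  have hdiv : (Fintype.card ι : ℝ) / n ≤ 1 := (div_le_one hn').2 hNn
  refine (measure_union_le _ _).trans ((add_le_add_right (measure_union_le _ _) _).trans ?_)
  have e : 417 * δ = δ + (384 * δ + 32 * δ) := by ring
  rw [e, ENNReal.ofReal_add (by positivity) (by positivity),
    ENNReal.ofReal_add (by positivity) (by positivity)]
  refine add_le_add ?_ (add_le_add ?_ ?_)
  · refine (expLaw_exists_gt hr0 (by positivity)).trans (ENNReal.ofReal_le_ofReal ?_)
    refine le_trans ?_ hδn
    rw [mul_div_cancel₀ _ hr0.ne']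
    have : Real.exp (-Real.log n ^ 2) ≤ 1 / n * (1 / n) := by
      calc Real.exp (-Real.log n ^ 2) ≤ Real.exp (-Real.log n + -Real.log n) :=
            Real.exp_le_exp.2 (by nlinarith)
        _ = _ := by rw [Real.exp_add, Real.exp_neg, Real.exp_log hn', one_div]
    calc _ ≤ (n : ℝ) * (1 / n * (1 / n)) := by gcongr
      _ = 1 / n := by field_simp
  · refine (expLaw_sum_pow_deviation hr0 2 (by positivity)).trans (ENNReal.ofReal_le_ofReal ?_)
    have e : (Fintype.card ι : ℝ) * (((2 * 2).factorial : ℕ) / √n ^ (2 * 2)) / (δ / 4) ^ 2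
        = Fintype.card ι / n * (384 * (1 / n / δ ^ 2)) := by
      norm_num [hr4, Nat.factorial]
      ring
    rw [e, hδinv]
    exact mul_le_of_le_one_left (by positivity) hdiv
  · refine (expLaw_pair_sum_deviation h1 h2 hr0 (by positivity)).trans
      (ENNReal.ofReal_le_ofReal ?_)
    have e : 2 * (Fintype.card ι : ℝ) / √n ^ 4 / (δ / 4) ^ 2
        = Fintype.card ι / n * (32 * (1 / n / δ ^ 2)) := by
      rw [hr4]
      ring
    rw [e, hδinv]
    exact mul_le_of_le_one_left (by positivity) hdiv

/-- The exponential means differ from 2 and 1/2 by 2v/n and v/(2n), at most a quarter of n^{-1/3}.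
Quarter tolerances around the means therefore imply the half tolerances of `typicalSet`. -/
theorem compl_typicalSet_subset [LinearOrder ι] (σ : ι → ι) {n v : ℕ} (hn : 0 < n)
    (hN : Fintype.card ι + v = n) (hv : 8 * v ≤ n * (n : ℝ) ^ (-(1 / 3) : ℝ)) :
    (typicalSet n σ)ᶜ ⊆ {x : ι → ℝ | 9 * Real.log n < |∑ i, x i - √n|} ∪
      ({x | |∑ i, x i - √n| ≤ 9 * Real.log n} ∩ ({x | ∃ i, Real.log n ^ 2 / √n < x i} ∪
          ({x | (n : ℝ) ^ (-(1 / 3) : ℝ) / 4 ≤ |∑ i, x i ^ 2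
            - Fintype.card ι * ((2 : ℕ).factorial / √n ^ 2)|} ∪
          {x | (n : ℝ) ^ (-(1 / 3) : ℝ) / 4 ≤ |∑ i with i < σ i, x i * x (σ i)
            - Fintype.card ι / (2 * √n ^ 2)|}))) := by
  have hn' : (0 : ℝ) < n := by exact_mod_cast hn
  have hrn : √(n : ℝ) ^ 2 = n := Real.sq_sqrt (by linarith)
  have hN' : (Fintype.card ι : ℝ) = n - v := by rw [← hN]; push_cast; ring
  set δ := (n : ℝ) ^ (-(1 / 3) : ℝ)
  have hvn : (v : ℝ) / n ≤ δ / 8 := by rw [div_le_iff₀ hn']; linarith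
  have hvn0 : 0 ≤ (v : ℝ) / n := by positivity
  have e1 : (Fintype.card ι : ℝ) * ((2 : ℕ).factorial / √n ^ 2) = 2 - 2 * (v / n) := by
    rw [hrn, hN']; norm_num; field_simp
  have e2 : (Fintype.card ι : ℝ) / (2 * √n ^ 2) = 1 / 2 - v / n / 2 := by
    rw [hrn, hN']; field_simp
  rw [e1, e2]
  intro x hx
  by_contra hc
  simp only [Set.mem_union, Set.mem_inter_iff, Set.mem_ofPred_eq, not_or, not_and, not_lt,
    not_exists, not_le] at hc
  obtain ⟨hc1, hc2⟩ := hc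
  obtain ⟨hc2, hc3, hc4⟩ := hc2 hc1
  refine hx ⟨hc1, hc2, ?_, ?_⟩
  · rw [abs_lt] at hc4
    exact abs_le.2 ⟨by linarith, by linarith⟩
  · rw [abs_lt] at hc3
    exact abs_le.2 ⟨by linarith, by linarith⟩

theorem setLIntegral_chiWeight_compl_typicalSet [Nonempty ι] [LinearOrder ι] {σ : ι → ι}
    (h1 : ∀ i, σ (σ i) = i) (h2 : ∀ i, σ i ≠ i) {n v : ℕ} (hn : 4 ≤ n)
    (hN : Fintype.card ι + v = n) (hl : 2 ≤ Real.log n) (hvl : 36 * v * Real.log n ≤ √n)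
    (hlr : 18 * Real.log n ≤ √n) (hv : 8 * v ≤ n * (n : ℝ) ^ (-(1 / 3) : ℝ)) :
    ∫⁻ x in positiveOrthant ι ∩ (typicalSet n σ)ᶜ,
        ENNReal.ofReal (chiWeight (2 * v) (∑ i, x i))
      ≤ ENNReal.ofReal (130000 * (n : ℝ) ^ (-(1 / 3) : ℝ)
          * orthantMass (Fintype.card ι) (2 * v)) := by
  have hn0 : 0 < n := by omega
  have hn' : (0 : ℝ) < n := by exact_mod_cast hn0
  have hlt : 2 * v < Fintype.card ι := by
    have : (3 : ℝ) * v < n := by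
      have h4 : (4 : ℝ) ≤ n := by exact_mod_cast hn
      have hr : 2 ≤ √(n : ℝ) := Real.le_sqrt_of_sq_le (by linarith)
      have hrn : √(n : ℝ) ^ 2 = n := Real.sq_sqrt (by linarith)
      nlinarith [(Nat.cast_nonneg v : (0 : ℝ) ≤ v)]
    have : 3 * v < n := by exact_mod_cast this
    omega
  refine (lintegral_mono_set (Set.inter_subset_inter_right _
    (compl_typicalSet_subset σ hn0 hN hv))).trans ?_
  rw [Set.inter_union_distrib_left]
  refine (lintegral_union_le _ _ _).trans ?_
  have hδ : Real.exp (-(4 * Real.log n)) ≤ (n : ℝ) ^ (-(1 / 3) : ℝ) := by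
    rw [Real.rpow_def_of_pos hn']
    exact Real.exp_le_exp.2 (by linarith)
  set δ := (n : ℝ) ^ (-(1 / 3) : ℝ) with hδdef
  have hδ0 : 0 < δ := by positivity
  have t1 := setLIntegral_chiWeight_tail (ι := ι) hn hN (v := v)
    (by nlinarith [(Nat.cast_nonneg v : (0 : ℝ) ≤ v)]) (ℓ := Real.log n) (by linarith)
  have t2 := setLIntegral_chiWeight_le_expLaw (ι := ι) hn hN (ℓ := Real.log n) (by linarith) hvl hlr
    (B := {x | ∃ i, Real.log n ^ 2 / √n < x i} ∪
          ({x | (n : ℝ) ^ (-(1 / 3) : ℝ) / 4 ≤ |∑ i, x i ^ 2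
            - Fintype.card ι * ((2 : ℕ).factorial / √n ^ 2)|} ∪
          {x | (n : ℝ) ^ (-(1 / 3) : ℝ) / 4 ≤ |∑ i with i < σ i, x i * x (σ i)
            - Fintype.card ι / (2 * √n ^ 2)|})) (by
      refine MeasurableSet.union ?_ ((measurableSet_le (by fun_prop) (by fun_prop)).union
        (measurableSet_le (by fun_prop) (by fun_prop)))
      have : {x : ι → ℝ | ∃ i, Real.log n ^ 2 / √n < x i}
          = ⋃ i, {x | Real.log n ^ 2 / √n < x i} := by ext; simp
      rw [this]
      exact MeasurableSet.iUnion fun i => measurableSet_lt (by fun_prop) (by fun_prop))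
  have t3 := expLaw_typicalSet_compl h1 h2 hn0 hN hl
  refine (add_le_add t1 (t2.trans (mul_le_mul_left (mul_le_mul_right t3 _) _))).trans ?_
  rw [← add_mul, ← ENNReal.ofReal_mul (by positivity),
    ← ENNReal.ofReal_add (by positivity) (by positivity), ← ENNReal.ofReal_mul (by positivity)]
  apply ENNReal.ofReal_le_ofReal
  refine mul_le_mul_of_nonneg_right ?_ (orthantMass_pos hlt).le
  have e1 : Real.exp 1 ≤ 2.72 := by linarith [Real.exp_one_lt_d9]
  have e2 : Real.exp 2 ≤ 8 := by
    have : Real.exp 2 = Real.exp 1 ^ 2 := by rw [← Real.exp_nat_mul]; norm_num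
    rw [this]; nlinarith [Real.exp_pos 1]
  -- The first term is the Chernoff tail, the second the comparison with exponentials; 36 · 8 · 417
  -- = 120096 accounts for nearly all of 130000.
  calc _ ≤ 2 * 2.72 * δ + 36 * 8 * (417 * δ) := by gcongr
    _ ≤ _ := by linarith

end Typical

/-! ### The product over unmatched pairs as a function of sum, squares and matched products. -/

section PairProducts

theorem one_sub_le_exp_neg_sub_sq {t : ℝ} (h0 : 0 ≤ t) (h1 : t ≤ 1) :
    1 - t ≤ Real.exp (-t - t ^ 2 / 2) := by
  rcases h1.eq_or_lt with rfl | h1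
  · simpa using (Real.exp_pos _).le
  have h := Real.hasSum_pow_div_log_of_abs_lt_one (x := t) (by rwa [abs_of_nonneg h0])
  have h2 := sum_le_hasSum (Finset.range 2) (fun i _ => by positivity) h
  simp only [Finset.sum_range_succ, Finset.sum_range_zero] at h2
  norm_num at h2
  rw [← Real.log_le_iff_le_exp (by linarith)]
  linarith

theorem exp_neg_sub_two_mul_sq_le {t : ℝ} (h0 : 0 ≤ t) (h1 : t ≤ 1 / 2) :
    Real.exp (-t - 2 * t ^ 2) ≤ 1 - t := by
  have h := Real.abs_log_sub_add_sum_range_le (x := t) (by rw [abs_of_nonneg h0]; linarith) 1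
  simp only [Finset.sum_range_succ, Finset.sum_range_zero, abs_of_nonneg h0] at h
  norm_num at h
  have h2 : t ^ 2 / (1 - t) ≤ 2 * t ^ 2 := by
    rw [div_le_iff₀ (by linarith)]; nlinarith [sq_nonneg t]
  rw [← Real.le_log_iff_exp_le (by linarith)]
  linarith [(abs_le.1 h).1]

theorem exp_neg_sub_sq_sub_le {t : ℝ} (h0 : 0 ≤ t) (h1 : t ≤ 1 / 2) :
    Real.exp (-t - t ^ 2 / 2 - 2 * t ^ 3) ≤ 1 - t := by
  have h := Real.abs_log_sub_add_sum_range_le (x := t) (by rw [abs_of_nonneg h0]; linarith) 2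
  simp only [Finset.sum_range_succ, Finset.sum_range_zero, abs_of_nonneg h0] at h
  norm_num at h
  have h2 : t ^ 3 / (1 - t) ≤ 2 * t ^ 3 := by
    rw [div_le_iff₀ (by linarith)]; nlinarith [pow_nonneg h0 3]
  rw [← Real.le_log_iff_exp_le (by linarith)]
  linarith [(abs_le.1 h).1]

variable {ι : Type*} [LinearOrder ι]

/-- The pairs of elements of `s`, each listed once in increasing order, that are not matched by
`σ`. -/
def unmatchedPairs (s : Finset ι) (σ : ι → ι) : Finset (ι × ι) :=
  (s ×ˢ s).filter fun p => p.1 < p.2 ∧ p.2 ≠ σ p.1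

theorem sum_matched_add {s : Finset ι} {σ : ι → ι} (hs : ∀ i ∈ s, σ i ∈ s)
    (h1 : ∀ i, σ (σ i) = i) (h2 : ∀ i, σ i ≠ i) (g : ι → ℝ) :
    ∑ i ∈ s with i < σ i, (g i + g (σ i)) = ∑ i ∈ s, g i := by
  rw [Finset.sum_add_distrib, ← Finset.sum_filter_add_sum_filter_not s (fun i => i < σ i)]
  congr 1
  refine Finset.sum_nbij' σ σ ?_ ?_ ?_ ?_ ?_ <;> intro i hi <;>
    simp only [Finset.mem_filter, h1, not_lt] at hi ⊢
  · exact ⟨hs i hi.1, hi.2.le⟩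
  · exact ⟨hs i hi.1, lt_of_le_of_ne hi.2 (h2 i)⟩

theorem sum_unmatchedPairs {s : Finset ι} {σ : ι → ι} (hs : ∀ i ∈ s, σ i ∈ s) (f : ι → ℝ) :
    ∑ p ∈ unmatchedPairs s σ, f p.1 * f p.2
      = ((∑ i ∈ s, f i) ^ 2 - ∑ i ∈ s, f i ^ 2) / 2 - ∑ i ∈ s with i < σ i, f i * f (σ i) := by
  have hlt : ∑ p ∈ (s ×ˢ s).filter (fun p => p.1 < p.2), f p.1 * f p.2
      = ∑ p ∈ unmatchedPairs s σ, f p.1 * f p.2 + ∑ i ∈ s with i < σ i, f i * f (σ i) := by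
    rw [← Finset.sum_filter_add_sum_filter_not _ (fun p : ι × ι => p.2 ≠ σ p.1),
      Finset.filter_filter, Finset.filter_filter]
    congr 1
    refine Finset.sum_nbij' (fun p => p.1) (fun i => (i, σ i)) ?_ ?_ ?_ ?_ ?_
    · rintro ⟨i, j⟩ h
      simp only [Finset.mem_filter, Finset.mem_product, not_not] at h ⊢
      exact ⟨h.1.1, h.2.2 ▸ h.2.1⟩
    · intro i h
      simp only [Finset.mem_filter, Finset.mem_product, not_not] at h ⊢
      exact ⟨⟨h.1, hs i h.1⟩, h.2, trivial⟩
    · rintro ⟨i, j⟩ h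
      simp only [Finset.mem_filter, Finset.mem_product, not_not] at h ⊢
      rw [h.2.2]
    · intro i _; rfl
    · rintro ⟨i, j⟩ h
      simp only [Finset.mem_filter, Finset.mem_product, not_not] at h ⊢
      rw [h.2.2]
  have hgt : ∑ p ∈ (s ×ˢ s).filter (fun p => p.2 < p.1), f p.1 * f p.2
      = ∑ p ∈ (s ×ˢ s).filter (fun p => p.1 < p.2), f p.1 * f p.2 := by
    refine Finset.sum_nbij' Prod.swap Prod.swap ?_ ?_ ?_ ?_ ?_ <;> rintro ⟨i, j⟩ h <;>
      simp_all [mul_comm]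
  have heq : ∑ p ∈ (s ×ˢ s).filter (fun p => p.1 = p.2), f p.1 * f p.2 = ∑ i ∈ s, f i ^ 2 := by
    refine Finset.sum_nbij' (fun p => p.1) (fun i => (i, i)) ?_ ?_ ?_ ?_ ?_
    · rintro ⟨i, j⟩ h; simp_all
    · intro i h; simp_all
    · rintro ⟨i, j⟩ h; simp_all
    · intro i h; rfl
    · rintro ⟨i, j⟩ h; simp_all [sq]
  have htot : (∑ i ∈ s, f i) ^ 2 = ∑ p ∈ (s ×ˢ s).filter (fun p => p.1 < p.2), f p.1 * f p.2
      + (∑ p ∈ (s ×ˢ s).filter (fun p => p.1 = p.2), f p.1 * f p.2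
      + ∑ p ∈ (s ×ˢ s).filter (fun p => p.2 < p.1), f p.1 * f p.2) := by
    rw [sq, Finset.sum_mul_sum, ← Finset.sum_product',
      ← Finset.sum_filter_add_sum_filter_not _ (fun p : ι × ι => p.1 < p.2),
      ← Finset.sum_filter_add_sum_filter_not (Finset.filter (fun p : ι × ι => ¬p.1 < p.2) _)
        (fun p : ι × ι => p.1 = p.2), Finset.filter_filter, Finset.filter_filter]
    congr 2
    · refine Finset.sum_congr (Finset.filter_congr fun p _ => ?_) fun _ _ => rfl
      constructor
      · exact fun h => h.2
      · exact fun h => ⟨by rw [h]; exact lt_irrefl _, h⟩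
    · refine Finset.sum_congr (Finset.filter_congr fun p _ => ?_) fun _ _ => rfl
      constructor
      · exact fun h => lt_of_le_of_ne (not_lt.1 h.1) (Ne.symm h.2)
      · exact fun h => ⟨not_lt.2 h.le, h.ne'⟩
  rw [hgt, heq] at htot
  linarith

variable {s : Finset ι} {σ : ι → ι} {x : ι → ℝ}

theorem sum_matched_le (hs : ∀ i ∈ s, σ i ∈ s) (h1 : ∀ i, σ (σ i) = i) (h2 : ∀ i, σ i ≠ i)
    (x : ι → ℝ) :
    ∑ i ∈ s with i < σ i, x i * x (σ i) ≤ (∑ i ∈ s, x i ^ 2) / 2 := by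
  rw [← sum_matched_add hs h1 h2 fun i => x i ^ 2, Finset.sum_div]
  exact Finset.sum_le_sum fun i _ => by nlinarith [sq_nonneg (x i - x (σ i))]

/-- The quadratic term of the logarithm must be kept: half the sum of (x_i x_j)² over the pairs is
about Q²/4, which is of order one when Q ≈ 2. -/
theorem prod_unmatchedPairs_le (hs : ∀ i ∈ s, σ i ∈ s) (h1 : ∀ i, σ (σ i) = i)
    (h2 : ∀ i, σ i ≠ i) (hx0 : ∀ i ∈ s, 0 ≤ x i) (hx1 : ∀ i ∈ s, x i ≤ 1) :
    ∏ p ∈ unmatchedPairs s σ, (1 - x p.1 * x p.2)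
      ≤ Real.exp (-((∑ i ∈ s, x i) ^ 2 / 2) + (∑ i ∈ s, x i ^ 2) / 2
        + ∑ i ∈ s with i < σ i, x i * x (σ i) - (∑ i ∈ s, x i ^ 2) ^ 2 / 4
        + (∑ i ∈ s, x i ^ 4) / 2) := by
  have hmem : ∀ p ∈ unmatchedPairs s σ, p.1 ∈ s ∧ p.2 ∈ s := fun p hp =>
    Finset.mem_product.1 (Finset.mem_filter.1 hp).1
  have hle1 : ∀ p ∈ unmatchedPairs s σ, x p.1 * x p.2 ≤ 1 := fun p hp =>
    mul_le_one₀ (hx1 _ (hmem p hp).1) (hx0 _ (hmem p hp).2) (hx1 _ (hmem p hp).2)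
  have hge0 : ∀ p ∈ unmatchedPairs s σ, 0 ≤ x p.1 * x p.2 := fun p hp =>
    mul_nonneg (hx0 _ (hmem p hp).1) (hx0 _ (hmem p hp).2)
  calc _ ≤ ∏ p ∈ unmatchedPairs s σ, Real.exp (-(x p.1 * x p.2) - (x p.1 * x p.2) ^ 2 / 2) :=
        Finset.prod_le_prod (fun p hp => by linarith [hle1 p hp]) fun p hp =>
          one_sub_le_exp_neg_sub_sq (hge0 p hp) (hle1 p hp)
    _ ≤ _ := by
      rw [← Real.exp_sum]
      apply Real.exp_le_exp.2
      have e : ∀ p : ι × ι, -(x p.1 * x p.2) - (x p.1 * x p.2) ^ 2 / 2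
          = -(x p.1 * x p.2) + (-1 / 2) * (x p.1 ^ 2 * x p.2 ^ 2) := fun p => by ring
      simp only [e]
      rw [Finset.sum_add_distrib, Finset.sum_neg_distrib, ← Finset.mul_sum, sum_unmatchedPairs hs,
        sum_unmatchedPairs hs fun i => x i ^ 2]
      have := sum_matched_le hs h1 h2 fun i => x i ^ 2
      simp only [← pow_mul] at this ⊢
      linarith

/-- Since P ≤ Q/2 and the fourth powers sum to at most Q, the extra exponent is at most 3Q/2 - Q²/4
≤ 9/4. No typicality is required, so this serves outside the quasirandom event. -/
theorem prod_unmatchedPairs_le_crude (hs : ∀ i ∈ s, σ i ∈ s) (h1 : ∀ i, σ (σ i) = i)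
    (h2 : ∀ i, σ i ≠ i) (hx0 : ∀ i ∈ s, 0 ≤ x i) (hx1 : ∀ i ∈ s, x i ≤ 1) :
    ∏ p ∈ unmatchedPairs s σ, (1 - x p.1 * x p.2)
      ≤ Real.exp (9 / 4) * Real.exp (-((∑ i ∈ s, x i) ^ 2 / 2)) := by
  refine (prod_unmatchedPairs_le hs h1 h2 hx0 hx1).trans ?_
  rw [← Real.exp_add]
  apply Real.exp_le_exp.2
  have := sum_matched_le hs h1 h2 x
  have h4 : ∑ i ∈ s, x i ^ 4 ≤ ∑ i ∈ s, x i ^ 2 := Finset.sum_le_sum fun i hi =>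
    pow_le_pow_of_le_one (hx0 i hi) (hx1 i hi) (by norm_num)
  nlinarith [sq_nonneg (∑ i ∈ s, x i ^ 2 - 3)]

/-- At Q = 2 and P = 1/2 the exponent Q/2 + P - Q²/4 equals 1/2. Deviations cost O(δ), and the
fourth powers cost O(L²). -/
theorem prod_unmatchedPairs_le_typical (hs : ∀ i ∈ s, σ i ∈ s) (h1 : ∀ i, σ (σ i) = i)
    (h2 : ∀ i, σ i ≠ i) {L δ : ℝ} (hL : L ≤ 1) (hδ : δ ≤ 1) (hx0 : ∀ i ∈ s, 0 ≤ x i)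
    (hxL : ∀ i ∈ s, x i ≤ L)
    (hQ : |∑ i ∈ s, x i ^ 2 - 2| ≤ δ)
    (hP : |∑ i ∈ s with i < σ i, x i * x (σ i) - 1 / 2| ≤ δ) :
    ∏ p ∈ unmatchedPairs s σ, (1 - x p.1 * x p.2)
      ≤ Real.exp (1 / 2 + 2 * δ + 2 * L ^ 2) * Real.exp (-((∑ i ∈ s, x i) ^ 2 / 2)) := by
  refine (prod_unmatchedPairs_le hs h1 h2 hx0 fun i hi => (hxL i hi).trans hL).trans ?_
  rw [← Real.exp_add]
  apply Real.exp_le_exp.2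
  have h4 : ∑ i ∈ s, x i ^ 4 ≤ L ^ 2 * ∑ i ∈ s, x i ^ 2 := by
    rw [Finset.mul_sum]
    refine Finset.sum_le_sum fun i hi => ?_
    have : x i ^ 2 ≤ L ^ 2 := pow_le_pow_left₀ (hx0 i hi) (hxL i hi) 2
    nlinarith [sq_nonneg (x i)]
  rw [abs_le] at hQ hP
  have h5 : L ^ 2 * ∑ i ∈ s, x i ^ 2 ≤ L ^ 2 * 3 :=
    mul_le_mul_of_nonneg_left (by linarith) (sq_nonneg L)
  nlinarith [sq_nonneg (∑ i ∈ s, x i ^ 2 - 2), sq_nonneg L]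

/-- The matching lower bound: the cubic term of the logarithm is absorbed in the quadratic one at
the price of a factor L², as every product x_i x_j is at most L². -/
theorem le_prod_unmatchedPairs (hs : ∀ i ∈ s, σ i ∈ s) {L δ : ℝ} (hL : L ^ 2 ≤ 1 / 2)
    (hδ : δ ≤ 1) (hx0 : ∀ i ∈ s, 0 ≤ x i) (hxL : ∀ i ∈ s, x i ≤ L)
    (hQ : |∑ i ∈ s, x i ^ 2 - 2| ≤ δ)
    (hP : |∑ i ∈ s with i < σ i, x i * x (σ i) - 1 / 2| ≤ δ) :
    Real.exp (1 / 2 - 2 * δ - 9 * L ^ 2) * Real.exp (-((∑ i ∈ s, x i) ^ 2 / 2))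
      ≤ ∏ p ∈ unmatchedPairs s σ, (1 - x p.1 * x p.2) := by
  have hmem : ∀ p ∈ unmatchedPairs s σ, p.1 ∈ s ∧ p.2 ∈ s := fun p hp =>
    Finset.mem_product.1 (Finset.mem_filter.1 hp).1
  have hleL : ∀ p ∈ unmatchedPairs s σ, x p.1 * x p.2 ≤ L ^ 2 := fun p hp => by
    rw [sq]
    exact mul_le_mul (hxL _ (hmem p hp).1) (hxL _ (hmem p hp).2) (hx0 _ (hmem p hp).2)
      ((hx0 _ (hmem p hp).1).trans (hxL _ (hmem p hp).1))
  have hge0 : ∀ p ∈ unmatchedPairs s σ, 0 ≤ x p.1 * x p.2 := fun p hp =>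
    mul_nonneg (hx0 _ (hmem p hp).1) (hx0 _ (hmem p hp).2)
  calc _ ≤ ∏ p ∈ unmatchedPairs s σ,
        Real.exp (-(x p.1 * x p.2) - (x p.1 * x p.2) ^ 2 / 2 - 2 * (x p.1 * x p.2) ^ 3) := by
        rw [← Real.exp_sum, ← Real.exp_add]
        apply Real.exp_le_exp.2
        have e : ∑ p ∈ unmatchedPairs s σ,
            (-(x p.1 * x p.2) - (1 / 2 + 2 * L ^ 2) * (x p.1 ^ 2 * x p.2 ^ 2))
            ≤ ∑ p ∈ unmatchedPairs s σ,
              (-(x p.1 * x p.2) - (x p.1 * x p.2) ^ 2 / 2 - 2 * (x p.1 * x p.2) ^ 3) := by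
          refine Finset.sum_le_sum fun p hp => ?_
          have := hleL p hp
          have : (x p.1 * x p.2) ^ 3 ≤ L ^ 2 * (x p.1 * x p.2) ^ 2 := by
            rw [pow_succ']
            exact mul_le_mul_of_nonneg_right this (sq_nonneg _)
          nlinarith
        refine le_trans ?_ e
        rw [Finset.sum_sub_distrib, Finset.sum_neg_distrib, ← Finset.mul_sum, sum_unmatchedPairs hs,
          sum_unmatchedPairs hs fun i => x i ^ 2]
        have h4 : 0 ≤ ∑ i ∈ s, (x i ^ 2) ^ 2 := Finset.sum_nonneg fun i _ => by positivity
        have hP4 : 0 ≤ ∑ i ∈ s with i < σ i, x i ^ 2 * x (σ i) ^ 2 :=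
          Finset.sum_nonneg fun i _ => by positivity
        rw [abs_le] at hQ hP
        set Q := ∑ i ∈ s, x i ^ 2
        have hQ2 : Q ^ 2 ≤ 9 := by
          have : 0 ≤ Q := Finset.sum_nonneg fun i _ => by positivity
          nlinarith
        have h6 : (1 / 2 + 2 * L ^ 2) * ((Q ^ 2 - ∑ i ∈ s, (x i ^ 2) ^ 2) / 2
            - ∑ i ∈ s with i < σ i, x i ^ 2 * x (σ i) ^ 2) ≤ (1 / 2 + 2 * L ^ 2) * (Q ^ 2 / 2) :=
          mul_le_mul_of_nonneg_left (by linarith) (by positivity)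
        have h7 : L ^ 2 * Q ^ 2 ≤ L ^ 2 * 9 := mul_le_mul_of_nonneg_left hQ2 (sq_nonneg L)
        have h8 : (Q - 2) ^ 2 ≤ δ := by
          have : (Q - 2) ^ 2 ≤ δ ^ 2 := sq_le_sq' (by linarith) (by linarith)
          nlinarith
        nlinarith
    _ ≤ _ := Finset.prod_le_prod (fun p _ => (Real.exp_pos _).le) fun p hp =>
          exp_neg_sub_sq_sub_le (hge0 p hp) ((hleL p hp).trans hL)

end PairProducts

/-! ### Disjoint pairs of uniform variables. -/

section Independence

/-- The uniform law on the unit interval. -/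
noncomputable abbrev unitLaw : Measure ℝ := volume.restrict (Set.Ioc (0 : ℝ) 1)

instance isProbabilityMeasure_unitLaw : IsProbabilityMeasure unitLaw := by
  constructor; simp [unitLaw]

theorem unitLaw_Iic {c : ℝ} (hc1 : c ≤ 1) : unitLaw (Set.Iic c) = ENNReal.ofReal c := by
  rw [unitLaw, Measure.restrict_apply measurableSet_Iic, Set.inter_comm, Set.Ioc_inter_Iic,
    min_eq_right hc1, Real.volume_Ioc, sub_zero]

variable {κ τ : Type*} [Fintype κ] [DecidableEq κ] [DecidableEq τ]

theorem pi_unitLaw_or {a b : κ} (hab : a ≠ b) {c d : ℝ} (hc0 : 0 ≤ c) (hc1 : c ≤ 1) (hd0 : 0 ≤ d)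
    (hd1 : d ≤ 1) :
    Measure.pi (fun _ : κ => unitLaw) {X | c < X a ∨ d < X b} = ENNReal.ofReal (1 - c * d) := by
  have e : {X : κ → ℝ | c < X a ∨ d < X b}
      = (Set.pi ({a, b} : Finset κ) fun k => if k = a then Set.Iic c else Set.Iic d)ᶜ := by
    ext X
    simp [hab.symm, imp_iff_not_or]
  rw [e, prob_compl_eq_one_sub, Measure.pi_pi_finset, Finset.prod_pair hab]
  · simp only [if_true, hab.symm, if_false]
    rw [unitLaw_Iic hc1, unitLaw_Iic hd1, ← ENNReal.ofReal_mul hc0,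
      ENNReal.ofReal_sub _ (by positivity), ENNReal.ofReal_one]
  · refine MeasurableSet.pi (Finset.countable_toSet _) fun k _ => ?_
    split_ifs <;> exact measurableSet_Iic

/-- For disjoint pairs of coordinates of a uniform vector, the probability that in each pair at
least one coordinate exceeds its threshold. -/
theorem pi_unitLaw_forall_or (T : Finset τ) (a b : τ → κ) (c d : τ → ℝ)
    (hab : ∀ p ∈ T, a p ≠ b p)
    (hdisj : ∀ p ∈ T, ∀ q ∈ T, p ≠ q → Disjoint ({a p, b p} : Finset κ) {a q, b q})
    (hc0 : ∀ p ∈ T, 0 ≤ c p) (hc1 : ∀ p ∈ T, c p ≤ 1) (hd0 : ∀ p ∈ T, 0 ≤ d p)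
    (hd1 : ∀ p ∈ T, d p ≤ 1) :
    Measure.pi (fun _ : κ => unitLaw) {X | ∀ p ∈ T, c p < X (a p) ∨ d p < X (b p)}
      = ENNReal.ofReal (∏ p ∈ T, (1 - c p * d p)) := by
  induction T using Finset.induction_on with
  | empty => simp
  | insert p T hp ih =>
    have ih' := ih (fun q hq => hab q (Finset.mem_insert_of_mem hq))
      (fun q hq r hr => hdisj q (Finset.mem_insert_of_mem hq) r (Finset.mem_insert_of_mem hr))
      (fun q hq => hc0 q (Finset.mem_insert_of_mem hq))
      (fun q hq => hc1 q (Finset.mem_insert_of_mem hq))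
      (fun q hq => hd0 q (Finset.mem_insert_of_mem hq))
      (fun q hq => hd1 q (Finset.mem_insert_of_mem hq))
    have hpm := Finset.mem_insert_self p T
    have h0 := pi_unitLaw_or (hab p hpm) (hc0 p hpm) (hc1 p hpm) (hd0 p hpm) (hd1 p hpm)
    rw [Finset.prod_insert hp, ENNReal.ofReal_mul (by
      linarith [mul_le_one₀ (hc1 p hpm) (hd0 p hpm) (hd1 p hpm)]), ← h0, ← ih']
    set A : Finset κ := {a p, b p} with hA
    set B : Finset κ := T.biUnion fun q => {a q, b q} with hB
    have hAB : Disjoint A B := by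
      rw [hB, Finset.disjoint_biUnion_right]
      intro q hq
      exact hdisj p hpm q (Finset.mem_insert_of_mem hq) (by rintro rfl; exact hp hq)
    have hind : iIndepFun (fun (k : κ) (X : κ → ℝ) => X k) (Measure.pi fun _ : κ => unitLaw) :=
      iIndepFun_pi (X := fun _ t => t) fun i => by fun_prop
    have hI := hind.indepFun_finset A B hAB fun k => by fun_prop
    have haA : a p ∈ A := by simp [hA]
    have hbA : b p ∈ A := by simp [hA]
    have haB : ∀ q : T, a q ∈ B := fun q => Finset.mem_biUnion.2 ⟨q, q.2, by simp⟩
    have hbB : ∀ q : T, b q ∈ B := fun q => Finset.mem_biUnion.2 ⟨q, q.2, by simp⟩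
    have h := hI.measure_inter_preimage_eq_mul
      ({f : A → ℝ | c p < f ⟨a p, haA⟩} ∪ {f | d p < f ⟨b p, hbA⟩})
      (⋂ q : T, ({f : B → ℝ | c q < f ⟨a q, haB q⟩} ∪ {f | d q < f ⟨b q, hbB q⟩}))
      ((measurableSet_lt (by fun_prop) (by fun_prop)).union
        (measurableSet_lt (by fun_prop) (by fun_prop)))
      (MeasurableSet.iInter fun q => (measurableSet_lt (by fun_prop) (by fun_prop)).union
        (measurableSet_lt (by fun_prop) (by fun_prop)))
    have e1 : {X : κ → ℝ | ∀ q ∈ T, c q < X (a q) ∨ d q < X (b q)}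
        = (fun X (i : B) => X i) ⁻¹'
          (⋂ q : T, ({f : B → ℝ | c q < f ⟨a q, haB q⟩} ∪ {f | d q < f ⟨b q, hbB q⟩})) := by
      ext X; simp
    have e2 : {X : κ → ℝ | c p < X (a p) ∨ d p < X (b p)} = (fun X (i : A) => X i) ⁻¹'
          ({f : A → ℝ | c p < f ⟨a p, haA⟩} ∪ {f | d p < f ⟨b p, hbA⟩}) := by
      ext X; simp
    rw [e1, e2, ← h, ← e1, ← e2]
    congr 1
    ext X
    simp

end Independence

/-! ### Separating the values at the partners from all other entries. -/

section Resampling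

variable {n : ℕ}

theorem measurePreserving_curry_unitLaw :
    MeasurePreserving (fun (X : Fin n × Fin n → ℝ) i j => X (i, j))
      (Measure.pi fun _ => unitLaw) (prefMeasure n) := by
  have h : MeasurePreserving (MeasurableEquiv.curry (Fin n) (Fin n) ℝ).symm (prefMeasure n)
      (Measure.pi fun _ => unitLaw) := by
    refine ⟨MeasurableEquiv.measurable _, ?_⟩
    symm
    refine Measure.pi_eq fun s hs => ?_
    rw [Measure.map_apply (MeasurableEquiv.measurable _) (MeasurableSet.univ_pi hs)]
    have e : (MeasurableEquiv.curry (Fin n) (Fin n) ℝ).symm ⁻¹' Set.univ.pi s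
        = Set.univ.pi fun i => Set.univ.pi fun j => s (i, j) := by
      ext X
      simp [Set.mem_pi, Function.uncurry]
    have hu : volume.restrict (Set.Icc (0 : ℝ) 1) = unitLaw :=
      Measure.restrict_congr_set Ioc_ae_eq_Icc.symm
    rw [e, prefMeasure, hu, Measure.pi_pi]
    simp only [Measure.pi_pi]
    rw [Fintype.prod_prod_type]
  exact h.symm (MeasurableEquiv.curry (Fin n) (Fin n) ℝ).symm

namespace PerfectMatching

variable (M N : PerfectMatching n)

/-- The people whose partners in the two matchings differ. -/
def changed : Finset (Fin n) := Finset.univ.filter fun i => N.partner i ≠ M.partner i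

/-- The array whose entries at the partners in `M` and in `N` are taken from `w` and `z`, and all
other entries from `X`. -/
def assemble (w : {i // i ∉ M.changed N} → ℝ) (z : {i // i ∈ M.changed N} → ℝ × ℝ)
    (X : Fin n × Fin n → ℝ) (i j : Fin n) : ℝ :=
  if h : i ∈ M.changed N then
    if j = M.partner i then (z ⟨i, h⟩).1 else if j = N.partner i then (z ⟨i, h⟩).2 else X (i, j)
  else if j = M.partner i then w ⟨i, h⟩ else X (i, j)

theorem measurable_assemble :
    Measurable fun q : ({i // i ∉ M.changed N} → ℝ) ×
      (({i // i ∈ M.changed N} → ℝ × ℝ) × (Fin n × Fin n → ℝ)) =>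
        M.assemble N q.1 q.2.1 q.2.2 := by
  refine measurable_pi_lambda _ fun i => measurable_pi_lambda _ fun j => ?_
  unfold assemble
  split_ifs <;> fun_prop

theorem measurePreserving_assemble :
    MeasurePreserving (fun q : ({i // i ∉ M.changed N} → ℝ) ×
      (({i // i ∈ M.changed N} → ℝ × ℝ) × (Fin n × Fin n → ℝ)) =>
        M.assemble N q.1 q.2.1 q.2.2)
      ((Measure.pi fun _ => unitLaw).prod
        ((Measure.pi fun _ => unitLaw.prod unitLaw).prod (Measure.pi fun _ => unitLaw)))
      (prefMeasure n) := by
  have h : MeasurePreserving (fun (q : ({i // i ∉ M.changed N} → ℝ) ×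
      (({i // i ∈ M.changed N} → ℝ × ℝ) × (Fin n × Fin n → ℝ))) (k : Fin n × Fin n) =>
        M.assemble N q.1 q.2.1 q.2.2 k.1 k.2)
      ((Measure.pi fun _ => unitLaw).prod
        ((Measure.pi fun _ => unitLaw.prod unitLaw).prod (Measure.pi fun _ => unitLaw)))
      (Measure.pi fun _ => unitLaw) := by
    have hm : Measurable (fun (q : ({i // i ∉ M.changed N} → ℝ) ×
        (({i // i ∈ M.changed N} → ℝ × ℝ) × (Fin n × Fin n → ℝ))) (k : Fin n × Fin n) =>
          M.assemble N q.1 q.2.1 q.2.2 k.1 k.2) := by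
      have := M.measurable_assemble N
      fun_prop
    refine ⟨hm, ?_⟩
    symm
    refine Measure.pi_eq fun s hs => ?_
    rw [Measure.map_apply hm (MeasurableSet.univ_pi hs)]
    have e : (fun (q : ({i // i ∉ M.changed N} → ℝ) ×
        (({i // i ∈ M.changed N} → ℝ × ℝ) × (Fin n × Fin n → ℝ))) (k : Fin n × Fin n) =>
          M.assemble N q.1 q.2.1 q.2.2 k.1 k.2) ⁻¹' Set.univ.pi s
        = (Set.univ.pi fun i : {i // i ∉ M.changed N} => s (i, M.partner i)) ×ˢ
          ((Set.univ.pi fun i : {i // i ∈ M.changed N} => s (i, M.partner i) ×ˢ s (i, N.partner i)) ×ˢ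
          -- Entries of `X` at the positions of partners are never read, so they are unconstrained
          -- and contribute the factor 1.
          (Set.univ.pi fun k => if k.2 = M.partner k.1 ∨ k.2 = N.partner k.1 then Set.univ
            else s k)) := by
      ext ⟨w, z, X⟩
      simp only [Set.mem_preimage, Set.mem_pi, Set.mem_univ, true_imp_iff, Set.mem_prod,
        Prod.forall, Subtype.forall]
      constructor
      · intro H
        refine ⟨fun i hi => ?_, fun i hi => ⟨?_, ?_⟩, fun i j => ?_⟩
        · have := H i (M.partner i)
          simpa [assemble, hi] using this
        · have := H i (M.partner i)
          simpa [assemble, hi] using this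
        · have := H i (N.partner i)
          have hne : N.partner i ≠ M.partner i := (Finset.mem_filter.1 hi).2
          simpa [assemble, hi, hne] using this
        · split_ifs with hj
          · trivial
          · push Not at hj
            have := H i j
            by_cases hi : i ∈ M.changed N <;> simpa [assemble, hi, hj] using this
      · rintro ⟨H1, H2, H3⟩ i j
        by_cases hi : i ∈ M.changed N
        · simp only [assemble, hi, dif_pos]
          split_ifs with h1 h2
          · rw [h1]; exact (H2 i hi).1
          · rw [h2]; exact (H2 i hi).2
          · simpa [h1, h2] using H3 i j
        · simp only [assemble, hi, dif_neg, not_false_eq_true]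
          have hNM : N.partner i = M.partner i := by
            by_contra hc; exact hi (Finset.mem_filter.2 ⟨Finset.mem_univ _, hc⟩)
          split_ifs with h1
          · rw [h1]; exact H1 i hi
          · simpa [h1, hNM] using H3 i j
    rw [e, Measure.prod_prod, Measure.prod_prod, Measure.pi_pi, Measure.pi_pi, Measure.pi_pi]
    simp only [Measure.prod_prod]
    rw [Fintype.prod_prod_type, Fintype.prod_prod_type]
    have row : ∀ i, ∏ j, unitLaw (s (i, j))
        = (if i ∈ M.changed N then unitLaw (s (i, M.partner i)) * unitLaw (s (i, N.partner i))
            else unitLaw (s (i, M.partner i))) *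
          ∏ j, unitLaw (if j = M.partner i ∨ j = N.partner i then Set.univ else s (i, j)) := by
      intro i
      have e1 : ∀ j, unitLaw (s (i, j))
          = (if j = M.partner i ∨ j = N.partner i then unitLaw (s (i, j)) else 1) *
          unitLaw (if j = M.partner i ∨ j = N.partner i then Set.univ else s (i, j)) := by
        intro j; split_ifs <;> simp
      rw [Finset.prod_congr rfl fun j _ => e1 j, Finset.prod_mul_distrib]
      congr 1
      rw [Finset.prod_ite, Finset.prod_const_one, mul_one]
      have e2 : Finset.univ.filter (fun j => j = M.partner i ∨ j = N.partner i)
          = {M.partner i, N.partner i} := by ext; simp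
      rw [e2]
      split_ifs with hi
      · rw [Finset.prod_pair (Finset.mem_filter.1 hi).2.symm]
      · have hNM : N.partner i = M.partner i := by
          by_contra hc; exact hi (Finset.mem_filter.2 ⟨Finset.mem_univ _, hc⟩)
        rw [hNM]; simp
    have hsplit := Fintype.prod_subtype_mul_prod_subtype (fun i => i ∈ M.changed N) fun i =>
      if i ∈ M.changed N then unitLaw (s (i, M.partner i)) * unitLaw (s (i, N.partner i))
        else unitLaw (s (i, M.partner i))
    have h1 : ∀ i : {i // i ∈ M.changed N}, (if (i : Fin n) ∈ M.changed N
        then unitLaw (s (i, M.partner i)) * unitLaw (s (i, N.partner i))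
        else unitLaw (s (i, M.partner i)))
        = unitLaw (s (i, M.partner i)) * unitLaw (s (i, N.partner i)) := fun i => if_pos i.2
    have h2 : ∀ i : {i // i ∉ M.changed N}, (if (i : Fin n) ∈ M.changed N
        then unitLaw (s (i, M.partner i)) * unitLaw (s (i, N.partner i))
        else unitLaw (s (i, M.partner i)))
        = unitLaw (s (i, M.partner i)) := fun i => if_neg i.2
    rw [Finset.prod_congr rfl fun i _ => row i, Finset.prod_mul_distrib (s := Finset.univ)
      (f := fun i => if i ∈ M.changed N then unitLaw (s (i, M.partner i)) *
        unitLaw (s (i, N.partner i)) else unitLaw (s (i, M.partner i))), ← mul_assoc, ← hsplit,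
      Finset.prod_congr rfl fun i _ => h1 i, Finset.prod_congr rfl fun i _ => h2 i]
    have gen : ∀ {a b c a' b' c' : ℝ≥0∞}, a = a' → b = b' → c = c' → a * b * c = b' * a' * c' := by
      rintro a b c _ _ _ rfl rfl rfl
      rw [mul_comm a]
    refine gen ?_ ?_ rfl
    · congr!
    · congr!
  exact measurePreserving_curry_unitLaw.comp h

/-- The probability of an event as an iterated integral over the values at the partners. -/
theorem prefMeasure_eq_lintegral {E : Set (Fin n → Fin n → ℝ)} (hE : MeasurableSet E) :
    prefMeasure n E = ∫⁻ w : {i // i ∉ M.changed N} → ℝ,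
      ∫⁻ z : {i // i ∈ M.changed N} → ℝ × ℝ,
        Measure.pi (fun _ => unitLaw) {X : Fin n × Fin n → ℝ | M.assemble N w z X ∈ E}
        ∂(Measure.pi fun _ => unitLaw.prod unitLaw) ∂(Measure.pi fun _ => unitLaw) := by
  have h := M.measurePreserving_assemble N
  have hpre := h.measurable hE
  rw [← h.measure_preimage hE.nullMeasurableSet, Measure.prod_apply hpre]
  refine lintegral_congr fun w => ?_
  rw [Measure.prod_apply (measurable_prodMk_left hpre)]
  rfl

end PerfectMatching

end Resampling

/-! ### Changed people, pairs, and the switching events. -/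

namespace PerfectMatching

variable {n : ℕ} (M N : PerfectMatching n)

theorem mem_changed {i : Fin n} : i ∈ M.changed N ↔ N.partner i ≠ M.partner i := by
  simp [changed]

theorem partner_eq_of_notMem_changed {i : Fin n} (h : i ∉ M.changed N) :
    N.partner i = M.partner i := by
  simpa [changed] using h

theorem partner_mem_changed {i : Fin n} (h : i ∈ M.changed N) : M.partner i ∈ M.changed N := by
  rw [mem_changed] at h ⊢
  intro hc
  rw [M.partner_partner] at hc
  exact h (by rw [← hc, N.partner_partner, hc])

theorem partner_mem_changed' {i : Fin n} (h : i ∈ M.changed N) : N.partner i ∈ M.changed N := by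
  rw [mem_changed] at h ⊢
  intro hc
  rw [N.partner_partner] at hc
  apply h
  rw [congrArg M.partner hc, M.partner_partner]

theorem partner_notMem_changed {i : Fin n} (h : i ∉ M.changed N) : M.partner i ∉ M.changed N := by
  intro hc
  have := M.partner_mem_changed N hc
  rw [M.partner_partner] at this
  exact h this

/-- The pairs that are matched in neither matching and have at most one changed member. -/
def outerPairs : Finset (Fin n × Fin n) :=
  unmatchedPairs (M.changed N)ᶜ M.partner ∪ M.changed N ×ˢ (M.changed N)ᶜ

/-- The pairs of changed people that are matched in neither matching. -/
def innerPairs : Finset (Fin n × Fin n) :=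
  (M.changed N ×ˢ M.changed N).filter fun p =>
    p.1 < p.2 ∧ p.2 ≠ M.partner p.1 ∧ p.2 ≠ N.partner p.1

/-- Among the changed people, both matchings are stable along the pairs of the other one, and at
every pair of `T` one of the two members prefers both of their partners. -/
def switchEvent (T : Finset (Fin n × Fin n)) : Set (Fin n → Fin n → ℝ) :=
  {X | (∀ i ∈ M.changed N, X i (N.partner i) < X i (M.partner i) ∨
      X (M.partner i) (N.partner (M.partner i)) < X (M.partner i) i) ∧
    (∀ i ∈ M.changed N, X i (M.partner i) < X i (N.partner i) ∨
      X (N.partner i) (M.partner (N.partner i)) < X (N.partner i) i) ∧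
    ∀ p ∈ T, max (X p.1 (M.partner p.1)) (X p.1 (N.partner p.1)) < X p.1 p.2 ∨
      max (X p.2 (M.partner p.2)) (X p.2 (N.partner p.2)) < X p.2 p.1}

/-- The vector whose entry at `i` is the value at the partner of `i`. -/
def partnerValues (X : Fin n → Fin n → ℝ) (i : Fin n) : ℝ := X i (M.partner i)

/-- The sets of changed people that may prefer their partner in `N`: they contain a member of each
changed pair of `M`, and miss a member of each changed pair of `N`. -/
def orientations : Finset (Finset (Fin n)) :=
  (M.changed N).powerset.filter fun B => ∀ i ∈ M.changed N,
    (i ∈ B ∨ M.partner i ∈ B) ∧ (i ∉ B ∨ N.partner i ∉ B)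

section Values

variable (w : {i // i ∉ M.changed N} → ℝ) (z : {i // i ∈ M.changed N} → ℝ × ℝ)

/-- The values at the partners in `M`. -/
def oldValue (i : Fin n) : ℝ :=
  if h : i ∈ M.changed N then (z ⟨i, h⟩).1 else w ⟨i, h⟩

/-- The values at the partners in `N`. -/
def newValue (i : Fin n) : ℝ :=
  if h : i ∈ M.changed N then (z ⟨i, h⟩).2 else w ⟨i, h⟩

/-- The larger one of the values at the partners in `M` and in `N`. -/
def maxValue (i : Fin n) : ℝ := max (M.oldValue N w z i) (M.newValue N w z i)

variable (X : Fin n × Fin n → ℝ)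

theorem assemble_old (i : Fin n) :
    M.assemble N w z X i (M.partner i) = M.oldValue N w z i := by
  unfold assemble oldValue
  split_ifs <;> simp_all

theorem assemble_new (i : Fin n) :
    M.assemble N w z X i (N.partner i) = M.newValue N w z i := by
  unfold assemble newValue
  split_ifs with h1 h2 h3 h4
  · exact absurd h2 ((M.mem_changed N).1 h1)
  · rfl
  · exact absurd rfl h3
  · rfl
  · exact absurd (M.partner_eq_of_notMem_changed N h1) h4

theorem assemble_old' (i : Fin n) :
    M.assemble N w z X (M.partner i) i = M.oldValue N w z (M.partner i) := by
  rw [← M.assemble_old N w z X, M.partner_partner]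

theorem assemble_new' (i : Fin n) :
    M.assemble N w z X (N.partner i) i = M.newValue N w z (N.partner i) := by
  rw [← M.assemble_new N w z X, N.partner_partner]

theorem assemble_other {i j : Fin n} (hM : j ≠ M.partner i) (hN : j ≠ N.partner i) :
    M.assemble N w z X i j = X (i, j) := by
  unfold assemble
  split_ifs <;> simp_all

theorem maxValue_of_notMem {i : Fin n} (h : i ∉ M.changed N) :
    M.maxValue N w z i = w ⟨i, h⟩ := by
  simp [maxValue, oldValue, newValue, h]

theorem oldValue_of_notMem {i : Fin n} (h : i ∉ M.changed N) :
    M.oldValue N w z i = w ⟨i, h⟩ := by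
  simp [oldValue, h]

theorem maxValue_of_mem {i : Fin n} (h : i ∈ M.changed N) :
    M.maxValue N w z i = max (z ⟨i, h⟩).1 (z ⟨i, h⟩).2 := by
  simp [maxValue, oldValue, newValue, h]

theorem partnerValues_assemble :
    M.partnerValues (M.assemble N w z X) = M.oldValue N w z :=
  funext fun i => M.assemble_old N w z X i

/-- The condition on the values under which both matchings are stable along the pairs of the other
one. -/
def Compatible : Prop :=
  ∀ i ∈ M.changed N,
    (M.newValue N w z i < M.oldValue N w z i ∨
      M.newValue N w z (M.partner i) < M.oldValue N w z (M.partner i)) ∧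
    (M.oldValue N w z i < M.newValue N w z i ∨
      M.oldValue N w z (N.partner i) < M.newValue N w z (N.partner i))

/-- The event splits into a condition on the partner values alone and conditions on other entries
with thresholds fixed by those values; given the values, the latter are independent. -/
theorem assemble_mem_switchEvent {T : Finset (Fin n × Fin n)}
    (hT : ∀ p ∈ T, p.2 ≠ M.partner p.1 ∧ p.2 ≠ N.partner p.1) :
    M.assemble N w z X ∈ M.switchEvent N T ↔ M.Compatible N w z ∧
      ∀ p ∈ T, M.maxValue N w z p.1 < X p ∨ M.maxValue N w z p.2 < X p.swap := by
  have hT' : ∀ p ∈ T, (max (M.assemble N w z X p.1 (M.partner p.1))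
      (M.assemble N w z X p.1 (N.partner p.1)) < M.assemble N w z X p.1 p.2 ∨
      max (M.assemble N w z X p.2 (M.partner p.2)) (M.assemble N w z X p.2 (N.partner p.2))
        < M.assemble N w z X p.2 p.1) ↔
      (M.maxValue N w z p.1 < X p ∨ M.maxValue N w z p.2 < X p.swap) := by
    intro p hp
    obtain ⟨h1, h2⟩ := hT p hp
    rw [assemble_old, assemble_new, assemble_old, assemble_new, assemble_other _ _ _ _ _ h1 h2,
      assemble_other _ _ _ _ _ (fun h => h1 (by rw [h, M.partner_partner]))
        (fun h => h2 (by rw [h, N.partner_partner]))]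
    rfl
  unfold switchEvent Compatible
  simp only [Set.mem_ofPred_eq]
  rw [forall₂_congr hT', ← and_assoc]
  refine and_congr ?_ Iff.rfl
  simp only [assemble_old, assemble_new, assemble_old', assemble_new']
  constructor
  · exact fun h i hi => ⟨h.1 i hi, h.2 i hi⟩
  · exact fun h => ⟨fun i hi => (h i hi).1, fun i hi => (h i hi).2⟩

end Values

theorem outerPairs_ne {p : Fin n × Fin n} (hp : p ∈ M.outerPairs N) :
    p.1 ≠ p.2 ∧ p.2 ≠ M.partner p.1 ∧ p.2 ≠ N.partner p.1 := by
  rcases Finset.mem_union.1 hp with hp | hp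
  · obtain ⟨h1, h2, h3⟩ := Finset.mem_filter.1 hp
    have hi := (Finset.mem_compl.1 (Finset.mem_product.1 h1).1)
    exact ⟨h2.ne, h3, by rwa [M.partner_eq_of_notMem_changed N hi]⟩
  · obtain ⟨h1, h2⟩ := Finset.mem_product.1 hp
    rw [Finset.mem_compl] at h2
    exact ⟨fun h => h2 (h ▸ h1), fun h => h2 (h ▸ M.partner_mem_changed N h1),
      fun h => h2 (h ▸ M.partner_mem_changed' N h1)⟩

theorem innerPairs_ne {p : Fin n × Fin n} (hp : p ∈ M.innerPairs N) :
    p.1 ≠ p.2 ∧ p.2 ≠ M.partner p.1 ∧ p.2 ≠ N.partner p.1 := by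
  obtain ⟨-, h2, h3⟩ := Finset.mem_filter.1 hp
  exact ⟨h2.ne, h3⟩

theorem mem_outerPairs {p : Fin n × Fin n} : p ∈ M.outerPairs N ↔
    (p.1 ∉ M.changed N ∧ p.2 ∉ M.changed N ∧ p.1 < p.2 ∧ p.2 ≠ M.partner p.1) ∨
      (p.1 ∈ M.changed N ∧ p.2 ∉ M.changed N) := by
  simp [outerPairs, unmatchedPairs, and_assoc]

theorem mem_innerPairs {p : Fin n × Fin n} : p ∈ M.innerPairs N ↔
    p.1 ∈ M.changed N ∧ p.2 ∈ M.changed N ∧ p.1 < p.2 ∧ p.2 ≠ M.partner p.1 ∧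
      p.2 ≠ N.partner p.1 := by
  simp [innerPairs, and_assoc]

theorem swap_notMem_outerPairs {p : Fin n × Fin n} (hp : p ∈ M.outerPairs N) :
    p.swap ∉ M.outerPairs N := by
  rw [mem_outerPairs] at hp ⊢
  simp only [Prod.fst_swap, Prod.snd_swap]
  rcases hp with ⟨h1, h2, h3, h4⟩ | ⟨h1, h2⟩
  · rintro (⟨-, -, h, -⟩ | ⟨h, -⟩)
    · exact lt_asymm h3 h
    · exact h2 h
  · rintro (⟨-, h, -⟩ | ⟨h, -⟩)
    · exact h h1
    · exact h2 h

theorem swap_notMem_all {p : Fin n × Fin n} (hp : p ∈ M.outerPairs N ∪ M.innerPairs N) :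
    p.swap ∉ M.outerPairs N ∪ M.innerPairs N := by
  rw [Finset.mem_union] at hp ⊢
  rcases hp with hp | hp
  · rintro (h | h)
    · exact M.swap_notMem_outerPairs N hp h
    · rw [mem_innerPairs] at h
      rw [mem_outerPairs] at hp
      simp only [Prod.fst_swap, Prod.snd_swap] at h
      tauto
  · rintro (h | h)
    · rw [mem_innerPairs] at hp
      rw [mem_outerPairs] at h
      simp only [Prod.fst_swap, Prod.snd_swap] at h
      tauto
    · rw [mem_innerPairs] at hp h
      exact lt_asymm hp.2.2.1 h.2.2.1

/-- Listing each unordered pair in one order only makes different pairs read disjoint sets of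
entries, so the probabilities multiply. -/
theorem measure_assemble_pairs {T : Finset (Fin n × Fin n)} (hne : ∀ p ∈ T, p.1 ≠ p.2)
    (hsw : ∀ p ∈ T, p.swap ∉ T) {m : Fin n → ℝ} (h0 : ∀ i, 0 ≤ m i) (h1 : ∀ i, m i ≤ 1) :
    Measure.pi (fun _ : Fin n × Fin n => unitLaw)
        {X | ∀ p ∈ T, m p.1 < X p ∨ m p.2 < X p.swap}
      = ENNReal.ofReal (∏ p ∈ T, (1 - m p.1 * m p.2)) := by
  refine pi_unitLaw_forall_or T (fun p => p) Prod.swap (fun p => m p.1) (fun p => m p.2) ?_ ?_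
    (fun p _ => h0 _) (fun p _ => h1 _) (fun p _ => h0 _) (fun p _ => h1 _)
  · rintro ⟨i, j⟩ hp h
    exact hne _ hp (congrArg Prod.fst h)
  · intro p hp q hq hpq
    rw [Finset.disjoint_left]
    intro k hk hk'
    simp only [Finset.mem_insert, Finset.mem_singleton] at hk hk'
    rcases hk with rfl | rfl <;> rcases hk' with h | h
    · exact hpq h
    · exact hsw q hq (h ▸ hp)
    · exact hsw p hp (h ▸ hq)
    · exact hpq (Prod.swap_injective h)

theorem prod_outerPairs (f : Fin n × Fin n → ℝ) :
    ∏ p ∈ M.outerPairs N, f p = (∏ p ∈ unmatchedPairs (M.changed N)ᶜ M.partner, f p)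
      * ∏ i ∈ M.changed N, ∏ j ∈ (M.changed N)ᶜ, f (i, j) := by
  rw [outerPairs, Finset.prod_union, Finset.prod_product]
  rw [Finset.disjoint_left]
  intro p hp hp'
  have h1 := (Finset.mem_product.1 (Finset.mem_filter.1 hp).1).1
  have h2 := (Finset.mem_product.1 hp').1
  exact (Finset.mem_compl.1 h1) h2

theorem prod_outerPairs_union_innerPairs (f : Fin n × Fin n → ℝ) :
    ∏ p ∈ M.outerPairs N ∪ M.innerPairs N, f p
      = (∏ p ∈ M.outerPairs N, f p) * ∏ p ∈ M.innerPairs N, f p := by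
  rw [Finset.prod_union]
  rw [Finset.disjoint_left]
  intro p hp hp'
  rw [mem_outerPairs] at hp
  rw [mem_innerPairs] at hp'
  tauto

end PerfectMatching

/-! ### The contribution of one changed person. -/

section PlanarIntegrals

theorem unitLaw_Iio {c : ℝ} (hc1 : c ≤ 1) : unitLaw (Set.Iio c) = ENNReal.ofReal c := by
  rw [← unitLaw_Iic hc1]
  exact measure_congr Iio_ae_eq_Iic

theorem ae_unitLaw_mem : ∀ᵐ t ∂unitLaw, 0 < t ∧ t ≤ 1 :=
  ae_restrict_mem (μ := volume) (s := Set.Ioc (0 : ℝ) 1) measurableSet_Ioc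

/-- The smaller of the two values is uniform below the larger value t; this is the source of the
factor t. -/
theorem lintegral_unitLaw_prod_snd_lt {g : ℝ → ℝ≥0∞} (hg : Measurable g) :
    ∫⁻ t : ℝ × ℝ, (if t.2 < t.1 then g t.1 else 0) ∂(unitLaw.prod unitLaw)
      = ∫⁻ t, ENNReal.ofReal t * g t ∂unitLaw := by
  rw [lintegral_prod _ (Measurable.ite (measurableSet_lt (by fun_prop) (by fun_prop))
    (by fun_prop) (by fun_prop)).aemeasurable]
  refine lintegral_congr_ae ?_
  filter_upwards [ae_unitLaw_mem] with t ht
  have : ∀ y : ℝ, (if y < t then g t else 0) = (Set.Iio t).indicator (fun _ => g t) y := by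
    intro y; simp [Set.indicator]
  simp only [this]
  rw [lintegral_indicator measurableSet_Iio, setLIntegral_const, unitLaw_Iio ht.2, mul_comm]

theorem lintegral_unitLaw_prod_fst_lt {g : ℝ → ℝ≥0∞} (hg : Measurable g) :
    ∫⁻ t : ℝ × ℝ, (if t.1 < t.2 then g t.2 else 0) ∂(unitLaw.prod unitLaw)
      = ∫⁻ t, ENNReal.ofReal t * g t ∂unitLaw := by
  rw [lintegral_prod_symm _ (Measurable.ite (measurableSet_lt (by fun_prop) (by fun_prop))
    (by fun_prop) (by fun_prop)).aemeasurable]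
  refine lintegral_congr_ae ?_
  filter_upwards [ae_unitLaw_mem] with t ht
  have : ∀ y : ℝ, (if y < t then g t else 0) = (Set.Iio t).indicator (fun _ => g t) y := by
    intro y; simp [Set.indicator]
  simp only [this]
  rw [lintegral_indicator measurableSet_Iio, setLIntegral_const, unitLaw_Iio ht.2, mul_comm]

theorem lintegral_unitLaw_prod_fst_le {g : ℝ → ℝ≥0∞} (hg : Measurable g) :
    ∫⁻ t : ℝ × ℝ, (if t.1 ≤ t.2 then g t.2 else 0) ∂(unitLaw.prod unitLaw)
      = ∫⁻ t, ENNReal.ofReal t * g t ∂unitLaw := by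
  rw [lintegral_prod_symm _ (Measurable.ite (measurableSet_le (by fun_prop) (by fun_prop))
    (by fun_prop) (by fun_prop)).aemeasurable]
  refine lintegral_congr_ae ?_
  filter_upwards [ae_unitLaw_mem] with t ht
  have : ∀ y : ℝ, (if y ≤ t then g t else 0) = (Set.Iic t).indicator (fun _ => g t) y := by
    intro y; simp [Set.indicator]
  simp only [this]
  rw [lintegral_indicator measurableSet_Iic, setLIntegral_const, unitLaw_Iic ht.2, mul_comm]

theorem lintegral_mul_exp_le {s : ℝ} (hs : 0 < s) :
    ∫⁻ t, ENNReal.ofReal t * ENNReal.ofReal (Real.exp (-(t * s))) ∂unitLaw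
      ≤ ENNReal.ofReal (s ^ 2)⁻¹ := by
  refine (lintegral_mono_set Set.Ioc_subset_Ioi_self).trans ?_
  rw [setLIntegral_Ioi_zero_mul_left (inv_pos.2 hs) (by fun_prop),
    ← lintegral_const_mul _ (by fun_prop)]
  have h := lintegral_pow_mul_exp_neg 2 (by norm_num)
  have e : ∫⁻ t in Set.Ioi (0 : ℝ), ENNReal.ofReal s⁻¹ *
      (ENNReal.ofReal (s⁻¹ * t) * ENNReal.ofReal (Real.exp (-(s⁻¹ * t * s))))
      = ∫⁻ t in Set.Ioi (0 : ℝ), ENNReal.ofReal (s ^ 2)⁻¹ *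
        ENNReal.ofReal (t ^ (2 - 1) * Real.exp (-t)) := by
    refine setLIntegral_congr_fun measurableSet_Ioi fun t ht => ?_
    have ht : (0 : ℝ) < t := ht
    have h1 : s⁻¹ * t * s = t := by field_simp
    rw [h1, ← ENNReal.ofReal_mul (by positivity), ← ENNReal.ofReal_mul (by positivity),
      ← ENNReal.ofReal_mul (by positivity)]
    congr 1
    norm_num
    field_simp
  rw [e, lintegral_const_mul _ (by fun_prop), h]
  norm_num

/-- Truncation at L loses only the relative amount (1 + Ls) e^{-Ls}, which is tiny when Ls is of
order log² n. -/
theorem le_lintegral_mul_exp {s L : ℝ} (hs : 0 < s) (hL0 : 0 ≤ L) (hL : L ≤ 1) :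
    ENNReal.ofReal ((1 - (1 + L * s) * Real.exp (-(L * s))) * (s ^ 2)⁻¹)
      ≤ ∫⁻ t, ENNReal.ofReal t *
        (if t ≤ L then ENNReal.ofReal (Real.exp (-(t * s))) else 0) ∂unitLaw := by
  have hF : ∀ t : ℝ, HasDerivAt (fun t => -((t / s + (s ^ 2)⁻¹) * Real.exp (-(t * s))))
      (t * Real.exp (-(t * s))) t := by
    intro t
    have h1 : HasDerivAt (fun t : ℝ => t / s + (s ^ 2)⁻¹) (1 / s) t :=
      ((hasDerivAt_id t).div_const s).add_const _
    have h2 : HasDerivAt (fun t : ℝ => Real.exp (-(t * s))) (Real.exp (-(t * s)) * -(1 * s)) t :=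
      ((hasDerivAt_id t).mul_const s).neg.exp
    refine (h1.mul h2).neg.congr_deriv ?_
    field_simp
    ring
  have hI := intervalIntegral.integral_eq_sub_of_hasDerivAt (a := 0) (b := L) (fun t _ => hF t)
    (by apply Continuous.intervalIntegrable; fun_prop)
  rw [intervalIntegral.integral_of_le hL0] at hI
  have e : (1 - (1 + L * s) * Real.exp (-(L * s))) * (s ^ 2)⁻¹
      = ∫ t in Set.Ioc 0 L, t * Real.exp (-(t * s)) := by
    rw [hI]
    simp
    field_simp
    ring
  rw [e, ofReal_integral_eq_lintegral_ofReal]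
  · have h3 : (Set.Ioc (0 : ℝ) L) ⊆ Set.Ioc 0 1 := Set.Ioc_subset_Ioc_right hL
    refine le_trans (le_of_eq ?_) (lintegral_mono_set h3)
    refine setLIntegral_congr_fun measurableSet_Ioc fun t ht => ?_
    rw [if_pos ht.2, ENNReal.ofReal_mul ht.1.le]
  · exact (Continuous.integrableOn_Icc (by fun_prop)).mono_set Set.Ioc_subset_Icc_self
  · filter_upwards [ae_restrict_mem measurableSet_Ioc] with t ht
    have := ht.1
    positivity

end PlanarIntegrals

/-! ### Integral bounds for the probability of switching events. -/

namespace PerfectMatching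

variable {n : ℕ} (M N : PerfectMatching n)

/-- The weight of a changed person's pair of values: the person prefers the partner in `N` or the
one in `M`, according to membership in `B`, and the larger value `t` has weight `exp (-t * s)`. -/
noncomputable def upperWeight (s : ℝ) (B : Finset (Fin n)) (i : Fin n) (t : ℝ × ℝ) : ℝ≥0∞ :=
  if i ∈ B then (if t.2 < t.1 then ENNReal.ofReal (Real.exp (-(t.1 * s))) else 0)
    -- Ties are included, so that the pattern read off from any values gets a nonzero weight in the
    -- upper bound.
    else (if t.1 ≤ t.2 then ENNReal.ofReal (Real.exp (-(t.2 * s))) else 0)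

theorem measurable_upperWeight (s : ℝ) (B : Finset (Fin n)) (i : Fin n) :
    Measurable (upperWeight s B i) := by
  unfold upperWeight
  split_ifs
  · exact Measurable.ite (measurableSet_lt (by fun_prop) (by fun_prop)) (by fun_prop) (by fun_prop)
  · exact Measurable.ite (measurableSet_le (by fun_prop) (by fun_prop)) (by fun_prop) (by fun_prop)

theorem lintegral_upperWeight_le {s : ℝ} (hs : 0 < s) (B : Finset (Fin n)) (i : Fin n) :
    ∫⁻ t, upperWeight s B i t ∂(unitLaw.prod unitLaw) ≤ ENNReal.ofReal (s ^ 2)⁻¹ := by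
  unfold upperWeight
  split_ifs
  · rw [lintegral_unitLaw_prod_snd_lt (g := fun t => ENNReal.ofReal (Real.exp (-(t * s))))
      (by fun_prop)]
    exact lintegral_mul_exp_le hs
  · rw [lintegral_unitLaw_prod_fst_le (g := fun t => ENNReal.ofReal (Real.exp (-(t * s))))
      (by fun_prop)]
    exact lintegral_mul_exp_le hs

/-- A strict version of `upperWeight`, restricted to values up to `L`. -/
noncomputable def lowerWeight (L s : ℝ) (B : Finset (Fin n)) (i : Fin n) (t : ℝ × ℝ) : ℝ≥0∞ :=
  if i ∈ B then
    (if t.2 < t.1 then (if t.1 ≤ L then ENNReal.ofReal (Real.exp (-(t.1 * s))) else 0) else 0)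
  else
    (if t.1 < t.2 then (if t.2 ≤ L then ENNReal.ofReal (Real.exp (-(t.2 * s))) else 0) else 0)

theorem measurable_lowerWeight (L s : ℝ) (B : Finset (Fin n)) (i : Fin n) :
    Measurable (lowerWeight L s B i) := by
  have h : Measurable fun t : ℝ => if t ≤ L then ENNReal.ofReal (Real.exp (-(t * s))) else 0 :=
    Measurable.ite measurableSet_Iic (by fun_prop) (by fun_prop)
  unfold lowerWeight
  split_ifs
  · exact Measurable.ite (measurableSet_lt (by fun_prop) (by fun_prop)) (h.comp measurable_fst)
      (by fun_prop)
  · exact Measurable.ite (measurableSet_lt (by fun_prop) (by fun_prop)) (h.comp measurable_snd)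
      (by fun_prop)

theorem le_lintegral_lowerWeight {L s : ℝ} (hs : 0 < s) (hL0 : 0 ≤ L) (hL : L ≤ 1)
    (B : Finset (Fin n)) (i : Fin n) :
    ENNReal.ofReal ((1 - (1 + L * s) * Real.exp (-(L * s))) * (s ^ 2)⁻¹)
      ≤ ∫⁻ t, lowerWeight L s B i t ∂(unitLaw.prod unitLaw) := by
  have h : Measurable fun t : ℝ => if t ≤ L then ENNReal.ofReal (Real.exp (-(t * s))) else 0 :=
    Measurable.ite measurableSet_Iic (by fun_prop) (by fun_prop)
  unfold lowerWeight
  split_ifs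
  · rw [lintegral_unitLaw_prod_snd_lt h]
    exact le_lintegral_mul_exp hs hL0 hL
  · rw [lintegral_unitLaw_prod_fst_lt h]
    exact le_lintegral_mul_exp hs hL0 hL

section Bounds

variable (w : {i // i ∉ M.changed N} → ℝ) (z : {i // i ∈ M.changed N} → ℝ × ℝ)

theorem sum_oldValue (f : ℝ → ℝ) :
    ∑ i ∈ (M.changed N)ᶜ, f (M.oldValue N w z i) = ∑ i, f (w i) := by
  rw [Finset.sum_subtype (p := fun i => i ∉ M.changed N) _ (by simp)]
  refine Finset.sum_congr rfl fun i _ => ?_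
  rw [M.oldValue_of_notMem N w z i.2]

theorem sum_maxValue (f : ℝ → ℝ) :
    ∑ i ∈ (M.changed N)ᶜ, f (M.maxValue N w z i) = ∑ i, f (w i) := by
  rw [Finset.sum_subtype (p := fun i => i ∉ M.changed N) _ (by simp)]
  refine Finset.sum_congr rfl fun i _ => ?_
  rw [M.maxValue_of_notMem N w z i.2]

theorem prod_unmatchedPairs_maxValue :
    ∏ p ∈ unmatchedPairs (M.changed N)ᶜ M.partner,
        (1 - M.maxValue N w z p.1 * M.maxValue N w z p.2)
      = ∏ p ∈ unmatchedPairs (M.changed N)ᶜ M.partner,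
        (1 - M.oldValue N w z p.1 * M.oldValue N w z p.2) := by
  refine Finset.prod_congr rfl fun p hp => ?_
  obtain ⟨h1, h2⟩ := Finset.mem_product.1 (Finset.mem_filter.1 hp).1
  rw [Finset.mem_compl] at h1 h2
  rw [M.maxValue_of_notMem N w z h1, M.maxValue_of_notMem N w z h2,
    M.oldValue_of_notMem N w z h1, M.oldValue_of_notMem N w z h2]

variable {w z}

theorem maxValue_pos (hw : ∀ i, 0 < w i) (hz : ∀ i, 0 < (z i).1) (i : Fin n) :
    0 < M.maxValue N w z i := by
  refine lt_max_of_lt_left ?_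
  unfold oldValue
  split_ifs
  · exact hz _
  · exact hw _

theorem maxValue_le {L : ℝ} (hw : ∀ i, w i ≤ L) (hz : ∀ i, (z i).1 ≤ L ∧ (z i).2 ≤ L)
    (i : Fin n) : M.maxValue N w z i ≤ L := by
  refine max_le ?_ ?_
  · unfold oldValue
    split_ifs
    · exact (hz _).1
    · exact hw _
  · unfold newValue
    split_ifs
    · exact (hz _).2
    · exact hw _

theorem prod_cross_le (hw : ∀ i, 0 < w i ∧ w i ≤ 1)
    (hz : ∀ i, (0 < (z i).1 ∧ (z i).1 ≤ 1) ∧ (0 < (z i).2 ∧ (z i).2 ≤ 1)) {i : Fin n}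
    (hi : i ∈ M.changed N) :
    ∏ j ∈ (M.changed N)ᶜ, (1 - M.maxValue N w z i * M.maxValue N w z j)
      ≤ Real.exp (-(max (z ⟨i, hi⟩).1 (z ⟨i, hi⟩).2 * ∑ j, w j)) := by
  have h0 := M.maxValue_pos N (fun i => (hw i).1) fun i => (hz i).1.1
  have h1 := M.maxValue_le N (fun i => (hw i).2) fun i => ⟨(hz i).1.2, (hz i).2.2⟩
  rw [← M.maxValue_of_mem N w z hi, ← M.sum_maxValue N w z (fun t => t), Finset.mul_sum,
    ← Finset.sum_neg_distrib, Real.exp_sum]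
  refine Finset.prod_le_prod (fun j _ => ?_) fun j _ => ?_
  · linarith [mul_le_one₀ (h1 i) (h0 j).le (h1 j)]
  · linarith [Real.add_one_le_exp (-(M.maxValue N w z i * M.maxValue N w z j))]

theorem le_prod_cross {L : ℝ} (hL : L ^ 2 ≤ 1 / 2) (hw : ∀ i, 0 < w i ∧ w i ≤ L)
    (hQ : ∑ i, w i ^ 2 ≤ 3)
    (hz : ∀ i, (0 < (z i).1 ∧ (z i).1 ≤ L) ∧ (0 < (z i).2 ∧ (z i).2 ≤ L)) {i : Fin n}
    (hi : i ∈ M.changed N) :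
    Real.exp (-(6 * L ^ 2)) * Real.exp (-(max (z ⟨i, hi⟩).1 (z ⟨i, hi⟩).2 * ∑ j, w j))
      ≤ ∏ j ∈ (M.changed N)ᶜ, (1 - M.maxValue N w z i * M.maxValue N w z j) := by
  have h0 := M.maxValue_pos N (fun i => (hw i).1) fun i => (hz i).1.1
  have h1 := M.maxValue_le N (fun i => (hw i).2) fun i => ⟨(hz i).1.2, (hz i).2.2⟩
  rw [← M.maxValue_of_mem N w z hi, ← M.sum_maxValue N w z (fun t => t)]
  rw [← M.sum_maxValue N w z (fun t => t ^ 2)] at hQ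
  calc _ ≤ Real.exp (∑ j ∈ (M.changed N)ᶜ, (-(M.maxValue N w z i * M.maxValue N w z j)
        - 2 * (M.maxValue N w z i * M.maxValue N w z j) ^ 2)) := by
        rw [← Real.exp_add]
        apply Real.exp_le_exp.2
        rw [Finset.sum_sub_distrib, Finset.sum_neg_distrib, ← Finset.mul_sum, ← Finset.mul_sum]
        simp only [mul_pow]
        rw [← Finset.mul_sum]
        have : M.maxValue N w z i ^ 2 * ∑ j ∈ (M.changed N)ᶜ, M.maxValue N w z j ^ 2
            ≤ L ^ 2 * 3 :=
          mul_le_mul (pow_le_pow_left₀ (h0 i).le (h1 i) 2) hQ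
            (Finset.sum_nonneg fun _ _ => by positivity) (by positivity)
        linarith
    _ ≤ _ := by
        rw [Real.exp_sum]
        refine Finset.prod_le_prod (fun j _ => (Real.exp_pos _).le) fun j _ => ?_
        refine exp_neg_sub_two_mul_sq_le (mul_nonneg (h0 i).le (h0 j).le) (le_trans ?_ hL)
        rw [sq]
        exact mul_le_mul (h1 i) (h1 j) (h0 j).le ((h0 i).le.trans (h1 i))

end Bounds

theorem ae_pi_unitLaw_mem (ι : Type*) [Fintype ι] :
    ∀ᵐ w ∂(Measure.pi fun _ : ι => unitLaw), ∀ i, 0 < w i ∧ w i ≤ 1 :=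
  ae_all_iff.2 fun i => (measurePreserving_eval (fun _ : ι => unitLaw) i).quasiMeasurePreserving.ae
    ae_unitLaw_mem

theorem ae_pi_unitLaw_prod_mem (ι : Type*) [Fintype ι] :
    ∀ᵐ z ∂(Measure.pi fun _ : ι => unitLaw.prod unitLaw),
      ∀ i, (0 < (z i).1 ∧ (z i).1 ≤ 1) ∧ (0 < (z i).2 ∧ (z i).2 ≤ 1) := by
  have h : ∀ᵐ t ∂(unitLaw.prod unitLaw), (0 < t.1 ∧ t.1 ≤ 1) ∧ (0 < t.2 ∧ t.2 ≤ 1) := by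
    filter_upwards [Measure.quasiMeasurePreserving_fst.ae ae_unitLaw_mem,
      Measure.quasiMeasurePreserving_snd.ae ae_unitLaw_mem] with t h1 h2
    exact ⟨h1, h2⟩
  exact ae_all_iff.2 fun i =>
    (measurePreserving_eval (fun _ : ι => unitLaw.prod unitLaw) i).quasiMeasurePreserving.ae h

theorem pi_unitLaw_eq (ι : Type*) [Fintype ι] :
    Measure.pi (fun _ : ι => unitLaw) = volume.restrict (Set.univ.pi fun _ => Set.Ioc 0 1) := by
  rw [volume_pi, Measure.restrict_pi_pi]

/-- The people whose new value is smaller form an orientation, by compatibility, and the term of the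
sum at this orientation already dominates the left side. -/
theorem ofReal_prod_cross_le_sum_upperWeight {w : {i // i ∉ M.changed N} → ℝ}
    {z : {i // i ∈ M.changed N} → ℝ × ℝ} (hw : ∀ i, 0 < w i ∧ w i ≤ 1)
    (hz : ∀ i, (0 < (z i).1 ∧ (z i).1 ≤ 1) ∧ (0 < (z i).2 ∧ (z i).2 ≤ 1))
    (hc : M.Compatible N w z) :
    ENNReal.ofReal (∏ i ∈ M.changed N, ∏ j ∈ (M.changed N)ᶜ,
        (1 - M.maxValue N w z i * M.maxValue N w z j)) ≤
      ∑ B ∈ M.orientations N,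
        ∏ i : {i // i ∈ M.changed N}, upperWeight (∑ i, w i) B i (z i) := by
  have h0 := M.maxValue_pos N (fun i => (hw i).1) fun i => (hz i).1.1
  have h1 := M.maxValue_le N (fun i => (hw i).2) fun i => ⟨(hz i).1.2, (hz i).2.2⟩
  set B := (M.changed N).filter fun i => M.newValue N w z i < M.oldValue N w z i with hB
  have hBmem : B ∈ M.orientations N := by
    refine Finset.mem_filter.2 ⟨Finset.mem_powerset.2 (Finset.filter_subset _ _),
      fun i hi => ⟨?_, ?_⟩⟩
    · rcases (hc i hi).1 with h | h
      · exact Or.inl (Finset.mem_filter.2 ⟨hi, h⟩)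
      · exact Or.inr (Finset.mem_filter.2 ⟨M.partner_mem_changed N hi, h⟩)
    · rcases (hc i hi).2 with h | h
      · exact Or.inl fun hm => lt_asymm h (Finset.mem_filter.1 hm).2
      · exact Or.inr fun hm => lt_asymm h (Finset.mem_filter.1 hm).2
  have hle : ∏ i : {i // i ∈ M.changed N}, upperWeight (∑ i, w i) B i (z i) ≤
      ∑ B ∈ M.orientations N, ∏ i : {i // i ∈ M.changed N}, upperWeight (∑ i, w i) B i (z i) := by
    rw [← Finset.add_sum_erase _ _ hBmem]
    exact le_self_add
  refine le_trans ?_ hle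
  rw [Finset.prod_subtype (p := fun i => i ∈ M.changed N) _ (fun _ => Iff.rfl),
    ENNReal.ofReal_prod_of_nonneg]
  swap
  · intro i _
    refine Finset.prod_nonneg fun j _ => ?_
    linarith [mul_le_one₀ (h1 i) (h0 j).le (h1 j)]
  refine Finset.prod_le_prod' fun i _ => ?_
  refine (ENNReal.ofReal_le_ofReal (M.prod_cross_le N hw hz i.2)).trans ?_
  have hold : M.oldValue N w z i = (z i).1 := by simp [oldValue, i.2]
  have hnew : M.newValue N w z i = (z i).2 := by simp [newValue, i.2]
  unfold upperWeight
  have hiB : (i : Fin n) ∈ B ↔ (z i).2 < (z i).1 := by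
    rw [hB, Finset.mem_filter, hold, hnew]
    exact ⟨fun h => h.2, fun h => ⟨i.2, h⟩⟩
  split_ifs with h1 h2 h3
  · rw [max_eq_left h2.le]
  · exact absurd (hiB.1 h1) h2
  · rw [max_eq_right h3]
  · exact absurd (hiB.2 (not_le.1 h3)) h1

/-- Upper bound for an event on which both matchings are stable along the outer pairs. -/
theorem prefMeasure_le_of_subset_switchEvent [Nonempty {i // i ∉ M.changed N}]
    {E : Set (Fin n → Fin n → ℝ)} (hE : MeasurableSet E) {A : Set (Fin n → ℝ)}
    (hsub : E ⊆ M.switchEvent N (M.outerPairs N) ∩ {X | M.partnerValues X ∈ A})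
    {D : Set ({i // i ∉ M.changed N} → ℝ)} (hD : MeasurableSet D) {K : ℝ} (hK : 0 ≤ K)
    (h : ∀ w z, (∀ i, 0 < w i ∧ w i ≤ 1) →
      (∀ i, (0 < (z i).1 ∧ (z i).1 ≤ 1) ∧ (0 < (z i).2 ∧ (z i).2 ≤ 1)) →
      M.oldValue N w z ∈ A → w ∈ D ∧
        ∏ p ∈ unmatchedPairs (M.changed N)ᶜ M.partner,
          (1 - M.oldValue N w z p.1 * M.oldValue N w z p.2)
          ≤ K * Real.exp (-((∑ i, w i) ^ 2 / 2))) :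
    prefMeasure n E ≤ ENNReal.ofReal K * (M.orientations N).card *
      ∫⁻ w in positiveOrthant {i // i ∉ M.changed N} ∩ D,
        ENNReal.ofReal (chiWeight (2 * (M.changed N).card) (∑ i, w i)) := by
  have point : ∀ w z, (∀ i, 0 < w i ∧ w i ≤ 1) →
      (∀ i, (0 < (z i).1 ∧ (z i).1 ≤ 1) ∧ (0 < (z i).2 ∧ (z i).2 ≤ 1)) →
      Measure.pi (fun _ => unitLaw) {X : Fin n × Fin n → ℝ | M.assemble N w z X ∈ E}
        ≤ D.indicator (fun w => ENNReal.ofReal (K * Real.exp (-((∑ i, w i) ^ 2 / 2)))) w *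
          ∑ B ∈ M.orientations N,
            ∏ i : {i // i ∈ M.changed N}, upperWeight (∑ i, w i) B i (z i) := by
    intro w z hw hz
    by_cases hc : M.Compatible N w z ∧ M.oldValue N w z ∈ A
    · obtain ⟨hc, hA⟩ := hc
      obtain ⟨hwD, hF⟩ := h w z hw hz hA
      have h0 := M.maxValue_pos N (fun i => (hw i).1) fun i => (hz i).1.1
      have h1 := M.maxValue_le N (fun i => (hw i).2) fun i => ⟨(hz i).1.2, (hz i).2.2⟩
      have hsub2 : {X : Fin n × Fin n → ℝ | M.assemble N w z X ∈ E} ⊆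
          {X | ∀ p ∈ M.outerPairs N,
            M.maxValue N w z p.1 < X p ∨ M.maxValue N w z p.2 < X p.swap} := by
        intro X hX
        exact ((M.assemble_mem_switchEvent N w z X fun p hp => (M.outerPairs_ne N hp).2).1
          (hsub hX).1).2
      refine (measure_mono hsub2).trans ?_
      rw [measure_assemble_pairs (fun p hp => (M.outerPairs_ne N hp).1)
        (fun p hp => M.swap_notMem_outerPairs N hp) (fun i => (h0 i).le) h1, M.prod_outerPairs N,
        M.prod_unmatchedPairs_maxValue N, Set.indicator_of_mem hwD, ENNReal.ofReal_mul']
      swap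
      · refine Finset.prod_nonneg fun i _ => Finset.prod_nonneg fun j _ => ?_
        linarith [mul_le_one₀ (h1 i) (h0 j).le (h1 j)]
      refine mul_le_mul' (ENNReal.ofReal_le_ofReal hF) ?_
      exact M.ofReal_prod_cross_le_sum_upperWeight N hw hz hc
    · have : {X : Fin n × Fin n → ℝ | M.assemble N w z X ∈ E} = ∅ := by
        refine Set.eq_empty_of_forall_notMem fun X hX => hc ⟨?_, ?_⟩
        · exact ((M.assemble_mem_switchEvent N w z X fun p hp => (M.outerPairs_ne N hp).2).1
            (hsub hX).1).1
        · have := (hsub hX).2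
          rwa [Set.mem_ofPred_eq, M.partnerValues_assemble N w z] at this
      rw [this, measure_empty]
      exact zero_le
  rw [M.prefMeasure_eq_lintegral N hE]
  have inner : ∀ w, (∀ i, 0 < w i ∧ w i ≤ 1) →
      ∫⁻ z : {i // i ∈ M.changed N} → ℝ × ℝ,
        Measure.pi (fun _ => unitLaw) {X : Fin n × Fin n → ℝ | M.assemble N w z X ∈ E}
        ∂(Measure.pi fun _ => unitLaw.prod unitLaw)
      ≤ ENNReal.ofReal K * (M.orientations N).card *
        D.indicator (fun w => ENNReal.ofReal (chiWeight (2 * (M.changed N).card) (∑ i, w i))) w := by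
    intro w hw
    have hS : 0 < ∑ i, w i :=
      sum_pos_of_mem_positiveOrthant (mem_positiveOrthant.2 fun i => (hw i).1)
    refine (lintegral_mono_ae ((ae_pi_unitLaw_prod_mem {i // i ∈ M.changed N}).mono
      fun z hz => point w z hw hz)).trans ?_
    have hmeas : ∀ B, Measurable fun z : {i // i ∈ M.changed N} → ℝ × ℝ =>
        ∏ i : {i // i ∈ M.changed N}, upperWeight (∑ i, w i) B i (z i) := fun B =>
      Finset.measurable_fun_prod _ fun i _ =>
        (measurable_upperWeight (∑ i, w i) B (i : Fin n)).comp (measurable_pi_apply i)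
    rw [lintegral_const_mul _ (Finset.measurable_fun_sum _ fun B _ => hmeas B),
      lintegral_finsetSum _ fun B _ => hmeas B]
    -- Each changed person integrates to at most S^{-2}; the v factors turn e^{-S²/2} into
    -- `chiWeight (2 * v)`.
    have hB : ∀ B ∈ M.orientations N, ∫⁻ z : {i // i ∈ M.changed N} → ℝ × ℝ,
        ∏ i : {i // i ∈ M.changed N}, upperWeight (∑ i, w i) B i (z i) ∂(Measure.pi fun _ => unitLaw.prod unitLaw)
        ≤ ENNReal.ofReal ((∑ i, w i) ^ (2 * (M.changed N).card))⁻¹ := by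
      intro B _
      rw [lintegral_fintype_prod _ (fun (i : {i // i ∈ M.changed N}) t =>
        upperWeight (∑ i, w i) B i t) (fun i => measurable_upperWeight _ _ _)]
      refine (Finset.prod_le_prod' fun (i : {i // i ∈ M.changed N}) _ =>
        lintegral_upperWeight_le hS B (i : Fin n)).trans (le_of_eq ?_)
      rw [Finset.prod_const, ← ENNReal.ofReal_pow (by positivity), inv_pow, ← pow_mul]
      simp
    refine (mul_le_mul' le_rfl (Finset.sum_le_sum hB)).trans (le_of_eq ?_)
    rw [Finset.sum_const, nsmul_eq_mul]
    by_cases hwD : w ∈ D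
    · rw [Set.indicator_of_mem hwD, Set.indicator_of_mem hwD, ENNReal.ofReal_mul hK, chiWeight,
        ENNReal.ofReal_mul (by positivity)]
      ring
    · rw [Set.indicator_of_notMem hwD, Set.indicator_of_notMem hwD, zero_mul, mul_zero]
  refine (lintegral_mono_ae ((ae_pi_unitLaw_mem _).mono inner)).trans ?_
  rw [lintegral_const_mul _ (Measurable.indicator (by fun_prop) hD)]
  refine mul_le_mul' le_rfl ?_
  rw [pi_unitLaw_eq]
  refine (lintegral_mono_set (Set.pi_mono fun i _ => Set.Ioc_subset_Ioi_self)).trans (le_of_eq ?_)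
  rw [Set.inter_comm]
  exact setLIntegral_indicator hD _

/-- Lower bound for an event that holds when both matchings are stable along all pairs. -/
theorem le_prefMeasure_of_switchEvent_subset [Nonempty {i // i ∉ M.changed N}]
    {E : Set (Fin n → Fin n → ℝ)} (hE : MeasurableSet E) {A : Set (Fin n → ℝ)}
    (hsub : M.switchEvent N (M.outerPairs N ∪ M.innerPairs N) ∩ {X | M.partnerValues X ∈ A} ⊆ E)
    {D : Set ({i // i ∉ M.changed N} → ℝ)} (hD : MeasurableSet D) {K L η : ℝ} (hK : 0 ≤ K)
    (hL0 : 0 ≤ L) (hL : L ^ 2 ≤ 1 / 2) (hη : η ≤ 1)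
    (h : ∀ w z, (∀ i, 0 < w i) → w ∈ D →
      (∀ i, (0 < (z i).1 ∧ (z i).1 ≤ L) ∧ (0 < (z i).2 ∧ (z i).2 ≤ L)) →
      M.oldValue N w z ∈ A ∧
        K * Real.exp (-((∑ i, w i) ^ 2 / 2)) ≤
          ∏ p ∈ unmatchedPairs (M.changed N)ᶜ M.partner,
          (1 - M.oldValue N w z p.1 * M.oldValue N w z p.2))
    (hDL : ∀ w ∈ D, ∀ i, w i ≤ L) (hDQ : ∀ w ∈ D, ∑ i, w i ^ 2 ≤ 3)
    (hDη : ∀ w ∈ D, (∀ i, 0 < w i) →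
      (1 + L * ∑ i, w i) * Real.exp (-(L * ∑ i, w i)) ≤ η) :
    ENNReal.ofReal (K * (1 - L ^ 2) ^ ((M.changed N).card ^ 2) *
        (Real.exp (-(6 * L ^ 2)) * (1 - η)) ^ (M.changed N).card) * (M.orientations N).card *
      ∫⁻ w in positiveOrthant {i // i ∉ M.changed N} ∩ D,
        ENNReal.ofReal (chiWeight (2 * (M.changed N).card) (∑ i, w i)) ≤ prefMeasure n E := by
  have hL1 : L ≤ 1 := by nlinarith
  have hL2 : 0 ≤ 1 - L ^ 2 := by linarith
  set v := (M.changed N).card with hv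
  set c : ({i // i ∉ M.changed N} → ℝ) → ℝ≥0∞ := fun w => ENNReal.ofReal (K *
    Real.exp (-((∑ i, w i) ^ 2 / 2)) * Real.exp (-(6 * L ^ 2)) ^ v * (1 - L ^ 2) ^ (v ^ 2)) with hc
  have point : ∀ w z, (∀ i, 0 < w i) → w ∈ D →
      (∀ i, (0 < (z i).1 ∧ (z i).1 ≤ 1) ∧ (0 < (z i).2 ∧ (z i).2 ≤ 1)) →
      c w * ∑ B ∈ M.orientations N,
            ∏ i : {i // i ∈ M.changed N}, lowerWeight L (∑ i, w i) B i (z i)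
      ≤ Measure.pi (fun _ => unitLaw) {X : Fin n × Fin n → ℝ | M.assemble N w z X ∈ E} := by
    intro w z hw hwD hz
    have hold : ∀ i : {i // i ∈ M.changed N}, M.oldValue N w z i = (z i).1 := fun i => by
      simp [oldValue, i.2]
    have hnew : ∀ i : {i // i ∈ M.changed N}, M.newValue N w z i = (z i).2 := fun i => by
      simp [newValue, i.2]
    set B₀ := (M.changed N).filter fun i => M.newValue N w z i < M.oldValue N w z i with hB₀
    have hmem₀ : ∀ i : {i // i ∈ M.changed N}, (i : Fin n) ∈ B₀ ↔ (z i).2 < (z i).1 := by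
      intro i
      rw [hB₀, Finset.mem_filter, hold, hnew]
      exact ⟨fun h => h.2, fun h => ⟨i.2, h⟩⟩
    -- A nonzero term forces `B` to be the pattern of the values themselves, so at most one term of
    -- the sum survives and no configuration is counted twice.
    have hnz : ∀ B ∈ M.orientations N,
        ∏ i : {i // i ∈ M.changed N}, lowerWeight L (∑ i, w i) B i (z i) ≠ 0 →
        B = B₀ ∧ ∀ i : {i // i ∈ M.changed N}, (z i).1 ≠ (z i).2 ∧ (z i).1 ≤ L ∧ (z i).2 ≤ L := by
      intro B hB hne
      have hne' := Finset.prod_ne_zero_iff.1 hne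
      have key : ∀ i : {i // i ∈ M.changed N}, (((i : Fin n) ∈ B ∧ (z i).2 < (z i).1) ∨
          ((i : Fin n) ∉ B ∧ (z i).1 < (z i).2)) ∧ (z i).1 ≤ L ∧ (z i).2 ≤ L := by
        intro i
        have hi := hne' i (Finset.mem_univ _)
        unfold lowerWeight at hi
        split_ifs at hi with h1 h2 h3 h2 h3
        · exact ⟨Or.inl ⟨h1, h2⟩, h3, h2.le.trans h3⟩
        · exact absurd rfl hi
        · exact absurd rfl hi
        · exact ⟨Or.inr ⟨h1, h2⟩, h2.le.trans h3, h3⟩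
        · exact absurd rfl hi
        · exact absurd rfl hi
      constructor
      · ext i
        by_cases hi : i ∈ M.changed N
        · have := (key ⟨i, hi⟩).1
          rw [hmem₀ ⟨i, hi⟩]
          constructor
          · intro hiB
            rcases this with h | h
            · exact h.2
            · exact absurd hiB h.1
          · intro hlt
            rcases this with h | h
            · exact h.1
            · exact absurd hlt (lt_asymm h.2)
        · constructor
          · intro hiB
            exact absurd (Finset.mem_powerset.1 (Finset.mem_filter.1 hB).1 hiB) hi
          · intro hiB
            exact absurd (Finset.mem_filter.1 hiB).1 hi
      · intro i
        refine ⟨?_, (key i).2⟩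
        rcases (key i).1 with h | h
        · exact h.2.ne'
        · exact h.2.ne
    by_cases hgood : B₀ ∈ M.orientations N ∧
        ∀ i : {i // i ∈ M.changed N}, (z i).1 ≠ (z i).2 ∧ (z i).1 ≤ L ∧ (z i).2 ≤ L
    · obtain ⟨hB0, hzL⟩ := hgood
      have hzL' : ∀ i, (0 < (z i).1 ∧ (z i).1 ≤ L) ∧ (0 < (z i).2 ∧ (z i).2 ≤ L) := fun i =>
        ⟨⟨(hz i).1.1, (hzL i).2.1⟩, (hz i).2.1, (hzL i).2.2⟩
      have hwL : ∀ i, 0 < w i ∧ w i ≤ L := fun i => ⟨hw i, hDL w hwD i⟩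
      obtain ⟨hA, hF⟩ := h w z hw hwD hzL'
      have h0 := M.maxValue_pos N (fun i => hw i) fun i => (hz i).1.1
      have h1L := M.maxValue_le N (fun i => (hwL i).2) fun i => (hzL i).2
      have h1 : ∀ i, M.maxValue N w z i ≤ 1 := fun i => (h1L i).trans hL1
      have hcomp : M.Compatible N w z := by
        have hor := (Finset.mem_filter.1 hB0).2
        have hnlt : ∀ i ∈ M.changed N, i ∉ B₀ → M.oldValue N w z i < M.newValue N w z i := by
          intro i hi hiB
          have h2 := hmem₀ ⟨i, hi⟩
          rw [hold ⟨i, hi⟩, hnew ⟨i, hi⟩]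
          exact lt_of_le_of_ne (not_lt.1 fun hlt => hiB (h2.2 hlt)) (hzL ⟨i, hi⟩).1
        intro i hi
        have hlt : ∀ i, i ∈ B₀ → M.newValue N w z i < M.oldValue N w z i :=
          fun i hi => (Finset.mem_filter.1 hi).2
        refine ⟨(hor i hi).1.imp (hlt _) (hlt _), (hor i hi).2.imp (hnlt i hi)
          (hnlt _ (M.partner_mem_changed' N hi))⟩
      have hsub2 : {X | ∀ p ∈ M.outerPairs N ∪ M.innerPairs N,
            M.maxValue N w z p.1 < X p ∨ M.maxValue N w z p.2 < X p.swap} ⊆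
            {X : Fin n × Fin n → ℝ | M.assemble N w z X ∈ E} := by
        intro X hX
        refine hsub ⟨(M.assemble_mem_switchEvent N w z X fun p hp => ?_).2 ⟨hcomp, hX⟩, ?_⟩
        · rcases Finset.mem_union.1 hp with hp | hp
          · exact (M.outerPairs_ne N hp).2
          · exact (M.innerPairs_ne N hp).2
        · rw [Set.mem_ofPred_eq, M.partnerValues_assemble N w z]
          exact hA
      refine le_trans ?_ (measure_mono hsub2)
      rw [measure_assemble_pairs (fun p hp => ?_)
        (fun p hp => M.swap_notMem_all N hp) (fun i => (h0 i).le) h1]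
      swap
      · rcases Finset.mem_union.1 hp with hp | hp
        · exact (M.outerPairs_ne N hp).1
        · exact (M.innerPairs_ne N hp).1
      rw [Finset.sum_eq_single B₀ (fun B hB hne => by
        by_contra hcon
        exact hne (hnz B hB hcon).1) (fun hcon => absurd hB0 hcon)]
      have hprod : ∏ i : {i // i ∈ M.changed N}, lowerWeight L (∑ i, w i) B₀ i (z i)
          = ENNReal.ofReal (∏ i : {i // i ∈ M.changed N},
            Real.exp (-(max (z i).1 (z i).2 * ∑ j, w j))) := by
        rw [ENNReal.ofReal_prod_of_nonneg fun _ _ => by positivity]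
        refine Finset.prod_congr rfl fun i _ => ?_
        unfold lowerWeight
        by_cases hi : (i : Fin n) ∈ B₀
        · have hlt := (hmem₀ i).1 hi
          rw [if_pos hi, if_pos hlt, if_pos (hzL i).2.1, max_eq_left hlt.le]
        · have hlt : (z i).1 < (z i).2 :=
            lt_of_le_of_ne (not_lt.1 fun hlt => hi ((hmem₀ i).2 hlt)) (hzL i).1
          rw [if_neg hi, if_pos hlt, if_pos (hzL i).2.2, max_eq_right hlt.le]
      rw [hprod, hc, ← ENNReal.ofReal_mul (by positivity)]
      apply ENNReal.ofReal_le_ofReal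
      rw [M.prod_outerPairs_union_innerPairs N, M.prod_outerPairs N,
        M.prod_unmatchedPairs_maxValue N]
      -- There are at most v² inner pairs, and each costs a factor of at least 1 - L².
      have hinner : (1 - L ^ 2) ^ (v ^ 2)
          ≤ ∏ p ∈ M.innerPairs N, (1 - M.maxValue N w z p.1 * M.maxValue N w z p.2) := by
        have hcard : (M.innerPairs N).card ≤ v ^ 2 := by
          refine (Finset.card_filter_le _ _).trans ?_
          rw [Finset.card_product, sq]
        calc (1 - L ^ 2) ^ (v ^ 2) ≤ (1 - L ^ 2) ^ (M.innerPairs N).card :=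
              pow_le_pow_of_le_one hL2 (by nlinarith [sq_nonneg L]) hcard
          _ = ∏ p ∈ M.innerPairs N, (1 - L ^ 2) := by rw [Finset.prod_const]
          _ ≤ _ := Finset.prod_le_prod (fun _ _ => hL2) fun p _ => by
              have : M.maxValue N w z p.1 * M.maxValue N w z p.2 ≤ L ^ 2 := by
                rw [sq]
                exact mul_le_mul (h1L _) (h1L _) (h0 _).le hL0
              linarith
      have hcross : Real.exp (-(6 * L ^ 2)) ^ v * ∏ i : {i // i ∈ M.changed N},
            Real.exp (-(max (z i).1 (z i).2 * ∑ j, w j))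
          ≤ ∏ i ∈ M.changed N, ∏ j ∈ (M.changed N)ᶜ,
            (1 - M.maxValue N w z i * M.maxValue N w z j) := by
        have e : Real.exp (-(6 * L ^ 2)) ^ v
            = ∏ _i : {i // i ∈ M.changed N}, Real.exp (-(6 * L ^ 2)) := by
          rw [Finset.prod_const]; simp [hv]
        rw [e, ← Finset.prod_mul_distrib,
          Finset.prod_subtype (p := fun i => i ∈ M.changed N) _ (fun _ => Iff.rfl)]
        exact Finset.prod_le_prod (fun i _ => by positivity) fun i _ =>
          M.le_prod_cross N hL hwL (hDQ w hwD) hzL' i.2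
      have hF0 : 0 ≤ K * Real.exp (-((∑ i, w i) ^ 2 / 2)) := by positivity
      have hX0 : 0 ≤ Real.exp (-(6 * L ^ 2)) ^ v * ∏ i : {i // i ∈ M.changed N},
            Real.exp (-(max (z i).1 (z i).2 * ∑ j, w j)) :=
        mul_nonneg (by positivity) (Finset.prod_nonneg fun _ _ => by positivity)
      calc _ = K * Real.exp (-((∑ i, w i) ^ 2 / 2)) * (Real.exp (-(6 * L ^ 2)) ^ v *
            ∏ i : {i // i ∈ M.changed N}, Real.exp (-(max (z i).1 (z i).2 * ∑ j, w j)))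
            * (1 - L ^ 2) ^ (v ^ 2) := by ring
        _ ≤ _ := mul_le_mul (mul_le_mul hF hcross hX0 (hF0.trans hF)) hinner (by positivity)
          (mul_nonneg (hF0.trans hF) (hX0.trans hcross))
    · have hzero : ∑ B ∈ M.orientations N,
            ∏ i : {i // i ∈ M.changed N}, lowerWeight L (∑ i, w i) B i (z i) = 0 := by
        refine Finset.sum_eq_zero fun B hB => ?_
        by_contra hne
        obtain ⟨rfl, h2⟩ := hnz B hB hne
        exact hgood ⟨hB, h2⟩
      rw [hzero, mul_zero]
      exact zero_le
  rw [M.prefMeasure_eq_lintegral N hE]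
  set C := K * (1 - L ^ 2) ^ (v ^ 2) * (Real.exp (-(6 * L ^ 2)) * (1 - η)) ^ v with hC
  have inner : ∀ w, (∀ i, 0 < w i) → w ∈ D →
      ENNReal.ofReal C * (M.orientations N).card *
        ENNReal.ofReal (chiWeight (2 * v) (∑ i, w i)) ≤
      ∫⁻ z : {i // i ∈ M.changed N} → ℝ × ℝ,
        Measure.pi (fun _ => unitLaw) {X : Fin n × Fin n → ℝ | M.assemble N w z X ∈ E}
        ∂(Measure.pi fun _ => unitLaw.prod unitLaw) := by
    intro w hw hwD
    have hS : 0 < ∑ i, w i := sum_pos_of_mem_positiveOrthant (mem_positiveOrthant.2 hw)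
    refine le_trans ?_ (lintegral_mono_ae
      ((ae_pi_unitLaw_prod_mem {i // i ∈ M.changed N}).mono fun z hz => point w z hw hwD hz))
    have hmeas : ∀ B, Measurable fun z : {i // i ∈ M.changed N} → ℝ × ℝ =>
        ∏ i : {i // i ∈ M.changed N}, lowerWeight L (∑ i, w i) B i (z i) := fun B =>
      Finset.measurable_fun_prod _ fun i _ =>
        (measurable_lowerWeight L (∑ i, w i) B (i : Fin n)).comp (measurable_pi_apply i)
    rw [lintegral_const_mul _ (Finset.measurable_fun_sum _ fun B _ => hmeas B),
      lintegral_finsetSum _ fun B _ => hmeas B]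
    have hB : ∀ B ∈ M.orientations N, ENNReal.ofReal (((1 - η) * ((∑ i, w i) ^ 2)⁻¹) ^ v) ≤
        ∫⁻ z : {i // i ∈ M.changed N} → ℝ × ℝ,
        ∏ i : {i // i ∈ M.changed N}, lowerWeight L (∑ i, w i) B i (z i) ∂(Measure.pi fun _ => unitLaw.prod unitLaw) := by
      intro B _
      rw [lintegral_fintype_prod _ (fun (i : {i // i ∈ M.changed N}) t =>
        lowerWeight L (∑ i, w i) B i t) (fun i => measurable_lowerWeight _ _ _ _)]
      have := hDη w hwD hw
      have h1 : 0 ≤ 1 - η := by linarith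
      refine le_trans ?_ (Finset.prod_le_prod' fun (i : {i // i ∈ M.changed N}) _ =>
        le_lintegral_lowerWeight hS hL0 hL1 B (i : Fin n))
      rw [Finset.prod_const, ← ENNReal.ofReal_pow]
      · simp only [Finset.card_univ, Fintype.card_coe, ← hv]
        apply ENNReal.ofReal_le_ofReal
        gcongr
      · exact mul_nonneg (by linarith) (by positivity)
    refine le_trans ?_ (mul_le_mul' le_rfl (Finset.sum_le_sum hB))
    rw [Finset.sum_const, nsmul_eq_mul, mul_comm _ (ENNReal.ofReal (_ ^ v)), ← mul_assoc, hc,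
      mul_right_comm, ← ENNReal.ofReal_mul (by
        have h1 : 0 ≤ 1 - η := by linarith
        positivity), ← ENNReal.ofReal_mul (by positivity)]
    refine mul_le_mul' (ENNReal.ofReal_le_ofReal (le_of_eq ?_)) le_rfl
    rw [hC, chiWeight, mul_pow, mul_pow, inv_pow, ← pow_mul]
    ring
  have hDbox : positiveOrthant {i // i ∉ M.changed N} ∩ D
      ⊆ Set.univ.pi fun _ => Set.Ioc (0 : ℝ) 1 := fun w hw i _ =>
    ⟨mem_positiveOrthant.1 hw.1 i, (hDL w hw.2 i).trans hL1⟩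
  rw [pi_unitLaw_eq]
  refine le_trans ?_ (lintegral_mono_set hDbox)
  rw [← lintegral_const_mul _ (by fun_prop)]
  refine lintegral_mono_ae ?_
  filter_upwards [ae_restrict_mem (measurableSet_positiveOrthant.inter hD)] with w hw
  exact inner w (mem_positiveOrthant.1 hw.1) hw.2

end PerfectMatching

/-! ### Smallness conditions and the resulting error terms. -/

/-- The pairs `(n, v)` in which `n` is large and `v` is small compared with `n`. -/
structure IsSparse (n v : ℕ) : Prop where
  le_log : 8 ≤ Real.log n
  log_le : 18 * Real.log n ≤ √n
  mul_log_le : 36 * v * Real.log n ≤ √n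
  mul_le : 8 * v ≤ n * (n : ℝ) ^ (-(1 / 3) : ℝ)
  log_pow_le : Real.log n ^ 3 ≤ 18 * (√n * (n : ℝ) ^ (-(1 / 3) : ℝ))
  error_le : 10 ^ 8 * (Real.log n ^ 4 * ((n : ℝ) ^ (-(1 / 3) : ℝ) + v ^ 2 / n)) ≤ 1

namespace IsSparse

variable {n v : ℕ} (h : IsSparse n v)
include h

theorem four_le : 4 ≤ n := by
  have h1 := h.le_log
  by_contra hn
  have h2 : (n : ℝ) ≤ 4 := by exact_mod_cast (not_le.1 hn).le
  have h3 := Real.log_le_self (Nat.cast_nonneg (α := ℝ) n)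
  linarith

theorem cast_pos : (0 : ℝ) < n := by
  have := h.four_le
  exact_mod_cast (by omega : 0 < n)

theorem mono {v' : ℕ} (hv : v' ≤ v) : IsSparse n v' := by
  have h0 := h.cast_pos
  have h1 := h.le_log
  have h2 : (v' : ℝ) ≤ v := by exact_mod_cast hv
  refine ⟨h.1, h.2, le_trans ?_ h.3, le_trans ?_ h.4, h.5, le_trans ?_ h.6⟩ <;> gcongr

theorem nine_sq_le : 9 * v ^ 2 ≤ n := by
  have h1 := h.le_log
  have h2 : 3 * (v : ℝ) ≤ √n := by
    refine le_trans ?_ h.mul_log_le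
    have : (0 : ℝ) ≤ v := Nat.cast_nonneg v
    nlinarith
  have h3 : (3 * (v : ℝ)) ^ 2 ≤ n := by
    rw [← Real.sq_sqrt h.cast_pos.le]
    exact pow_le_pow_left₀ (by positivity) h2 2
  have : ((9 * v ^ 2 : ℕ) : ℝ) ≤ n := by push_cast; linarith
  exact_mod_cast this

theorem three_mul_lt : 3 * v < n := by
  have := h.nine_sq_le
  have h4 := h.four_le
  rcases Nat.eq_zero_or_pos v with rfl | hv
  · omega
  · nlinarith

theorem inv_le : ((n : ℝ))⁻¹ ≤ (n : ℝ) ^ (-(1 / 3) : ℝ) := by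
  rw [← Real.rpow_neg_one]
  refine Real.rpow_le_rpow_of_exponent_le ?_ (by norm_num)
  have := h.four_le
  exact_mod_cast (by omega : 1 ≤ n)

theorem rpow_pos : 0 < (n : ℝ) ^ (-(1 / 3) : ℝ) := Real.rpow_pos_of_pos h.cast_pos _

theorem div_sqrt_sq : (Real.log n ^ 2 / √n) ^ 2 = Real.log n ^ 4 / n := by
  rw [div_pow, Real.sq_sqrt h.cast_pos.le]; ring

theorem mul_div_sqrt_le : v * (Real.log n ^ 2 / √n) ≤ Real.log n := by
  have h0 : 0 < √(n : ℝ) := Real.sqrt_pos.2 h.cast_pos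
  have h1 := h.le_log
  have h2 := h.mul_log_le
  rw [← mul_div_assoc, div_le_iff₀ h0]
  have : (v : ℝ) * Real.log n ≤ √n := by
    have : 0 ≤ (v : ℝ) * Real.log n := by positivity
    linarith
  nlinarith

theorem mul_div_sqrt_sq_le :
    v * (Real.log n ^ 2 / √n) ^ 2 ≤ (n : ℝ) ^ (-(1 / 3) : ℝ) / 2 := by
  have h0 : 0 < √(n : ℝ) := Real.sqrt_pos.2 h.cast_pos
  have h1 := h.le_log
  have h2 := h.mul_log_le
  have h3 := h.log_pow_le
  rw [h.div_sqrt_sq, ← mul_div_assoc, div_le_iff₀ h.cast_pos]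
  calc (v : ℝ) * Real.log n ^ 4 = (v * Real.log n) * Real.log n ^ 3 := by ring
    _ ≤ (√n / 36) * (18 * (√n * (n : ℝ) ^ (-(1 / 3) : ℝ))) :=
        mul_le_mul (by linarith) h3 (by positivity) (by positivity)
    _ = (n : ℝ) ^ (-(1 / 3) : ℝ) / 2 * (√n * √n) := by ring
    _ = _ := by rw [Real.mul_self_sqrt h.cast_pos.le]

/-- The relative error in the estimates below. -/
theorem error_bounds {τ : ℝ}
    (hτ : τ = Real.log n ^ 4 * ((n : ℝ) ^ (-(1 / 3) : ℝ) + v ^ 2 / n)) :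
    (n : ℝ) ^ (-(1 / 3) : ℝ) ≤ τ ∧ (Real.log n ^ 2 / √n) ^ 2 ≤ τ ∧ (v : ℝ) ^ 2 / n ≤ τ ∧
      v ^ 2 * (Real.log n ^ 2 / √n) ^ 2 ≤ τ ∧ v * (Real.log n ^ 2 / √n) ^ 2 ≤ τ ∧
      v * (n : ℝ)⁻¹ ≤ τ := by
  have h0 := h.cast_pos
  have h1 := h.le_log
  have hε := h.rpow_pos
  have hinv := h.inv_le
  have hl : 1 ≤ Real.log n ^ 4 := one_le_pow₀ (by linarith)
  have hvv : (v : ℝ) ≤ v ^ 2 := by exact_mod_cast Nat.le_self_pow two_ne_zero v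
  have hvn : (0 : ℝ) ≤ v ^ 2 / n := by positivity
  have hsum : (n : ℝ) ^ (-(1 / 3) : ℝ) + v ^ 2 / n ≤ τ := by
    rw [hτ]; exact le_mul_of_one_le_left (by positivity) hl
  have e1 : Real.log n ^ 4 * (v ^ 2 / n) ≤ τ := by
    rw [hτ]; gcongr; linarith
  have e2 : v ^ 2 * (Real.log n ^ 2 / √n) ^ 2 ≤ τ := by
    refine le_trans (le_of_eq ?_) e1
    rw [h.div_sqrt_sq]; ring
  have e3 : (v : ℝ) * (n : ℝ)⁻¹ ≤ v ^ 2 / n := by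
    rw [div_eq_mul_inv]; gcongr
  refine ⟨by linarith, ?_, by linarith, e2, le_trans ?_ e2, by linarith⟩
  · rw [h.div_sqrt_sq, hτ, div_eq_mul_inv]
    gcongr
    linarith
  · gcongr

end IsSparse

/-! ### Quasirandomness of all partner values against typicality of the unchanged ones. -/

theorem sum_compl_mem_Icc {ι : Type*} [Fintype ι] [DecidableEq ι] (s : Finset ι) {f : ι → ℝ}
    {b : ℝ} (h0 : ∀ i ∈ s, 0 ≤ f i) (hb : ∀ i ∈ s, f i ≤ b) :
    0 ≤ ∑ i, f i - ∑ i ∈ sᶜ, f i ∧ ∑ i, f i - ∑ i ∈ sᶜ, f i ≤ s.card * b := by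
  have e : ∑ i, f i - ∑ i ∈ sᶜ, f i = ∑ i ∈ s, f i := by
    rw [← Finset.sum_add_sum_compl s]; ring
  rw [e]
  exact ⟨Finset.sum_nonneg h0, by simpa using Finset.sum_le_card_nsmul s f b hb⟩

namespace PerfectMatching

variable {n : ℕ} (M N : PerfectMatching n)

instance isProbabilityMeasure_prefMeasure : IsProbabilityMeasure (prefMeasure n) :=
  measurePreserving_curry_unitLaw.map_eq ▸
    Measure.isProbabilityMeasure_map measurePreserving_curry_unitLaw.measurable.aemeasurable

/-- The vectors of partner values that satisfy the conditions of quasirandomness. -/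
def quasirandomValues : Set (Fin n → ℝ) :=
  {x | |∑ i, x i - √n| ≤ 10 * Real.log n ∧ (∀ i, x i ≤ Real.log n ^ 2 / √n) ∧
    |∑ i with i < M.partner i, x i * x (M.partner i) - 1 / 2| ≤ (n : ℝ) ^ (-(1 / 3) : ℝ) ∧
    |∑ i, x i ^ 2 - 2| ≤ (n : ℝ) ^ (-(1 / 3) : ℝ)}

theorem quasirandom_eq : M.quasirandom = {X | M.partnerValues X ∈ M.quasirandomValues} := by
  ext X
  simp [quasirandom, quasirandomValues, partnerValues, M.partner_partner]

theorem measurableSet_quasirandomValues : MeasurableSet M.quasirandomValues := by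
  have : M.quasirandomValues = {x | |∑ i, x i - √n| ≤ 10 * Real.log n} ∩
      ((⋂ i, {x | x i ≤ Real.log n ^ 2 / √n}) ∩
        ({x | |∑ i with i < M.partner i, x i * x (M.partner i) - 1 / 2|
          ≤ (n : ℝ) ^ (-(1 / 3) : ℝ)} ∩
        {x | |∑ i, x i ^ 2 - 2| ≤ (n : ℝ) ^ (-(1 / 3) : ℝ)})) := by
    ext x; simp [quasirandomValues]
  rw [this]
  exact (measurableSet_le (by fun_prop) (by fun_prop)).inter
    ((MeasurableSet.iInter fun i => measurableSet_le (by fun_prop) (by fun_prop)).inter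
      ((measurableSet_le (by fun_prop) (by fun_prop)).inter
        (measurableSet_le (by fun_prop) (by fun_prop))))

theorem measurableSet_quasirandom : MeasurableSet M.quasirandom := by
  rw [quasirandom_eq]
  have : Measurable (M.partnerValues) := by unfold partnerValues; fun_prop
  exact this M.measurableSet_quasirandomValues

theorem measurableSet_stable : MeasurableSet M.stable := by
  have : M.stable = ⋂ i, ⋂ j, ⋂ (_ : i ≠ j), ⋂ (_ : M.partner i ≠ j),
      ({X | X i (M.partner i) < X i j} ∪ {X | X j (M.partner j) < X j i}) := by
    ext X; simp [stable]
  rw [this]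
  exact MeasurableSet.iInter fun i => MeasurableSet.iInter fun j => MeasurableSet.iInter fun _ =>
    MeasurableSet.iInter fun _ => (measurableSet_lt (by fun_prop) (by fun_prop)).union
      (measurableSet_lt (by fun_prop) (by fun_prop))

/-- The matching `M` on the unchanged people. -/
def restrictUnchanged (i : {i // i ∉ M.changed N}) : {i // i ∉ M.changed N} :=
  ⟨M.partner i, M.partner_notMem_changed N i.2⟩

theorem card_unchanged :
    Fintype.card {i // i ∉ M.changed N} + (M.changed N).card = n := by
  have := Fintype.card_subtype_compl (fun i => i ∈ M.changed N)
  rw [this, Fintype.card_fin, Fintype.card_coe]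
  have := (M.changed N).card_le_univ
  simp at this
  omega

/-- The matching `M` pairs the changed people among themselves. The parity is what gives the masses
their factorial form. -/
theorem even_card_changed : Even (M.changed N).card := by
  have := sum_matched_add (s := M.changed N) (fun i hi => M.partner_mem_changed N hi)
    M.partner_partner M.partner_ne fun _ => (1 : ℝ)
  simp only [Finset.sum_const, nsmul_eq_mul, mul_one] at this
  refine ⟨((M.changed N).filter fun i => i < M.partner i).card, ?_⟩
  have h : (((M.changed N).card : ℕ) : ℝ) = _ := this.symm
  have h2 : (((M.changed N).card : ℕ) : ℝ)
      = ((2 * ((M.changed N).filter fun i => i < M.partner i).card : ℕ) : ℝ) := by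
    rw [h]; push_cast; ring
  have := Nat.cast_injective h2
  omega

theorem sum_matched_oldValue (w : {i // i ∉ M.changed N} → ℝ)
    (z : {i // i ∈ M.changed N} → ℝ × ℝ) :
    ∑ i ∈ (M.changed N)ᶜ with i < M.partner i,
        M.oldValue N w z i * M.oldValue N w z (M.partner i)
      = ∑ i with i < M.restrictUnchanged N i, w i * w (M.restrictUnchanged N i) := by
  rw [Finset.sum_filter, Finset.sum_filter,
    Finset.sum_subtype (p := fun i => i ∉ M.changed N) _ (by simp)]
  refine Finset.sum_congr rfl fun i _ => ?_
  rw [M.oldValue_of_notMem N w z i.2,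
    M.oldValue_of_notMem N w z (M.partner_notMem_changed N i.2)]
  rfl

section Deterministic

variable {M N} {w : {i // i ∉ M.changed N} → ℝ} {z : {i // i ∈ M.changed N} → ℝ × ℝ}

theorem oldValue_nonneg (hw : ∀ i, 0 < w i) (hz : ∀ i, 0 < (z i).1) (i : Fin n) :
    0 ≤ M.oldValue N w z i := by
  unfold oldValue
  split_ifs
  · exact (hz _).le
  · exact (hw _).le

theorem sum_matched_mem_Icc {L : ℝ} (h0 : ∀ i, 0 ≤ M.oldValue N w z i)
    (hL : ∀ i ∈ M.changed N, M.oldValue N w z i ≤ L) :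
    let P := ∑ i with i < M.partner i, M.oldValue N w z i * M.oldValue N w z (M.partner i)
    let P' := ∑ i ∈ (M.changed N)ᶜ with i < M.partner i,
      M.oldValue N w z i * M.oldValue N w z (M.partner i)
    0 ≤ P - P' ∧ P - P' ≤ (M.changed N).card * L ^ 2 := by
  intro P P'
  have hP : P = _ := Finset.sum_filter _ _
  have hP' : P' = _ := Finset.sum_filter _ _
  rw [hP, hP']
  refine sum_compl_mem_Icc (M.changed N) (fun i _ => ?_) fun i hi => ?_
  · split_ifs
    · exact mul_nonneg (h0 _) (h0 _)
    · exact le_rfl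
  · split_ifs
    · rw [sq]
      exact mul_le_mul (hL i hi) (hL _ (M.partner_mem_changed N hi)) (h0 _)
        ((h0 i).trans (hL i hi))
    · exact sq_nonneg L

theorem sum_sq_mem_Icc {L : ℝ} (h0 : ∀ i, 0 ≤ M.oldValue N w z i)
    (hL : ∀ i ∈ M.changed N, M.oldValue N w z i ≤ L) :
    0 ≤ ∑ i, M.oldValue N w z i ^ 2 - ∑ i ∈ (M.changed N)ᶜ, M.oldValue N w z i ^ 2 ∧
    ∑ i, M.oldValue N w z i ^ 2 - ∑ i ∈ (M.changed N)ᶜ, M.oldValue N w z i ^ 2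
      ≤ (M.changed N).card * L ^ 2 :=
  sum_compl_mem_Icc (M.changed N) (fun _ _ => sq_nonneg _)
    fun i hi => pow_le_pow_left₀ (h0 i) (hL i hi) 2

/-- Removing the changed people alters the quadratic sums by at most vL² ≤ n^{-1/3}/2, where L =
log² n / √n; this is why the tolerance grows to 3/2 · n^{-1/3}. -/
theorem prod_unmatchedPairs_le_of_mem_quasirandomValues
    (h : IsSparse n (M.changed N).card) (hw : ∀ i, 0 < w i) (hz : ∀ i, 0 < (z i).1)
    (hA : M.oldValue N w z ∈ M.quasirandomValues) :
    ∏ p ∈ unmatchedPairs (M.changed N)ᶜ M.partner,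
        (1 - M.oldValue N w z p.1 * M.oldValue N w z p.2)
      ≤ Real.exp (1 / 2 + 3 * (n : ℝ) ^ (-(1 / 3) : ℝ) + 2 * (Real.log n ^ 2 / √n) ^ 2)
        * Real.exp (-((∑ i, w i) ^ 2 / 2)) := by
  obtain ⟨-, hA2, hA3, hA4⟩ := hA
  have h0 := oldValue_nonneg hw hz
  obtain ⟨p1, p2⟩ := sum_matched_mem_Icc h0 fun i _ => hA2 i
  obtain ⟨q1, q2⟩ := sum_sq_mem_Icc h0 fun i _ => hA2 i
  have hv := h.mul_div_sqrt_sq_le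
  obtain ⟨e1, e2, -⟩ := h.error_bounds rfl
  have e3 := h.error_le
  have hL : Real.log n ^ 2 / √n ≤ 1 := by
    refine (sq_le_one_iff₀ (by positivity)).1 ?_
    linarith
  rw [abs_le] at hA3 hA4
  have := prod_unmatchedPairs_le_typical (s := (M.changed N)ᶜ) (σ := M.partner)
    (x := M.oldValue N w z) (fun i hi => Finset.mem_compl.2
      (M.partner_notMem_changed N (Finset.mem_compl.1 hi))) M.partner_partner M.partner_ne
    (L := Real.log n ^ 2 / √n) (δ := 3 / 2 * (n : ℝ) ^ (-(1 / 3) : ℝ)) hL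
    (by linarith) (fun i _ => h0 i) (fun i _ => hA2 i)
    (abs_le.2 ⟨by linarith, by linarith⟩) (abs_le.2 ⟨by linarith, by linarith⟩)
  rw [M.sum_oldValue N w z (fun t => t)] at this
  convert this using 3
  ring

/-- The slack in `typicalSet` is made for this: the changed people add at most vL ≤ log n to the
sum, raising 9 log n to 10 log n, and at most vL² ≤ n^{-1/3}/2 to the quadratic sums. -/
theorem mem_quasirandomValues_of_mem_typicalSet
    (h : IsSparse n (M.changed N).card) (hw : ∀ i, 0 < w i)
    (hwD : w ∈ typicalSet n (M.restrictUnchanged N))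
    (hz : ∀ i, 0 < (z i).1 ∧ (z i).1 ≤ Real.log n ^ 2 / √n) :
    M.oldValue N w z ∈ M.quasirandomValues ∧
      Real.exp (1 / 2 - (n : ℝ) ^ (-(1 / 3) : ℝ) - 9 * (Real.log n ^ 2 / √n) ^ 2)
        * Real.exp (-((∑ i, w i) ^ 2 / 2)) ≤
      ∏ p ∈ unmatchedPairs (M.changed N)ᶜ M.partner,
        (1 - M.oldValue N w z p.1 * M.oldValue N w z p.2) := by
  obtain ⟨hD1, hD2, hD3, hD4⟩ := hwD
  have h0 := oldValue_nonneg hw fun i => (hz i).1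
  have hL : ∀ i, M.oldValue N w z i ≤ Real.log n ^ 2 / √n := by
    intro i
    unfold oldValue
    split_ifs
    · exact (hz _).2
    · exact hD2 _
  obtain ⟨p1, p2⟩ := sum_matched_mem_Icc h0 fun i _ => hL i
  obtain ⟨q1, q2⟩ := sum_sq_mem_Icc h0 fun i _ => hL i
  obtain ⟨s1, s2⟩ := sum_compl_mem_Icc (M.changed N) (fun i _ => h0 i) fun i _ => hL i
  have hv1 := h.mul_div_sqrt_le
  have hv := h.mul_div_sqrt_sq_le
  have hε := h.rpow_pos
  obtain ⟨e1, e2, -⟩ := h.error_bounds rfl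
  have e3 := h.error_le
  rw [← M.sum_oldValue N w z (fun t => t)] at hD1 ⊢
  rw [← M.sum_oldValue N w z (fun t => t ^ 2)] at hD4
  rw [← M.sum_matched_oldValue N w z] at hD3
  constructor
  · rw [abs_le] at hD1 hD3 hD4
    exact ⟨abs_le.2 ⟨by linarith, by linarith⟩, hL, abs_le.2 ⟨by linarith, by linarith⟩,
      abs_le.2 ⟨by linarith, by linarith⟩⟩
  · have := le_prod_unmatchedPairs (s := (M.changed N)ᶜ) (σ := M.partner)
      (x := M.oldValue N w z) (fun i hi => Finset.mem_compl.2
      (M.partner_notMem_changed N (Finset.mem_compl.1 hi)))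
      (L := Real.log n ^ 2 / √n) (δ := (n : ℝ) ^ (-(1 / 3) : ℝ) / 2) (by linarith)
      (by linarith) (fun i _ => h0 i) (fun i _ => hL i) hD4 hD3
    convert this using 3
    ring

end Deterministic

end PerfectMatching

/-! ### Joint probability of stability and quasirandomness. -/

namespace PerfectMatching

variable {n : ℕ} {M N : PerfectMatching n}

theorem nonempty_unchanged (h : IsSparse n (M.changed N).card) :
    Nonempty {i // i ∉ M.changed N} := by
  rw [← Fintype.card_pos_iff]
  have h1 := M.card_unchanged N
  have h2 := h.three_mul_lt
  omega

theorem two_mul_card_changed_lt (h : IsSparse n (M.changed N).card) :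
    2 * (M.changed N).card < Fintype.card {i // i ∉ M.changed N} := by
  have h1 := M.card_unchanged N
  have h2 := h.three_mul_lt
  omega

theorem lintegral_compl_typicalSet_le (h : IsSparse n (M.changed N).card) :
    ∫⁻ w in positiveOrthant {i // i ∉ M.changed N} ∩ (typicalSet n (M.restrictUnchanged N))ᶜ,
        ENNReal.ofReal (chiWeight (2 * (M.changed N).card) (∑ i, w i))
      ≤ ENNReal.ofReal (130000 * (n : ℝ) ^ (-(1 / 3) : ℝ)
          * orthantMass (Fintype.card {i // i ∉ M.changed N}) (2 * (M.changed N).card)) := by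
  have := nonempty_unchanged h
  exact setLIntegral_chiWeight_compl_typicalSet (σ := M.restrictUnchanged N)
    (fun i => Subtype.ext (M.partner_partner i))
    (fun i hi => M.partner_ne i (congrArg Subtype.val hi)) h.four_le (M.card_unchanged N)
    (by linarith [h.le_log]) h.mul_log_le h.log_le h.mul_le

theorem le_lintegral_typicalSet (h : IsSparse n (M.changed N).card) :
    ENNReal.ofReal ((1 - 130000 * (n : ℝ) ^ (-(1 / 3) : ℝ))
        * orthantMass (Fintype.card {i // i ∉ M.changed N}) (2 * (M.changed N).card)) ≤
    ∫⁻ w in positiveOrthant {i // i ∉ M.changed N} ∩ typicalSet n (M.restrictUnchanged N),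
        ENNReal.ofReal (chiWeight (2 * (M.changed N).card) (∑ i, w i)) := by
  have := nonempty_unchanged h
  have hbad := lintegral_compl_typicalSet_le h
  have hall := lintegral_chiWeight (ι := {i // i ∉ M.changed N}) (two_mul_card_changed_lt h)
  rw [← lintegral_inter_add_sdiff _ _
    (measurableSet_typicalSet n (M.restrictUnchanged N)), Set.sdiff_eq] at hall
  rw [sub_mul, one_mul, ENNReal.ofReal_sub, ← hall, tsub_le_iff_right]
  · gcongr
  · have := (orthantMass_pos (two_mul_card_changed_lt h)).le
    have := h.rpow_pos
    positivity

theorem real_inter_quasirandom_le (h : IsSparse n (M.changed N).card)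
    {J : Set (Fin n → Fin n → ℝ)} (hJ : MeasurableSet J)
    (hsub : J ⊆ M.switchEvent N (M.outerPairs N)) :
    (prefMeasure n).real (J ∩ M.quasirandom) ≤
      Real.exp (1 / 2 + 3 * (n : ℝ) ^ (-(1 / 3) : ℝ) + 2 * (Real.log n ^ 2 / √n) ^ 2) *
        (M.orientations N).card *
        orthantMass (Fintype.card {i // i ∉ M.changed N}) (2 * (M.changed N).card) := by
  have := nonempty_unchanged h
  have hpos := (orthantMass_pos (two_mul_card_changed_lt h)).le
  refine ENNReal.toReal_le_of_le_ofReal (by positivity) ?_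
  have := M.prefMeasure_le_of_subset_switchEvent N (hJ.inter M.measurableSet_quasirandom)
    (A := M.quasirandomValues) (D := Set.univ)
    (K := Real.exp (1 / 2 + 3 * (n : ℝ) ^ (-(1 / 3) : ℝ) + 2 * (Real.log n ^ 2 / √n) ^ 2))
    (by rw [M.quasirandom_eq]; exact Set.inter_subset_inter_left _ hsub) MeasurableSet.univ
    (Real.exp_pos _).le fun w z hw hz hA => ⟨trivial,
      prod_unmatchedPairs_le_of_mem_quasirandomValues h (fun i => (hw i).1)
        (fun i => (hz i).1.1) hA⟩
  rw [Set.inter_univ, lintegral_chiWeight (two_mul_card_changed_lt h)] at this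
  rw [ENNReal.ofReal_mul (by positivity), ENNReal.ofReal_mul (Real.exp_pos _).le,
    ENNReal.ofReal_natCast]
  exact this

/-- Used for the truncation at L = log² n / √n with u = LS: typical S is at least √n/2, so u ≥ log²
n / 2 and the loss is at most e^{-log n} = 1/n. -/
theorem one_add_mul_exp_neg_le {l u : ℝ} (hl : 8 ≤ l) (hu : l ^ 2 / 2 ≤ u) :
    (1 + u) * Real.exp (-u) ≤ Real.exp (-l) := by
  have h1 : 1 + u ≤ 2 * Real.exp (u / 2) := by
    have := Real.add_one_le_exp (u / 2)
    linarith
  have h2 : (2 : ℝ) ≤ Real.exp 1 := by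
    have := Real.add_one_le_exp (1 : ℝ)
    linarith
  calc (1 + u) * Real.exp (-u) ≤ 2 * Real.exp (u / 2) * Real.exp (-u) := by gcongr
    _ ≤ Real.exp 1 * Real.exp (u / 2) * Real.exp (-u) := by gcongr
    _ = Real.exp (1 - u / 2) := by rw [← Real.exp_add, ← Real.exp_add]; congr 1; ring
    _ ≤ _ := Real.exp_le_exp.2 (by nlinarith)

theorem le_real_inter_quasirandom (h : IsSparse n (M.changed N).card)
    {J : Set (Fin n → Fin n → ℝ)} (hJ : MeasurableSet J)
    (hsub : M.switchEvent N (M.outerPairs N ∪ M.innerPairs N) ⊆ J) :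
    Real.exp (1 / 2 - (n : ℝ) ^ (-(1 / 3) : ℝ) - 9 * (Real.log n ^ 2 / √n) ^ 2) *
        (1 - (Real.log n ^ 2 / √n) ^ 2) ^ ((M.changed N).card ^ 2) *
        (Real.exp (-(6 * (Real.log n ^ 2 / √n) ^ 2)) * (1 - (n : ℝ)⁻¹)) ^ (M.changed N).card *
        (M.orientations N).card *
        ((1 - 130000 * (n : ℝ) ^ (-(1 / 3) : ℝ)) *
          orthantMass (Fintype.card {i // i ∉ M.changed N}) (2 * (M.changed N).card))
      ≤ (prefMeasure n).real (J ∩ M.quasirandom) := by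
  have := nonempty_unchanged h
  have hpos := (orthantMass_pos (two_mul_card_changed_lt h)).le
  have h0 := h.cast_pos
  have hlog := h.le_log
  have hsqrt := h.log_le
  have hr : 0 < √(n : ℝ) := Real.sqrt_pos.2 h0
  obtain ⟨e1, e2, -⟩ := h.error_bounds rfl
  have e3 := h.error_le
  have hε := h.rpow_pos
  have hinv := h.inv_le
  have key := M.le_prefMeasure_of_switchEvent_subset N
    (hJ.inter M.measurableSet_quasirandom) (A := M.quasirandomValues)
    (D := typicalSet n (M.restrictUnchanged N))
    (K := Real.exp (1 / 2 - (n : ℝ) ^ (-(1 / 3) : ℝ) - 9 * (Real.log n ^ 2 / √n) ^ 2))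
    (L := Real.log n ^ 2 / √n) (η := (n : ℝ)⁻¹)
    (by rw [M.quasirandom_eq]; exact Set.inter_subset_inter_left _ hsub)
    (measurableSet_typicalSet _ _) (Real.exp_pos _).le (by positivity) (by linarith)
    (by linarith)
    (fun w z hw hwD hz => mem_quasirandomValues_of_mem_typicalSet h hw hwD fun i => (hz i).1)
    (fun w hw => hw.2.1) (fun w hw => by
      have := (abs_le.1 hw.2.2.2).2
      linarith) fun w hw hw0 => by
      have hS := (abs_le.1 hw.1).1
      refine (one_add_mul_exp_neg_le hlog ?_).trans (le_of_eq ?_)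
      · rw [div_mul_eq_mul_div, div_le_div_iff₀ two_pos hr, mul_assoc]
        gcongr
        linarith
      · rw [Real.exp_neg, Real.exp_log h0]
  have hC : 0 ≤ Real.exp (1 / 2 - (n : ℝ) ^ (-(1 / 3) : ℝ) - 9 * (Real.log n ^ 2 / √n) ^ 2) *
        (1 - (Real.log n ^ 2 / √n) ^ 2) ^ ((M.changed N).card ^ 2) *
        (Real.exp (-(6 * (Real.log n ^ 2 / √n) ^ 2)) * (1 - (n : ℝ)⁻¹)) ^ (M.changed N).card := by
    have h1 : 0 ≤ 1 - (Real.log n ^ 2 / √n) ^ 2 := by linarith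
    have h2 : 0 ≤ 1 - (n : ℝ)⁻¹ := by linarith
    positivity
  rw [Measure.real, ← ENNReal.ofReal_le_iff_le_toReal (measure_ne_top _ _),
    ENNReal.ofReal_mul (by positivity), ENNReal.ofReal_mul hC, ENNReal.ofReal_natCast]
  exact (mul_le_mul' le_rfl (le_lintegral_typicalSet h)).trans key

/-- For N = M nobody is changed and the outer pairs are all unmatched pairs, so the bounds for
switching events also yield the normalising probability that `M` is stable. -/
theorem stable_subset_switchEvent : M.stable ⊆ M.switchEvent M (M.outerPairs M) := by
  intro X hX
  have hV : ∀ i, i ∉ M.changed M := fun i hi => (M.mem_changed M).1 hi rfl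
  refine ⟨fun i hi => absurd hi (hV i), fun i hi => absurd hi (hV i), fun p hp => ?_⟩
  obtain ⟨h1, h2, -⟩ := M.outerPairs_ne M hp
  simpa using hX p.1 p.2 h1 (Ne.symm h2)

/-- With nobody changed, failure of quasirandomness forces the values out of `typicalSet`; there the
crude product bound is enough, since that region carries only an O(n^{-1/3}) share of the mass. -/
theorem real_stable_inter_compl_quasirandom_le (h : IsSparse n 0) :
    (prefMeasure n).real (M.stable ∩ M.quasirandomᶜ) ≤
      Real.exp (9 / 4) * (130000 * (n : ℝ) ^ (-(1 / 3) : ℝ) * orthantMass n 0) := by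
  have hV : M.changed M = ∅ := by simp [changed]
  have hc : (M.changed M).card = 0 := by rw [hV, Finset.card_empty]
  have h' : IsSparse n (M.changed M).card := by rwa [hc]
  have hW : Fintype.card {i // i ∉ M.changed M} = n := by
    have := M.card_unchanged M
    omega
  have hO : (M.orientations M).card = 1 := by simp [orientations, hV]
  have := nonempty_unchanged h'
  have hpos : 0 < orthantMass n 0 := orthantMass_pos (by linarith [h.four_le])
  have hε := h.rpow_pos
  refine ENNReal.toReal_le_of_le_ofReal (by positivity) ?_
  have key := M.prefMeasure_le_of_subset_switchEvent M
    (M.measurableSet_stable.inter M.measurableSet_quasirandom.compl)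
    (A := M.quasirandomValuesᶜ) (D := (typicalSet n (M.restrictUnchanged M))ᶜ)
    (K := Real.exp (9 / 4))
    (by rw [M.quasirandom_eq]; exact Set.inter_subset_inter_left _ stable_subset_switchEvent)
    (measurableSet_typicalSet _ _).compl (Real.exp_pos _).le fun w z hw hz hA => by
      refine ⟨fun hD => hA (mem_quasirandomValues_of_mem_typicalSet h' (fun i => (hw i).1) hD
        fun i => absurd i.2 (by simp [hV])).1, ?_⟩
      have := prod_unmatchedPairs_le_crude (s := (M.changed M)ᶜ) (σ := M.partner)
        (x := M.oldValue M w z) (fun i hi => Finset.mem_compl.2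
          (M.partner_notMem_changed M (Finset.mem_compl.1 hi))) M.partner_partner M.partner_ne
        (fun i _ => oldValue_nonneg (fun i => (hw i).1) (fun i => (hz i).1.1) i)
        (fun i _ => by
          unfold oldValue
          split_ifs
          · exact (hz _).1.2
          · exact (hw _).2)
      rwa [M.sum_oldValue M w z (fun t => t)] at this
  rw [ENNReal.ofReal_mul (Real.exp_pos _).le]
  refine key.trans ?_
  rw [hO, Nat.cast_one, mul_one]
  have hb := lintegral_compl_typicalSet_le h'
  rw [hW] at hb
  rw [hc] at hb ⊢
  exact mul_le_mul' le_rfl hb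

end PerfectMatching

/-! ### The conditional probability of a switch. -/

namespace PerfectMatching

variable {n : ℕ} (M N : PerfectMatching n)

/-- The approximate conditional probability that `N` is stable as well. -/
noncomputable def switchRate : ℝ := (M.orientations N).card / √n ^ (M.changed N).card

theorem switchRate_nonneg : 0 ≤ M.switchRate N := by
  unfold switchRate; positivity

variable {M N}

theorem mul_orthantMass_bounds (hn : Even n) (h : IsSparse n (M.changed N).card) :
    (1 - ((M.changed N).card : ℝ) ^ 2 / n) * orthantMass n 0 ≤ √n ^ (M.changed N).card *
        orthantMass (Fintype.card {i // i ∉ M.changed N}) (2 * (M.changed N).card) ∧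
      √n ^ (M.changed N).card *
        orthantMass (Fintype.card {i // i ∉ M.changed N}) (2 * (M.changed N).card) ≤
      (1 + 9 * (((M.changed N).card : ℝ) ^ 2 / n)) * orthantMass n 0 := by
  obtain ⟨k, hk⟩ := hn
  obtain ⟨m, hm⟩ := M.even_card_changed N
  have h9 := h.nine_sq_le
  have h4 := h.four_le
  have hW := M.card_unchanged N
  have hcard : Fintype.card {i // i ∉ M.changed N} = 2 * k - 2 * m := by omega
  have key := orthantMass_ratio (h := k) (m := m) (by rw [hm] at h9; nlinarith) (by omega)
  have hsq : √(n : ℝ) ^ (m + m) = (n : ℝ) ^ m := by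
    rw [pow_add, ← mul_pow, Real.mul_self_sqrt h.cast_pos.le]
  rw [hcard, hm, hsq, ← two_mul m]
  rw [show 2 * k = n by omega] at key ⊢
  push_cast
  refine ⟨le_trans (le_of_eq ?_) key.1, key.2.trans (le_of_eq ?_)⟩ <;> ring

theorem one_sub_add_le_mul {a b x y : ℝ} (ha : 1 - x ≤ a) (hb : 1 - y ≤ b) (hx : 0 ≤ x)
    (hy : 0 ≤ y) (hy1 : y ≤ 1) (ha0 : 0 ≤ a) : 1 - (x + y) ≤ a * b := by
  have h1 : a * (1 - y) ≤ a * b := mul_le_mul_of_nonneg_left hb ha0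
  have h2 : (1 - x) * (1 - y) ≤ a * (1 - y) := mul_le_mul_of_nonneg_right ha (by linarith)
  nlinarith [mul_nonneg hx hy]

-- In the lower bound the relative errors add up as 10 + 1 + 7 + 130000 + 1 = 130019: the
-- exponential, inner pairs, cross pairs with truncation, atypical vectors, and the ratio of masses.
-- The upper bound needs only 20.
set_option maxHeartbeats 800000 in
theorem abs_real_inter_quasirandom_sub_le (hn : Even n) (h : IsSparse n (M.changed N).card)
    {τ : ℝ}
    (hτ : τ = Real.log n ^ 4 * ((n : ℝ) ^ (-(1 / 3) : ℝ) + ((M.changed N).card : ℝ) ^ 2 / n))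
    {J : Set (Fin n → Fin n → ℝ)} (hJ : MeasurableSet J)
    (hlow : M.switchEvent N (M.outerPairs N ∪ M.innerPairs N) ⊆ J)
    (hup : J ⊆ M.switchEvent N (M.outerPairs N)) :
    |(prefMeasure n).real (J ∩ M.quasirandom)
        - M.switchRate N * (Real.exp (1 / 2) * orthantMass n 0)|
      ≤ 130019 * τ * (M.switchRate N * (Real.exp (1 / 2) * orthantMass n 0)) := by
  obtain ⟨b1, b2, b3, b4, b5, b6⟩ := h.error_bounds hτ
  have hsmall : 10 ^ 8 * τ ≤ 1 := by rw [hτ]; exact h.error_le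
  obtain ⟨r1, r2⟩ := mul_orthantMass_bounds hn h
  have hup' := real_inter_quasirandom_le h hJ hup
  have hlow' := le_real_inter_quasirandom h hJ hlow
  have hε := h.rpow_pos
  have hinv := h.inv_le
  have h0 := h.cast_pos
  have hrate : (M.orientations N).card = M.switchRate N * √n ^ (M.changed N).card := by
    rw [switchRate, div_mul_cancel₀]
    have := Real.sqrt_pos.2 h0
    positivity
  rw [hrate] at hup' hlow'
  have ha := M.switchRate_nonneg N
  have hR : 0 < orthantMass n 0 := orthantMass_pos (by linarith [h.four_le])
  have hL2 : 0 ≤ (Real.log n ^ 2 / √n) ^ 2 := by positivity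
  set L2 := (Real.log n ^ 2 / √n) ^ 2 with hL2def
  set ε := (n : ℝ) ^ (-(1 / 3) : ℝ) with hεdef
  set v := (M.changed N).card with hv
  set Z := √n ^ v * orthantMass (Fintype.card {i // i ∉ M.changed N}) (2 * v) with hZ
  set R := orthantMass n 0 with hRdef
  set a := M.switchRate N with hadef
  have hvn : (0 : ℝ) ≤ (v : ℝ) ^ 2 / n := by positivity
  have he := Real.exp_pos (1 / 2)
  have hθ : 0 ≤ a * (Real.exp (1 / 2) * R) := by positivity
  rw [abs_le]
  constructor
  · have g1 : 1 - 10 * τ ≤ Real.exp (-ε - 9 * L2) := by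
      have := Real.add_one_le_exp (-ε - 9 * L2)
      linarith
    have g2 : 1 - τ ≤ (1 - L2) ^ (v ^ 2) := by
      have := one_add_mul_le_pow (a := -L2) (by linarith) (v ^ 2)
      push_cast at this
      rw [← sub_eq_add_neg] at this
      linarith
    have g3 : 1 - 7 * τ ≤ (Real.exp (-(6 * L2)) * (1 - (n : ℝ)⁻¹)) ^ v := by
      have hinv0 : 0 ≤ (n : ℝ)⁻¹ := by positivity
      have e1 : 1 - (6 * L2 + (n : ℝ)⁻¹) ≤ Real.exp (-(6 * L2)) * (1 - (n : ℝ)⁻¹) := by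
        have := Real.add_one_le_exp (-(6 * L2))
        exact one_sub_add_le_mul (by linarith) le_rfl (by linarith) hinv0 (by linarith)
          (Real.exp_pos _).le
      have e2 := one_add_mul_le_pow (a := -(6 * L2 + (n : ℝ)⁻¹)) (by linarith) v
      have e3 : (1 + -(6 * L2 + (n : ℝ)⁻¹)) ^ v
          ≤ (Real.exp (-(6 * L2)) * (1 - (n : ℝ)⁻¹)) ^ v :=
        pow_le_pow_left₀ (by linarith) (by linarith) v
      nlinarith
    have g4 : 1 - 130000 * τ ≤ 1 - 130000 * ε := by linarith
    have g5 : (1 - τ) * R ≤ Z := le_trans (by gcongr) r1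
    have p2 := one_sub_add_le_mul g1 g2 (by linarith) (by linarith) (by linarith)
      (Real.exp_pos _).le
    have p3 := one_sub_add_le_mul p2 g3 (by linarith) (by linarith) (by linarith) (by linarith)
    have p4 := one_sub_add_le_mul p3 g4 (by linarith) (by linarith) (by linarith) (by linarith)
    have hsplit : Real.exp (1 / 2 - ε - 9 * L2) = Real.exp (1 / 2) * Real.exp (-ε - 9 * L2) := by
      rw [← Real.exp_add]; congr 1; ring
    rw [hsplit] at hlow'
    have hQ0 : 0 ≤ Real.exp (-ε - 9 * L2) * (1 - L2) ^ v ^ 2 *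
        (Real.exp (-(6 * L2)) * (1 - (n : ℝ)⁻¹)) ^ v * (1 - 130000 * ε) := by linarith
    generalize hQ : Real.exp (-ε - 9 * L2) * (1 - L2) ^ v ^ 2 *
        (Real.exp (-(6 * L2)) * (1 - (n : ℝ)⁻¹)) ^ v * (1 - 130000 * ε) = Q at p4 hQ0
    have p5 := one_sub_add_le_mul p4 (le_refl (1 - τ)) (by linarith) (by linarith)
      (by linarith) hQ0
    have c1 : (1 - 130019 * τ) * R ≤ Q * Z := by
      refine le_trans (mul_le_mul_of_nonneg_right (le_trans (by linarith) p5) hR.le) ?_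
      rw [mul_assoc]
      exact mul_le_mul_of_nonneg_left g5 hQ0
    have e4 : a * Real.exp (1 / 2) * (Q * Z) ≤ (prefMeasure n).real (J ∩ M.quasirandom) := by
      refine le_trans (le_of_eq ?_) hlow'
      rw [hZ, ← hQ]; ring
    have c3 := (mul_le_mul_of_nonneg_left c1 (mul_nonneg ha he.le)).trans e4
    have e5 : a * Real.exp (1 / 2) * ((1 - 130019 * τ) * R)
        = a * (Real.exp (1 / 2) * R) - 130019 * τ * (a * (Real.exp (1 / 2) * R)) := by ring
    linarith
  · have g1 : Real.exp (3 * ε + 2 * L2) ≤ 1 + 10 * τ := by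
      have := (abs_le.1 (Real.abs_exp_sub_one_le (x := 3 * ε + 2 * L2)
        (by rw [abs_of_nonneg (by linarith)]; linarith))).2
      rw [abs_of_nonneg (by linarith)] at this
      linarith
    have g2 : Z ≤ (1 + 9 * τ) * R := r2.trans (by gcongr)
    have hsplit : Real.exp (1 / 2 + 3 * ε + 2 * L2)
        = Real.exp (1 / 2) * Real.exp (3 * ε + 2 * L2) := by
      rw [← Real.exp_add]; congr 1; ring
    rw [hsplit] at hup'
    have hτ0 : 0 ≤ τ := by linarith
    have c1 : Real.exp (3 * ε + 2 * L2) * Z ≤ (1 + 10 * τ) * ((1 + 9 * τ) * R) :=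
      (mul_le_mul_of_nonneg_left g2 (Real.exp_pos _).le).trans
        (mul_le_mul_of_nonneg_right g1 (by positivity))
    have c2 : (1 + 10 * τ) * ((1 + 9 * τ) * R) ≤ (1 + 20 * τ) * R := by
      rw [← mul_assoc]
      gcongr
      nlinarith
    have c3 := mul_le_mul_of_nonneg_left (c1.trans c2) (mul_nonneg ha he.le)
    have e5 : a * Real.exp (1 / 2) * ((1 + 20 * τ) * R)
        = a * (Real.exp (1 / 2) * R) + 20 * (τ * (a * (Real.exp (1 / 2) * R))) := by ring
    have e6 := mul_nonneg hτ0 hθ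
    have e4 : (prefMeasure n).real (J ∩ M.quasirandom)
        ≤ a * Real.exp (1 / 2) * (Real.exp (3 * ε + 2 * L2) * Z) := by
      refine hup'.trans (le_of_eq ?_)
      rw [hZ]; ring
    linarith

theorem switchEvent_self_subset_stable :
    M.switchEvent M (M.outerPairs M ∪ M.innerPairs M) ⊆ M.stable := by
  intro X hX i j hij hM
  have hV : ∀ i, i ∉ M.changed M := fun i hi => (M.mem_changed M).1 hi rfl
  rcases lt_or_gt_of_ne hij with hlt | hlt
  · simpa using hX.2.2 (i, j) (Finset.mem_union_left _ ((M.mem_outerPairs M).2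
      (Or.inl ⟨hV i, hV j, hlt, hM.symm⟩)))
  · refine Or.symm ?_
    simpa using hX.2.2 (j, i) (Finset.mem_union_left _ ((M.mem_outerPairs M).2
      (Or.inl ⟨hV j, hV i, hlt, fun h => hM (by
        rw [show i = M.partner j from h, M.partner_partner])⟩)))

/-- The conditioning event is not restricted to quasirandom arrays, so the remaining part is added
with error 9 · 130000; together with 130019 this stays below 1400000. -/
theorem abs_real_stable_sub_le (hn : Even n) (h : IsSparse n 0) :
    |(prefMeasure n).real M.stable - Real.exp (1 / 2) * orthantMass n 0|
      ≤ 1400000 * (Real.log n ^ 4 * (n : ℝ) ^ (-(1 / 3) : ℝ)) *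
        (Real.exp (1 / 2) * orthantMass n 0) := by
  have hV : M.changed M = ∅ := by simp [changed]
  have hc : (M.changed M).card = 0 := by rw [hV, Finset.card_empty]
  have h' : IsSparse n (M.changed M).card := by rwa [hc]
  have hrate : M.switchRate M = 1 := by simp [switchRate, orientations, hV]
  have h1 := abs_real_inter_quasirandom_sub_le hn h' rfl M.measurableSet_stable
    switchEvent_self_subset_stable stable_subset_switchEvent
  have h2 := real_stable_inter_compl_quasirandom_le (M := M) h
  have hsum := measureReal_inter_add_sdiff (μ := prefMeasure n) (s := M.stable)
    M.measurableSet_quasirandom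
  rw [Set.sdiff_eq] at hsum
  rw [hrate, hc] at h1
  have hR : 0 < orthantMass n 0 := orthantMass_pos (by linarith [h.four_le])
  have hε := h.rpow_pos
  have hl : 1 ≤ Real.log n ^ 4 := one_le_pow₀ (by linarith [h.le_log])
  have h3 : Real.exp (9 / 4) ≤ 9 * Real.exp (1 / 2) := by
    have e1 : Real.exp (9 / 4) = Real.exp (1 / 2) * Real.exp (7 / 4) := by
      rw [← Real.exp_add]; norm_num
    have e2 : Real.exp (7 / 4) ≤ Real.exp 1 * Real.exp 1 := by
      rw [← Real.exp_add]; apply Real.exp_le_exp.2; norm_num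
    have e3 := Real.exp_one_lt_d9
    have e4 : Real.exp 1 * Real.exp 1 ≤ 3 * 3 := by
      have := Real.exp_pos 1
      gcongr <;> linarith
    nlinarith [Real.exp_pos (1 / 2)]
  have h4 : Real.exp (9 / 4) * (130000 * (n : ℝ) ^ (-(1 / 3) : ℝ) * orthantMass n 0) ≤
      1170000 * (Real.log n ^ 4 * (n : ℝ) ^ (-(1 / 3) : ℝ)) *
        (Real.exp (1 / 2) * orthantMass n 0) := by
    calc _ ≤ 9 * Real.exp (1 / 2) * (130000 * (1 * (n : ℝ) ^ (-(1 / 3) : ℝ)) *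
          orthantMass n 0) := by rw [one_mul]; gcongr
      _ ≤ 9 * Real.exp (1 / 2) * (130000 * (Real.log n ^ 4 * (n : ℝ) ^ (-(1 / 3) : ℝ)) *
          orthantMass n 0) := by gcongr
      _ = _ := by ring
  have h5 : 0 ≤ (prefMeasure n).real (M.stable ∩ M.quasirandomᶜ) := measureReal_nonneg
  rw [abs_le] at h1 ⊢
  simp only [Nat.cast_zero, ne_eq, OfNat.ofNat_ne_zero, not_false_eq_true, zero_pow, zero_div,
    add_zero, one_mul] at h1
  have hpos : 0 ≤ (Real.log n ^ 4 * (n : ℝ) ^ (-(1 / 3) : ℝ)) *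
        (Real.exp (1 / 2) * orthantMass n 0) := by positivity
  constructor <;> linarith

/-- The numerator of x/y - a is (x - aθ) - a(y - θ), and y ≥ θ/2. -/
theorem abs_div_sub_le {x y a θ α β : ℝ} (ha : 0 ≤ a) (hθ : 0 < θ)
    (hx : |x - a * θ| ≤ α * (a * θ)) (hy : |y - θ| ≤ β * θ) (hβ : β ≤ 1 / 2) :
    |x / y - a| ≤ 2 * (α + β) * a := by
  have hy0 : θ / 2 ≤ y := by
    have := (abs_le.1 hy).1
    nlinarith
  have hypos : 0 < y := by linarith
  have e : x / y - a = (x - a * y) / y := by field_simp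
  have h1 : |x - a * y| ≤ (α + β) * (a * θ) := by
    calc |x - a * y| = |(x - a * θ) - a * (y - θ)| := by ring_nf
      _ ≤ |x - a * θ| + |a * (y - θ)| := abs_sub _ _
      _ ≤ α * (a * θ) + a * (β * θ) := by
          rw [abs_mul, abs_of_nonneg ha]
          gcongr
      _ = _ := by ring
  have h0 : 0 ≤ (α + β) * (a * θ) := (abs_nonneg _).trans h1
  rw [e, abs_div, abs_of_pos hypos, div_le_iff₀ hypos]
  have h2 : 0 ≤ (α + β) * a := by
    by_contra hc
    push Not at hc
    nlinarith
  nlinarith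

/-- The conditional probability of an event between the two switching events. -/
theorem abs_probGivenStable_sub_le (hn : Even n) (h : IsSparse n (M.changed N).card)
    {E : Set (Fin n → Fin n → ℝ)} (hE : MeasurableSet E)
    (hlow : M.switchEvent N (M.outerPairs N ∪ M.innerPairs N) ⊆ M.stable ∩ E)
    (hup : M.stable ∩ E ⊆ M.switchEvent N (M.outerPairs N)) :
    |probGivenStable M (E ∩ M.quasirandom) - M.switchRate N| ≤
      4000000 * (Real.log n ^ 4 *
        ((n : ℝ) ^ (-(1 / 3) : ℝ) + ((M.changed N).card : ℝ) ^ 2 / n)) * M.switchRate N := by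
  have h00 := h.mono (Nat.zero_le _)
  have h1 := abs_real_inter_quasirandom_sub_le hn h rfl (M.measurableSet_stable.inter hE) hlow hup
  have h2 := abs_real_stable_sub_le (M := M) hn h00
  have hR : 0 < orthantMass n 0 := orthantMass_pos (by linarith [h.four_le])
  have hε := h.rpow_pos
  have hvn : (0 : ℝ) ≤ ((M.changed N).card : ℝ) ^ 2 / n := by positivity
  have hlog : 0 ≤ Real.log n ^ 4 := by positivity
  have hle : Real.log n ^ 4 * (n : ℝ) ^ (-(1 / 3) : ℝ) ≤ Real.log n ^ 4 *
      ((n : ℝ) ^ (-(1 / 3) : ℝ) + ((M.changed N).card : ℝ) ^ 2 / n) := by gcongr; linarith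
  have hsmall := h.error_le
  set τ := Real.log n ^ 4 * ((n : ℝ) ^ (-(1 / 3) : ℝ) + ((M.changed N).card : ℝ) ^ 2 / n)
  have hτ0 : 0 ≤ τ := by positivity
  have e : probGivenStable M (E ∩ M.quasirandom)
      = (prefMeasure n).real (M.stable ∩ E ∩ M.quasirandom) / (prefMeasure n).real M.stable := by
    rw [probGivenStable, Measure.real, cond_apply M.measurableSet_stable, ENNReal.toReal_mul,
      ENNReal.toReal_inv, Set.inter_assoc, div_eq_inv_mul]
    rfl
  rw [e]
  have h2' : |(prefMeasure n).real M.stable - Real.exp (1 / 2) * orthantMass n 0|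
      ≤ 1400000 * τ * (Real.exp (1 / 2) * orthantMass n 0) := h2.trans (by gcongr)
  refine (abs_div_sub_le (M.switchRate_nonneg N) (by positivity) h1 h2' (by linarith)).trans ?_
  refine mul_le_mul_of_nonneg_right ?_ (M.switchRate_nonneg N)
  linarith

end PerfectMatching

/-! ### Combining matchings with disjoint changes. -/

namespace PerfectMatching

variable {n : ℕ} {κ : Type*} {M N : PerfectMatching n} {F : κ → PerfectMatching n}

/-- `N` makes all the changes to `M` that are made by the members of the family `F`. -/
structure IsCombination (M : PerfectMatching n) (F : κ → PerfectMatching n)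
    (N : PerfectMatching n) : Prop where
  agree : ∀ a i, i ∈ M.changed (F a) → N.partner i = (F a).partner i
  rest : ∀ i, (∀ a, i ∉ M.changed (F a)) → N.partner i = M.partner i

/-- The changed set of each `F a` is closed under the partner maps of `M` and of `F a`, so the
partner maps can be glued to an involution. -/
theorem exists_isCombination
    (hd : ∀ a b, a ≠ b → Disjoint (M.changed (F a)) (M.changed (F b))) :
    ∃ N, IsCombination M F N := by
  classical
  let f : Fin n → Fin n := fun i =>
    if h : ∃ a, i ∈ M.changed (F a) then (F h.choose).partner i else M.partner i
  have hf : ∀ a i, i ∈ M.changed (F a) → f i = (F a).partner i := by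
    intro a i hi
    have h : ∃ a, i ∈ M.changed (F a) := ⟨a, hi⟩
    have : h.choose = a := by
      by_contra hne
      exact Finset.disjoint_left.1 (hd _ _ hne) h.choose_spec hi
    simp only [f, dif_pos h, this]
  have hf' : ∀ i, (∀ a, i ∉ M.changed (F a)) → f i = M.partner i := fun i hi =>
    dif_neg fun ⟨a, ha⟩ => hi a ha
  refine ⟨⟨f, fun i => ?_, fun i => ?_⟩, hf, hf'⟩ <;> by_cases h : ∃ a, i ∈ M.changed (F a)
  · obtain ⟨a, ha⟩ := h
    rw [hf a i ha, hf a _ (M.partner_mem_changed' (F a) ha), (F a).partner_partner]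
  · push Not at h
    rw [hf' i h, hf' _ fun a => M.partner_notMem_changed (F a) (h a), M.partner_partner]
  · obtain ⟨a, ha⟩ := h
    rw [hf a i ha]
    exact (F a).partner_ne i
  · push Not at h
    rw [hf' i h]
    exact M.partner_ne i

namespace IsCombination

variable (h : IsCombination M F N)
include h

theorem mem_changed_iff {i : Fin n} : i ∈ M.changed N ↔ ∃ a, i ∈ M.changed (F a) := by
  constructor
  · intro hi
    by_contra hc
    push Not at hc
    exact (M.mem_changed N).1 hi (h.rest i hc)
  · rintro ⟨a, ha⟩
    rw [mem_changed, h.agree a i ha]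
    exact (M.mem_changed (F a)).1 ha

theorem partner_eq_or (a : κ) (i : Fin n) :
    (F a).partner i = M.partner i ∨ (F a).partner i = N.partner i := by
  by_cases hi : i ∈ M.changed (F a)
  · exact Or.inr (h.agree a i hi).symm
  · exact Or.inl (M.partner_eq_of_notMem_changed (F a) hi)

/-- For a pair with one changed member i, if the unchanged member does not prefer their own partner,
stability of `M` and of some `F a` both fall on i, whose entry must exceed the maximum of both
values. With two changed members the two matchings could be protected by different people, so inner
pairs cannot be included. -/
theorem subset_switchEvent :
    M.stable ∩ ⋂ a, (F a).stable ⊆ M.switchEvent N (M.outerPairs N) := by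
  rintro X ⟨hM, hF⟩
  rw [Set.mem_iInter] at hF
  refine ⟨fun i hi => ?_, fun i hi => ?_, fun p hp => ?_⟩
  · obtain ⟨a, ha⟩ := h.mem_changed_iff.1 hi
    have hne := (M.mem_changed (F a)).1 ha
    rw [h.agree a i ha, h.agree a _ (M.partner_mem_changed (F a) ha)]
    exact hF a i (M.partner i) (M.partner_ne i).symm hne
  · exact hM i (N.partner i) (N.partner_ne i).symm ((M.mem_changed N).1 hi).symm
  · obtain ⟨hne, h2, h3⟩ := M.outerPairs_ne N hp
    obtain ⟨i, j⟩ := p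
    dsimp only at hne h2 h3 ⊢
    have hMij := hM i j hne h2.symm
    rcases (M.mem_outerPairs N).1 hp with ⟨hi, hj, -⟩ | ⟨hi, hj⟩
    · rwa [M.partner_eq_of_notMem_changed N hi, M.partner_eq_of_notMem_changed N hj, max_self,
        max_self]
    · obtain ⟨a, ha⟩ := h.mem_changed_iff.1 hi
      have hja : j ∉ M.changed (F a) := fun hc => hj (h.mem_changed_iff.2 ⟨a, hc⟩)
      have hFij := hF a i j hne (by rw [← h.agree a i ha]; exact h3.symm)
      rw [M.partner_eq_of_notMem_changed (F a) hja, ← h.agree a i ha] at hFij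
      rw [M.partner_eq_of_notMem_changed N hj, max_self]
      rcases hMij with h4 | h4
      · rcases hFij with h5 | h5
        · exact Or.inl (max_lt h4 h5)
        · exact Or.inr h5
      · exact Or.inr h4

/-- Every partner under `F a` is a partner under `M` or `N`, so the condition with the maxima
implies stability at pairs matched in neither. Pairs matched in `M` or `N` are covered by the other
two clauses of the event. -/
theorem switchEvent_subset :
    M.switchEvent N (M.outerPairs N ∪ M.innerPairs N) ⊆ M.stable ∩ ⋂ a, (F a).stable := by
  rintro X ⟨h1, h2, h3⟩
  have swap : ∀ {P : PerfectMatching n} {i j : Fin n}, j ≠ P.partner i → i ≠ P.partner j := by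
    rintro P i j hne rfl
    exact hne (P.partner_partner j).symm
  have key : ∀ i j, i ≠ j → j ≠ M.partner i → j ≠ N.partner i →
      max (X i (M.partner i)) (X i (N.partner i)) < X i j ∨
        max (X j (M.partner j)) (X j (N.partner j)) < X j i := by
    have aux : ∀ i j, i < j → j ≠ M.partner i → j ≠ N.partner i →
      max (X i (M.partner i)) (X i (N.partner i)) < X i j ∨
        max (X j (M.partner j)) (X j (N.partner j)) < X j i := by
      intro i j hij hM hN
      by_cases hi : i ∈ M.changed N <;> by_cases hj : j ∈ M.changed N
      · exact h3 (i, j) (Finset.mem_union_right _ ((M.mem_innerPairs N).2 ⟨hi, hj, hij, hM, hN⟩))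
      · exact h3 (i, j) (Finset.mem_union_left _ ((M.mem_outerPairs N).2 (Or.inr ⟨hi, hj⟩)))
      · exact (h3 (j, i) (Finset.mem_union_left _
          ((M.mem_outerPairs N).2 (Or.inr ⟨hj, hi⟩)))).symm
      · exact h3 (i, j) (Finset.mem_union_left _
          ((M.mem_outerPairs N).2 (Or.inl ⟨hi, hj, hij, hM⟩)))
    intro i j hij hM hN
    rcases lt_or_gt_of_ne hij with hlt | hlt
    · exact aux i j hlt hM hN
    · exact (aux j i hlt (swap hM) (swap hN)).symm
  refine ⟨fun i j hij hM => ?_, Set.mem_iInter.2 fun a i j hij hF => ?_⟩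
  · by_cases hN : N.partner i = j
    · subst hN
      exact h2 i ((M.mem_changed N).2 (Ne.symm hM))
    · exact (key i j hij (Ne.symm hM) (Ne.symm hN)).imp (le_max_left _ _).trans_lt
        (le_max_left _ _).trans_lt
  · by_cases hM : M.partner i = j
    · subst hM
      have ha : i ∈ M.changed (F a) := (M.mem_changed (F a)).2 hF
      rw [← h.agree a i ha, ← h.agree a _ (M.partner_mem_changed (F a) ha)]
      exact h1 i (h.mem_changed_iff.2 ⟨a, ha⟩)
    · by_cases hN : N.partner i = j
      · subst hN
        have hi : i ∈ M.changed N := (M.mem_changed N).2 (Ne.symm hM)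
        -- A pair of `N` that is not a pair of `F a` comes from another member of the family. Both
        -- its people keep their `M`-partners under `F a`, so stability of `M` along this pair
        -- suffices.
        have ha : i ∉ M.changed (F a) := fun hc => hF (h.agree a i hc).symm
        have hja : N.partner i ∉ M.changed (F a) := by
          intro hc
          have := h.agree a _ hc
          rw [N.partner_partner] at this
          apply hF
          nth_rw 1 [this]
          exact (F a).partner_partner _
        rw [M.partner_eq_of_notMem_changed (F a) ha, M.partner_eq_of_notMem_changed (F a) hja]
        exact h2 i hi
      · refine (key i j hij (Ne.symm hM) (Ne.symm hN)).imp (fun hlt => ?_) fun hlt => ?_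
        · rcases h.partner_eq_or a i with e | e <;> rw [e]
          · exact (le_max_left _ _).trans_lt hlt
          · exact (le_max_right _ _).trans_lt hlt
        · rcases h.partner_eq_or a j with e | e <;> rw [e]
          · exact (le_max_left _ _).trans_lt hlt
          · exact (le_max_right _ _).trans_lt hlt

variable [Fintype κ]

theorem changed_eq : M.changed N = Finset.univ.biUnion fun a => M.changed (F a) := by
  ext i
  simp [h.mem_changed_iff]

variable (hd : ∀ a b, a ≠ b → Disjoint (M.changed (F a)) (M.changed (F b)))
include hd

theorem card_changed : (M.changed N).card = ∑ a, (M.changed (F a)).card := by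
  rw [h.changed_eq, Finset.card_biUnion fun a _ b _ hab => hd a b hab]

/-- The conditions on an orientation couple only people within one changed set, so orientations of
`N` are free choices of an orientation for each `F a`. This multiplicativity is the source of the
approximate independence; the counts themselves are never needed. -/
theorem card_orientations : (M.orientations N).card = ∏ a, (M.orientations (F a)).card := by
  classical
  rw [← Fintype.card_piFinset]
  refine Finset.card_nbij' (fun B a => B ∩ M.changed (F a)) (fun f => Finset.univ.biUnion f)
    ?_ ?_ ?_ ?_
  · intro B hB
    rw [Finset.mem_coe] at hB ⊢
    obtain ⟨-, hB2⟩ := Finset.mem_filter.1 hB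
    refine Fintype.mem_piFinset.2 fun a => Finset.mem_filter.2
      ⟨Finset.mem_powerset.2 Finset.inter_subset_right, fun i hi => ?_⟩
    obtain ⟨h1, h2⟩ := hB2 i (h.mem_changed_iff.2 ⟨a, hi⟩)
    rw [h.agree a i hi] at h2
    simp only [Finset.mem_inter, hi, M.partner_mem_changed (F a) hi,
      M.partner_mem_changed' (F a) hi, and_true]
    exact ⟨h1, h2⟩
  · intro f hf
    rw [Finset.mem_coe] at hf ⊢
    have hf' := fun a => Finset.mem_filter.1 (Fintype.mem_piFinset.1 hf a)
    have hsub := fun a => Finset.mem_powerset.1 (hf' a).1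
    have hmem : ∀ a i, i ∈ M.changed (F a) → (i ∈ Finset.univ.biUnion f ↔ i ∈ f a) := by
      intro a i hi
      simp only [Finset.mem_biUnion, Finset.mem_univ, true_and]
      refine ⟨?_, fun hia => ⟨a, hia⟩⟩
      rintro ⟨b, hb⟩
      by_cases hab : a = b
      · rwa [hab]
      · exact absurd (hsub b hb) (Finset.disjoint_left.1 (hd a b hab) hi)
    refine Finset.mem_filter.2 ⟨Finset.mem_powerset.2 fun i hi => ?_, fun i hi => ?_⟩
    · obtain ⟨a, -, ha⟩ := Finset.mem_biUnion.1 hi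
      exact h.mem_changed_iff.2 ⟨a, hsub a ha⟩
    · obtain ⟨a, ha⟩ := h.mem_changed_iff.1 hi
      rw [h.agree a i ha, hmem a i ha, hmem a _ (M.partner_mem_changed (F a) ha),
        hmem a _ (M.partner_mem_changed' (F a) ha)]
      exact (hf' a).2 i ha
  · intro B hB
    rw [Finset.mem_coe] at hB
    have hB1 := Finset.mem_powerset.1 (Finset.mem_filter.1 hB).1
    rw [h.changed_eq] at hB1
    dsimp only
    rw [← Finset.inter_biUnion]
    exact Finset.inter_eq_left.2 hB1
  · intro f hf
    rw [Finset.mem_coe] at hf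
    have hsub := fun a => Finset.mem_powerset.1 (Finset.mem_filter.1 (Fintype.mem_piFinset.1 hf a)).1
    funext a
    ext i
    simp only [Finset.mem_inter, Finset.mem_biUnion, Finset.mem_univ, true_and]
    constructor
    · rintro ⟨⟨b, hb⟩, hi⟩
      by_cases hab : a = b
      · rwa [hab]
      · exact absurd (hsub b hb) (Finset.disjoint_left.1 (hd a b hab) hi)
    · exact fun hi => ⟨⟨a, hi⟩, hsub a hi⟩

theorem switchRate_eq : M.switchRate N = ∏ a, M.switchRate (F a) := by
  simp only [switchRate]
  rw [Finset.prod_div_distrib, h.card_orientations hd, h.card_changed hd, Finset.prod_pow_eq_pow_sum]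
  push_cast
  rfl

end IsCombination

theorem isCombination_const (N : PerfectMatching n) :
    IsCombination M (fun _ : Unit => N) N :=
  ⟨fun _ _ _ => rfl, fun _ hi => M.partner_eq_of_notMem_changed N (hi ())⟩

/-- The conditional probability that the members of a family with disjoint changes are stable. -/
theorem abs_probGivenStable_iInter_sub_le (hn : Even n) [Fintype κ]
    (hd : ∀ a b, a ≠ b → Disjoint (M.changed (F a)) (M.changed (F b)))
    (h : IsSparse n (∑ a, (M.changed (F a)).card)) :
    |probGivenStable M ((⋂ a, (F a).stable) ∩ M.quasirandom) - ∏ a, M.switchRate (F a)| ≤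
      4000000 * (Real.log n ^ 4 * ((n : ℝ) ^ (-(1 / 3) : ℝ) +
        ((∑ a, (M.changed (F a)).card : ℕ) : ℝ) ^ 2 / n)) * ∏ a, M.switchRate (F a) := by
  obtain ⟨N, hN⟩ := exists_isCombination hd
  rw [← hN.card_changed hd] at h ⊢
  rw [← hN.switchRate_eq hd]
  exact abs_probGivenStable_sub_le hn h
    (MeasurableSet.iInter fun a => (F a).measurableSet_stable) hN.switchEvent_subset
    hN.subset_switchEvent

theorem abs_probGivenStable_stable_sub_le (hn : Even n) (h : IsSparse n (M.changed N).card) :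
    |probGivenStable M (N.stable ∩ M.quasirandom) - M.switchRate N| ≤
      4000000 * (Real.log n ^ 4 *
        ((n : ℝ) ^ (-(1 / 3) : ℝ) + ((M.changed N).card : ℝ) ^ 2 / n)) * M.switchRate N := by
  have hN := isCombination_const (M := M) N
  have h1 := hN.switchEvent_subset
  have h2 := hN.subset_switchEvent
  rw [Set.iInter_const] at h1 h2
  exact abs_probGivenStable_sub_le hn h N.measurableSet_stable h1 h2

end PerfectMatching

/-! ### From difference graphs to sets of changed people. -/

theorem IsSingleCycle.ncard_edgeSet_le {V : Type*} {G : SimpleGraph V} {ℓ : ℕ}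
    (h : IsSingleCycle G ℓ) : G.edgeSet.ncard ≤ ℓ := by
  classical
  obtain ⟨v, w, -, rfl, hw⟩ := h
  have hsub : G.edgeSet ⊆ (w.edges.toFinset : Set (Sym2 V)) := fun e he =>
    Finset.mem_coe.2 (List.mem_toFinset.2 (hw e he))
  calc G.edgeSet.ncard ≤ (w.edges.toFinset : Set (Sym2 V)).ncard :=
        Set.ncard_le_ncard hsub (Finset.finite_toSet _)
    _ = w.edges.toFinset.card := Set.ncard_coe_finset _
    _ ≤ w.edges.length := List.toFinset_card_le _
    _ = w.length := w.length_edges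

namespace PerfectMatching

variable {n : ℕ} {M N : PerfectMatching n}

theorem diffGraph_adj_partner {i : Fin n} (hi : i ∈ M.changed N) :
    (N.diffGraph M).Adj i (M.partner i) := by
  rw [diffGraph, symmDiff, SimpleGraph.sup_adj, SimpleGraph.sdiff_adj, SimpleGraph.sdiff_adj]
  exact Or.inr ⟨rfl, (M.mem_changed N).1 hi⟩

/-- Edge-disjointness is enough: a person changed in both would have their `M`-edge in both
difference graphs. -/
theorem disjoint_changed {N' : PerfectMatching n}
    (h : Disjoint (N.diffGraph M) (N'.diffGraph M)) :
    Disjoint (M.changed N) (M.changed N') := by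
  rw [Finset.disjoint_left]
  intro i hi hi'
  exact SimpleGraph.disjoint_left.1 h i (M.partner i) (diffGraph_adj_partner hi)
    (diffGraph_adj_partner hi')

theorem card_changed_le : (M.changed N).card ≤ 2 * (N.diffGraph M).edgeSet.ncard := by
  classical
  have hfin : (N.diffGraph M).edgeSet.Finite := Set.toFinite _
  have hsub : M.changed N ⊆ hfin.toFinset.biUnion fun e => e.toFinset := by
    intro i hi
    exact Finset.mem_biUnion.2 ⟨s(i, M.partner i), hfin.mem_toFinset.2
      (diffGraph_adj_partner hi), by simp⟩
  rw [Set.ncard_eq_toFinset_card _ hfin, mul_comm]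
  refine (Finset.card_le_card hsub).trans (Finset.card_biUnion_le_card_mul _ _ _ fun e _ => ?_)
  rw [Sym2.card_toFinset]
  split_ifs <;> norm_num

end PerfectMatching

/-! ### Powers of n as integer powers of the sixtieth root. -/

/-- The number `y` is the sixtieth root of `n`, and is large. -/
structure IsScale (n : ℕ) (y : ℝ) : Prop where
  pos : 0 < y
  pow_eq : y ^ 60 = n
  le_log : 8 ≤ Real.log n
  log_le : 1000 * Real.log n ≤ y

theorem eventually_isScale :
    ∀ᶠ n : ℕ in atTop, IsScale n ((n : ℝ) ^ (1 / 60 : ℝ)) := by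
  have h1 : ∀ᶠ x : ℝ in atTop, 8 ≤ Real.log x := Real.tendsto_log_atTop.eventually_ge_atTop 8
  have h2 := (isLittleO_log_rpow_atTop (by norm_num : (0 : ℝ) < 1 / 60)).bound
    (by norm_num : (0 : ℝ) < 1 / 1000)
  have h : ∀ᶠ x : ℝ in atTop, 0 < x ∧ 8 ≤ Real.log x ∧ 1000 * Real.log x ≤ x ^ (1 / 60 : ℝ) := by
    filter_upwards [h1, h2, eventually_gt_atTop 0] with x hx1 hx2 hx0
    rw [Real.norm_of_nonneg (by linarith), Real.norm_of_nonneg (by positivity)] at hx2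
    exact ⟨hx0, hx1, by linarith⟩
  filter_upwards [tendsto_natCast_atTop_atTop.eventually h] with n hn
  refine ⟨Real.rpow_pos_of_pos hn.1 _, ?_, hn.2.1, hn.2.2⟩
  rw [← Real.rpow_natCast, ← Real.rpow_mul hn.1.le]
  norm_num

namespace IsScale

variable {n : ℕ} {y : ℝ} (h : IsScale n y)
include h

theorem le_scale : 8000 ≤ y := by linarith [h.le_log, h.log_le]

theorem rpow_eq (r : ℝ) (m : ℕ) (hr : r * 60 = m) : (n : ℝ) ^ r = y ^ m := by
  rw [← h.pow_eq, ← Real.rpow_natCast, ← Real.rpow_natCast, ← Real.rpow_mul h.pos.le, ← hr]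
  congr 1
  push_cast
  ring

theorem rpow_neg_third : (n : ℝ) ^ (-(1 / 3) : ℝ) = (y ^ 20)⁻¹ := by
  rw [Real.rpow_neg (Nat.cast_nonneg _), h.rpow_eq (1 / 3) 20 (by norm_num)]

theorem sqrt_eq : √(n : ℝ) = y ^ 30 := by
  rw [← h.pow_eq, show y ^ 60 = (y ^ 30) ^ 2 by ring, Real.sqrt_sq (pow_nonneg h.pos.le _)]

theorem log_pow_le (m : ℕ) : Real.log n ^ m ≤ (y / 1000) ^ m :=
  pow_le_pow_left₀ (by linarith [h.le_log]) (by linarith [h.log_le]) m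

/-- The bound y^25 is n^{1/6} · n^{1/4}, the number of matchings times the cycle length. Logarithms
are absorbed through 1000 log n ≤ y. -/
theorem isSparse {v : ℕ} (hv : (v : ℝ) ≤ 4 * y ^ 25) : IsSparse n v := by
  have hy := h.le_scale
  have hy0 := h.pos
  have hl := h.le_log
  have h1 := h.log_le
  have hv0 : (0 : ℝ) ≤ v := Nat.cast_nonneg v
  have hy1 : 1 ≤ y := by linarith
  refine ⟨hl, ?_, ?_, ?_, ?_, ?_⟩
  · rw [h.sqrt_eq]
    have := le_self_pow₀ hy1 (by norm_num : 30 ≠ 0)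
    linarith
  · rw [h.sqrt_eq]
    calc 36 * (v : ℝ) * Real.log n ≤ 36 * (4 * y ^ 25) * (y / 144) := by
          gcongr; linarith
      _ = y ^ 26 := by ring
      _ ≤ y ^ 30 := pow_le_pow_right₀ hy1 (by norm_num)
  · rw [h.rpow_neg_third, ← h.pow_eq, show y ^ 60 = y ^ 40 * y ^ 20 by ring,
      mul_inv_cancel_right₀ (by positivity)]
    calc 8 * (v : ℝ) ≤ 8 * (4 * y ^ 25) := by gcongr
      _ = 32 * y ^ 25 := by ring
      _ ≤ y * y ^ 25 := by gcongr; linarith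
      _ = y ^ 26 := by ring
      _ ≤ y ^ 40 := pow_le_pow_right₀ hy1 (by norm_num)
  · rw [h.rpow_neg_third, h.sqrt_eq, show y ^ 30 = y ^ 10 * y ^ 20 by ring,
      mul_inv_cancel_right₀ (by positivity)]
    calc Real.log n ^ 3 ≤ (y / 1000) ^ 3 := h.log_pow_le 3
      _ ≤ y ^ 3 := by gcongr; linarith
      _ ≤ y ^ 10 := pow_le_pow_right₀ hy1 (by norm_num)
      _ ≤ 18 * y ^ 10 := by linarith [pow_pos hy0 10]
  · rw [h.rpow_neg_third, ← h.pow_eq]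
    have e1 : (v : ℝ) ^ 2 / y ^ 60 ≤ 16 * (y ^ 10)⁻¹ := by
      calc (v : ℝ) ^ 2 / y ^ 60 ≤ (4 * y ^ 25) ^ 2 / y ^ 60 := by gcongr
        _ = 16 * (y ^ 10)⁻¹ := by field_simp; norm_num
    have e2 : (y ^ 20)⁻¹ ≤ (y ^ 10)⁻¹ :=
      inv_anti₀ (by positivity) (pow_le_pow_right₀ hy1 (by norm_num))
    have e3 : Real.log (y ^ 60) ^ 4 ≤ (y / 1000) ^ 4 := by
      rw [h.pow_eq]; exact h.log_pow_le 4
    calc 10 ^ 8 * (Real.log (y ^ 60) ^ 4 * ((y ^ 20)⁻¹ + (v : ℝ) ^ 2 / y ^ 60))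
        ≤ 10 ^ 8 * ((y / 1000) ^ 4 * ((y ^ 10)⁻¹ + 16 * (y ^ 10)⁻¹)) := by gcongr
      _ = 17 / 10000 * (y ^ 6)⁻¹ := by field_simp; norm_num
      _ ≤ 1 * 1 := by
          gcongr
          · norm_num
          · exact inv_le_one_of_one_le₀ (one_le_pow₀ hy1)
      _ = 1 := by norm_num

end IsScale

/-! ### Passing from the main terms to products of probabilities, and conclusion. -/

/-- Both P and ∏ p are compared with A = ∏ a: the individual errors accumulate to at most 2T, so |P
- ∏ p| ≤ 3TA, and A ≤ 2 ∏ p gives the factor 6. -/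
theorem abs_sub_prod_le {κ : Type*} [Fintype κ] {P T t : ℝ} {p a : κ → ℝ}
    (ha : ∀ i, 0 ≤ a i) (ht : 0 ≤ t) (hT : T ≤ 1 / 2)
    (hp : ∀ i, |p i - a i| ≤ t * a i) (hP : |P - ∏ i, a i| ≤ T * ∏ i, a i)
    (htT : Fintype.card κ * t ≤ T) : |P - ∏ i, p i| ≤ 6 * T * ∏ i, p i := by
  have hA : 0 ≤ ∏ i, a i := Finset.prod_nonneg fun i _ => ha i
  have hT0 : 0 ≤ T := le_trans (by positivity) htT
  rcases isEmpty_or_nonempty κ with hκ | hκ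
  · simp only [Finset.univ_eq_empty, Finset.prod_empty, mul_one] at hP ⊢
    linarith
  have hk : (1 : ℝ) ≤ Fintype.card κ := by exact_mod_cast Fintype.card_pos
  have ht1 : t ≤ 1 / 2 := by nlinarith
  have hlow : (1 - t) ^ Fintype.card κ * ∏ i, a i ≤ ∏ i, p i := by
    rw [← Finset.card_univ, ← Finset.prod_const, ← Finset.prod_mul_distrib]
    refine Finset.prod_le_prod (fun i _ => mul_nonneg (by linarith) (ha i)) fun i _ => ?_
    have := (abs_le.1 (hp i)).1
    linarith
  have hup : ∏ i, p i ≤ (1 + t) ^ Fintype.card κ * ∏ i, a i := by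
    rw [← Finset.card_univ, ← Finset.prod_const, ← Finset.prod_mul_distrib]
    refine Finset.prod_le_prod (fun i _ => ?_) fun i _ => ?_
    · have := (abs_le.1 (hp i)).1
      nlinarith [ha i]
    · have := (abs_le.1 (hp i)).2
      linarith
  have e1 : 1 - T ≤ (1 - t) ^ Fintype.card κ := by
    have := one_add_mul_le_pow (a := -t) (by linarith) (Fintype.card κ)
    rw [← sub_eq_add_neg] at this
    linarith
  have e2 : (1 + t) ^ Fintype.card κ ≤ 1 + 2 * T := by
    calc (1 + t) ^ Fintype.card κ ≤ Real.exp t ^ Fintype.card κ := by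
          gcongr; linarith [Real.add_one_le_exp t]
      _ = Real.exp (Fintype.card κ * t) := by rw [← Real.exp_nat_mul]
      _ ≤ Real.exp T := Real.exp_le_exp.2 htT
      _ ≤ 1 + 2 * T := by
          have := (abs_le.1 (Real.abs_exp_sub_one_le (x := T)
            (by rw [abs_of_nonneg hT0]; linarith))).2
          rw [abs_of_nonneg hT0] at this
          linarith
  have c1 := (mul_le_mul_of_nonneg_right e1 hA).trans hlow
  have c2 := hup.trans (mul_le_mul_of_nonneg_right e2 hA)
  set A := ∏ i, a i
  set B := ∏ i, p i
  have hAB : A ≤ 2 * B := by nlinarith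
  have h3 : |P - B| ≤ 3 * T * A := by
    obtain ⟨p1, p2⟩ := abs_le.1 hP
    have := mul_nonneg hT0 hA
    exact abs_le.2 ⟨by linarith, by linarith⟩
  nlinarith

namespace PerfectMatching

variable {n : ℕ} {M : PerfectMatching n}

/-- Approximate conditional independence for matchings with few and disjoint changes. -/
theorem abs_probGivenStable_iInter_sub_prod_le (hn : Even n) {y : ℝ} (hy : IsScale n y) {k : ℕ}
    (hk1 : 1 ≤ k) (hk : (k : ℝ) ≤ y ^ 10) {F : Fin k → PerfectMatching n}
    (hd : ∀ a b, a ≠ b → Disjoint (M.changed (F a)) (M.changed (F b)))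
    (hc : ∀ a, ((M.changed (F a)).card : ℝ) ≤ 2 * y ^ 15) :
    |probGivenStable M ((⋂ a, (F a).stable) ∩ M.quasirandom)
        - ∏ a, probGivenStable M ((F a).stable ∩ M.quasirandom)|
      ≤ 120000000 * Real.log n ^ 4 * (k * (n : ℝ) ^ (-(1 / 3) : ℝ))
        * ∏ a, probGivenStable M ((F a).stable ∩ M.quasirandom) := by
  have hy0 := hy.pos
  have hy1 : 1 ≤ y := by linarith [hy.le_scale]
  have hk1' : (1 : ℝ) ≤ k := by exact_mod_cast hk1
  have hl : 0 ≤ Real.log n ^ 4 := by positivity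
  have hsum : ((∑ a, (M.changed (F a)).card : ℕ) : ℝ) ≤ 2 * k * y ^ 15 := by
    push_cast
    refine (Finset.sum_le_sum fun a _ => hc a).trans (le_of_eq ?_)
    rw [Finset.sum_const, Finset.card_univ, Fintype.card_fin, nsmul_eq_mul]
    ring
  have hs1 : IsSparse n (∑ a, (M.changed (F a)).card) := by
    refine hy.isSparse (hsum.trans ?_)
    calc 2 * (k : ℝ) * y ^ 15 ≤ 2 * y ^ 10 * y ^ 15 := by gcongr
      _ = 2 * y ^ 25 := by ring
      _ ≤ 4 * y ^ 25 := by gcongr; norm_num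
  have key := abs_probGivenStable_iInter_sub_le hn hd hs1
  have key1 := fun a => abs_probGivenStable_stable_sub_le hn
    (hs1.mono (Finset.single_le_sum (fun a _ => Nat.zero_le (M.changed (F a)).card)
      (Finset.mem_univ a)))
  -- Here v²/n ≤ 4c² n^{-1/2}, and one factor c is traded for n^{1/6}, leaving 4c n^{-1/3}. This
  -- makes the error linear in k; it is used with c = k for the family and c = 1 for each member.
  have herr : ∀ {v : ℕ} {c : ℝ}, 1 ≤ c → c ≤ y ^ 10 → (v : ℝ) ≤ 2 * c * y ^ 15 →
      4000000 * (Real.log n ^ 4 * ((n : ℝ) ^ (-(1 / 3) : ℝ) + (v : ℝ) ^ 2 / n))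
        ≤ 20000000 * (Real.log n ^ 4 * (c * (n : ℝ) ^ (-(1 / 3) : ℝ))) := by
    intro v c hc1 hcy hv
    have e1 : (v : ℝ) ^ 2 / n ≤ 4 * c * (n : ℝ) ^ (-(1 / 3) : ℝ) := by
      rw [hy.rpow_neg_third, ← hy.pow_eq]
      calc (v : ℝ) ^ 2 / y ^ 60 ≤ (2 * c * y ^ 15) ^ 2 / y ^ 60 := by gcongr
        _ = 4 * c * (c * (y ^ 30)⁻¹) := by field_simp; ring
        _ ≤ 4 * c * (y ^ 10 * (y ^ 30)⁻¹) := by gcongr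
        _ = 4 * c * (y ^ 20)⁻¹ := by field_simp
    have hε := hs1.rpow_pos
    have e2 : (n : ℝ) ^ (-(1 / 3) : ℝ) + (v : ℝ) ^ 2 / n
        ≤ 5 * (c * (n : ℝ) ^ (-(1 / 3) : ℝ)) := by nlinarith
    calc _ ≤ 4000000 * (Real.log n ^ 4 * (5 * (c * (n : ℝ) ^ (-(1 / 3) : ℝ)))) := by gcongr
      _ = _ := by ring
  have hε := hs1.rpow_pos
  have hsmall : 20000000 * (Real.log n ^ 4 * (k * (n : ℝ) ^ (-(1 / 3) : ℝ))) ≤ 1 / 2 := by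
    rw [hy.rpow_neg_third]
    calc 20000000 * (Real.log n ^ 4 * (k * (y ^ 20)⁻¹))
        ≤ 20000000 * ((y / 1000) ^ 4 * (y ^ 10 * (y ^ 20)⁻¹)) := by
          have := hy.log_pow_le 4
          gcongr ?_ * (?_ * (?_ * _))
      _ = 1 / 50000 * (y ^ 6)⁻¹ := by field_simp; norm_num
      _ ≤ 1 / 50000 * 1 := by
          gcongr
          exact inv_le_one_of_one_le₀ (one_le_pow₀ hy1)
      _ ≤ 1 / 2 := by norm_num
  have := abs_sub_prod_le (P := probGivenStable M ((⋂ a, (F a).stable) ∩ M.quasirandom))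
    (T := 20000000 * (Real.log n ^ 4 * (k * (n : ℝ) ^ (-(1 / 3) : ℝ))))
    (t := 20000000 * (Real.log n ^ 4 * (1 * (n : ℝ) ^ (-(1 / 3) : ℝ))))
    (p := fun a => probGivenStable M ((F a).stable ∩ M.quasirandom))
    (a := fun a => M.switchRate (F a)) (fun a => M.switchRate_nonneg _) (by positivity) hsmall
    (fun a => (key1 a).trans (mul_le_mul_of_nonneg_right
      (herr le_rfl (one_le_pow₀ hy1) (by linarith [hc a])) (M.switchRate_nonneg _)))
    (key.trans (mul_le_mul_of_nonneg_right (herr hk1' hk hsum)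
      (Finset.prod_nonneg fun a _ => M.switchRate_nonneg _)))
    (le_of_eq (by rw [Fintype.card_fin]; ring))
  refine this.trans (le_of_eq ?_)
  ring

end PerfectMatching

theorem mainTheorem3 :
    ∃ (C : ℝ) (p : ℕ), 0 < C ∧ ∀ᶠ n : ℕ in atTop, Even n → ∀ M : PerfectMatching n,
      -- `k` matchings, each differing from `M` on one short cycle, the cycles being disjoint
      (∀ k : ℕ, 1 ≤ k → (k : ℝ) ≤ (n : ℝ) ^ (1 / 6 : ℝ) →
        ∀ N : Fin k → PerfectMatching n,
          (∀ a, ∃ ℓ : ℕ, (ℓ : ℝ) ≤ (n : ℝ) ^ (1 / 4 : ℝ) ∧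
            IsSingleCycle ((N a).diffGraph M) ℓ) →
          (∀ a b, a ≠ b → Disjoint ((N a).diffGraph M) ((N b).diffGraph M)) →
          |probGivenStable M ((⋂ a, (N a).stable) ∩ M.quasirandom)
              - ∏ a, probGivenStable M ((N a).stable ∩ M.quasirandom)|
            ≤ C * Real.log n ^ p * (k * (n : ℝ) ^ (-(1 / 3) : ℝ))
              * ∏ a, probGivenStable M ((N a).stable ∩ M.quasirandom)) ∧
      -- two matchings differing from `M` on few nodes, the two sets of nodes being disjoint
      (∀ N₁ N₂ : PerfectMatching n,
          ((N₁.diffGraph M).edgeSet.ncard : ℝ) ≤ (n : ℝ) ^ (1 / 4 : ℝ) →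
          ((N₂.diffGraph M).edgeSet.ncard : ℝ) ≤ (n : ℝ) ^ (1 / 4 : ℝ) →
          (∀ i, N₁.partner i = M.partner i ∨ N₂.partner i = M.partner i) →
          |probGivenStable M (N₁.stable ∩ N₂.stable ∩ M.quasirandom)
              - probGivenStable M (N₁.stable ∩ M.quasirandom)
                * probGivenStable M (N₂.stable ∩ M.quasirandom)|
            ≤ C * Real.log n ^ p * (n : ℝ) ^ (-(1 / 3) : ℝ)
              * (probGivenStable M (N₁.stable ∩ M.quasirandom)
                * probGivenStable M (N₂.stable ∩ M.quasirandom))) := by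
  -- The power 4 of the logarithm comes from L² = log⁴ n / n. The constant is twice that of the
  -- general estimate because the second claim is its case k = 2.
  refine ⟨240000000, 4, by norm_num, ?_⟩
  filter_upwards [eventually_isScale] with n hy hn M
  rw [hy.rpow_eq (1 / 6) 10 (by norm_num), hy.rpow_eq (1 / 4) 15 (by norm_num)]
  have hcard : ∀ N : PerfectMatching n, ((N.diffGraph M).edgeSet.ncard : ℝ) ≤
      ((n : ℝ) ^ (1 / 60 : ℝ)) ^ 15 →
      ((M.changed N).card : ℝ) ≤ 2 * ((n : ℝ) ^ (1 / 60 : ℝ)) ^ 15 := by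
    intro N hN
    have : ((M.changed N).card : ℝ) ≤ 2 * ((N.diffGraph M).edgeSet.ncard : ℝ) := by
      exact_mod_cast PerfectMatching.card_changed_le
    linarith
  have hprob : ∀ E, 0 ≤ probGivenStable M E := fun E => measureReal_nonneg
  constructor
  · intro k hk1 hk N hN hd
    refine (PerfectMatching.abs_probGivenStable_iInter_sub_prod_le hn hy hk1 hk
      (fun a b hab => PerfectMatching.disjoint_changed (hd a b hab)) fun a => ?_).trans ?_
    · obtain ⟨ℓ, hℓ, hcyc⟩ := hN a
      refine hcard _ (le_trans ?_ hℓ)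
      exact_mod_cast hcyc.ncard_edgeSet_le
    · have : 0 ≤ ∏ a, probGivenStable M ((N a).stable ∩ M.quasirandom) :=
        Finset.prod_nonneg fun a _ => hprob _
      have hlog : 0 ≤ Real.log n ^ 4 := by positivity
      gcongr
      norm_num
  · intro N₁ N₂ h₁ h₂ hd
    have hdisj : Disjoint (M.changed N₁) (M.changed N₂) := by
      rw [Finset.disjoint_left]
      intro i hi hi'
      exact (hd i).elim ((M.mem_changed N₁).1 hi) ((M.mem_changed N₂).1 hi')
    have hk : ((2 : ℕ) : ℝ) ≤ ((n : ℝ) ^ (1 / 60 : ℝ)) ^ 10 := by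
      have h1 := hy.le_scale
      have h2 := le_self_pow₀ (by linarith : 1 ≤ (n : ℝ) ^ (1 / 60 : ℝ)) (by norm_num : 10 ≠ 0)
      push_cast
      linarith
    have key := PerfectMatching.abs_probGivenStable_iInter_sub_prod_le (M := M) hn hy
      (k := 2) (F := ![N₁, N₂]) one_le_two hk
      (by
        intro a b hab
        fin_cases a <;> fin_cases b <;> simp_all [disjoint_comm])
      (by
        intro a
        fin_cases a
        · exact hcard _ h₁
        · exact hcard _ h₂)
    have hinter : ⋂ a : Fin 2, (![N₁, N₂] a).stable = N₁.stable ∩ N₂.stable := by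
      ext X
      simp [Fin.forall_fin_two]
    rw [hinter, Fin.prod_univ_two] at key
    refine key.trans (le_of_eq ?_)
    simp only [Matrix.cons_val_zero, Matrix.cons_val_one]
    push_cast
    ring
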